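/- Let $\Omega\subset\mathbb{R}^2$ be a smooth bounded domain with outward unit normal $n$, let $T>0$, and let $H(\Omega)$ be the closure in $L^2(\Omega;\mathbb{R}^2)$ of $\{w\in C_c^\infty(\Omega;\mathbb{R}^2):\operatorname{div}w=0\}$. A vector field $u\in L^\infty((0,T);H(\Omega))$ is called an *admissible weak solution* of the incompressible Euler equations with initial data $u^0\in H(\Omega)$ if for almost every $\tau\in(0,T)$ $$\int_0^\tau\int_\Omega \partial_t\phi\cdot u+\nabla\phi:(u\otimes u)\,dx\,dt=\int_\Omega u(x,\tau)\cdot\phi(x,\tau)-u^0(x)\cdot\phi(x,0)\,dx$$ for every $\phi\in C^1_c(\Omega\times[0,T];\mathbb{R}^2)$ with $\operatorname{div}\phi=0$, and if for almost every $\tau\in(0,T)$ $$\frac12\int_\Omega|u(x,\tau)|^2\,dx\le\frac12\int_\Omega|u^0(x)|^2\,dx .$$ **Theorem.** Let $U\in C^1(\overline{\Omega}\times[0,T];\mathbb{R}^2)$ be a solution of the incompressible Euler equations with slip boundary condition, that is, for some scalar pressure $p$, $$\partial_tU+\operatorname{div}(U\otimes U)+\nabla p=0,\qquad \operatorname{div}U=0\quad\text{in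 }\Omega\times(0,T),\qquad U\cdot n=0\quad\text{on }\partial\Omega\times[0,T],$$ with $U(\cdot,0)=u^0$. Let $u\in L^\infty((0,T);H(\Omega))$ be an admissible weak solution with the same initial data $u^0$, and suppose that $u$ is continuous in a neighbourhood of $\partial\Omega\times[0,T]$ in $\overline{\Omega}\times[0,T]$ (that is, it agrees almost everywhere in this neighbourhood with a function that is continuous there, up to the boundary). Then $u=U$ for almost every $(x,t)\in\Omega\times(0,T)$. -/

import Mathlib

open MeasureTheory Set
open scoped ContDiff

namespace Euler2D

/-- The Euclidean plane. -/
abbrev Plane : Type := EuclideanSpace ℝ (Fin 2)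

/-- `ρ` is a smooth defining function of `Ω` near the boundary point `x`: in a neighbourhood `V`
of `x`, `Ω` is the set where `ρ < 0`, and the gradient of `ρ` does not vanish at `x`. -/
def IsDefiningFunctionAt (Ω : Set Plane) (x : Plane) (ρ : Plane → ℝ) : Prop :=
  ContDiff ℝ ∞ ρ ∧ gradient ρ x ≠ 0 ∧
    ∃ V : Set Plane, IsOpen V ∧ x ∈ V ∧ ∀ y ∈ V, (y ∈ Ω ↔ ρ y < 0)

/-- A smooth bounded domain of the plane: a bounded, connected (in particular nonempty), open set
which near every boundary point lies on one side of its smooth boundary curve. -/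
structure IsSmoothBoundedDomain (Ω : Set Plane) : Prop where
  isOpen : IsOpen Ω
  isConnected : IsConnected Ω
  isBounded : Bornology.IsBounded Ω
  smooth_boundary : ∀ x ∈ frontier Ω, ∃ ρ : Plane → ℝ, IsDefiningFunctionAt Ω x ρ

/-- `n` is the outward unit normal of `Ω` at the boundary point `x`, i.e. `n = ∇ρ(x) / |∇ρ(x)|`
for a defining function `ρ` (the quotient does not depend on the choice of `ρ`). -/
def IsOuterUnitNormal (Ω : Set Plane) (x n : Plane) : Prop :=
  x ∈ frontier Ω ∧
    ∃ ρ : Plane → ℝ, IsDefiningFunctionAt Ω x ρ ∧ n = ‖gradient ρ x‖⁻¹ • gradient ρ x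

/-- The partial derivative `∂ⱼ f (x)` of a real function. -/
noncomputable def partialDeriv (j : Fin 2) (f : Plane → ℝ) (x : Plane) : ℝ :=
  fderiv ℝ f x (EuclideanSpace.single j 1)

/-- The divergence `∑ᵢ ∂ᵢ Vᵢ` of a vector field. -/
noncomputable def divergence (V : Plane → Plane) (x : Plane) : ℝ :=
  ∑ i, partialDeriv i (fun y => V y i) x

/-- The vector `div (V ⊗ V)`, with components `∑ⱼ ∂ⱼ (Vᵢ Vⱼ)`. -/
noncomputable def divTensorSelf (V : Plane → Plane) (x : Plane) : Plane :=
  WithLp.toLp 2 fun i => ∑ j, partialDeriv j (fun y => V y i * V y j) x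

/-- The scalar `∇V(x) : (a ⊗ a) = ∑ᵢⱼ ∂ⱼ Vᵢ(x) aᵢ aⱼ`. -/
noncomputable def gradContract (V : Plane → Plane) (x a : Plane) : ℝ :=
  ∑ i, ∑ j, partialDeriv j (fun y => V y i) x * (a i * a j)

/-- The space `H(Ω)`: the closure in `L²(Ω; ℝ²)` of the smooth divergence-free vector fields with
compact support in `Ω`. -/
def solenoidal (Ω : Set Plane) : Set (Lp Plane 2 (volume.restrict Ω)) :=
  closure {w | ∃ f : Plane → Plane, ContDiff ℝ ∞ f ∧ HasCompactSupport f ∧ tsupport f ⊆ Ω ∧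
    (∀ x, divergence f x = 0) ∧ w =ᵐ[volume.restrict Ω] f}

/-- The vector field `f` represents an element of `H(Ω)`. -/
def MemSolenoidal (Ω : Set Plane) (f : Plane → Plane) : Prop :=
  ∃ h : MemLp f 2 (volume.restrict Ω), h.toLp f ∈ solenoidal Ω

/-- The vector field `u` on `Ω × (0,T)` represents an element of `L^∞((0,T); H(Ω))`. -/
def MemLinftySolenoidal (Ω : Set Plane) (T : ℝ) (u : Plane × ℝ → Plane) : Prop :=
  AEStronglyMeasurable u (volume.restrict (Ω ×ˢ Ioo 0 T)) ∧
  (∀ᵐ t ∂(volume.restrict (Ioo 0 T)), MemSolenoidal Ω (fun x => u (x, t))) ∧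
  ∃ C : NNReal, ∀ᵐ t ∂(volume.restrict (Ioo 0 T)),
    eLpNorm (fun x => u (x, t)) 2 (volume.restrict Ω) ≤ C

/-- Test fields: `φ ∈ C¹_c(Ω × [0,T]; ℝ²)` with `div φ = 0`. The support is compact in `Ω × [0,T]`,
so `φ` need not vanish at the times `0` and `T`. -/
structure IsTestField (Ω : Set Plane) (T : ℝ) (φ : Plane × ℝ → Plane) : Prop where
  contDiffOn : ContDiffOn ℝ 1 φ (Ω ×ˢ Icc 0 T)
  compact_support : ∃ K : Set Plane, IsCompact K ∧ K ⊆ Ω ∧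
    ∀ x ∈ Ω, x ∉ K → ∀ t ∈ Icc 0 T, φ (x, t) = 0
  div_free : ∀ x ∈ Ω, ∀ t ∈ Icc 0 T, divergence (fun y => φ (y, t)) x = 0

/-- Admissible weak solutions in `L^∞((0,T); H(Ω))` of the incompressible Euler equations on
`Ω × [0,T]` with initial datum `u₀ ∈ H(Ω)`. -/
structure IsAdmissibleWeakSolution (Ω : Set Plane) (T : ℝ) (u₀ : Plane → Plane)
    (u : Plane × ℝ → Plane) : Prop where
  initial_mem : MemSolenoidal Ω u₀
  mem : MemLinftySolenoidal Ω T u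
  weak_form : ∀ᵐ τ ∂(volume.restrict (Ioo 0 T)), ∀ φ : Plane × ℝ → Plane, IsTestField Ω T φ →
    ∫ t in (0 : ℝ)..τ, ∫ x in Ω,
        (inner ℝ (deriv (fun s => φ (x, s)) t) (u (x, t))
          + gradContract (fun y => φ (y, t)) x (u (x, t)))
      = ∫ x in Ω, (inner ℝ (u (x, τ)) (φ (x, τ)) - inner ℝ (u₀ x) (φ (x, 0)))
  energy_ineq : ∀ᵐ τ ∂(volume.restrict (Ioo 0 T)),
    1 / 2 * ∫ x in Ω, ‖u (x, τ)‖ ^ 2 ≤ 1 / 2 * ∫ x in Ω, ‖u₀ x‖ ^ 2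

/-- Solutions `U ∈ C¹(closure Ω × [0,T])` of the incompressible Euler equations
`∂ₜU + div (U ⊗ U) + ∇p = 0`, `div U = 0` in `Ω`, with the slip condition `U · n = 0` on `∂Ω`. -/
structure IsStrongSolution (Ω : Set Plane) (T : ℝ) (U : Plane × ℝ → Plane) : Prop where
  contDiffOn : ContDiffOn ℝ 1 U (closure Ω ×ˢ Icc 0 T)
  momentum : ∃ p : Plane × ℝ → ℝ, ∀ x ∈ Ω, ∀ t ∈ Ioo 0 T,
    DifferentiableAt ℝ (fun y => p (y, t)) x ∧
    deriv (fun s => U (x, s)) t + divTensorSelf (fun y => U (y, t)) x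
      + gradient (fun y => p (y, t)) x = 0
  div_free : ∀ x ∈ Ω, ∀ t ∈ Icc 0 T, divergence (fun y => U (y, t)) x = 0
  slip : ∀ x ∈ frontier Ω, ∀ t ∈ Icc 0 T, ∀ n, IsOuterUnitNormal Ω x n → inner ℝ (U (x, t)) n = 0

/-- The class `u` (a vector field on `Ω × (0,T)` up to null sets) is continuous in a neighbourhood
of `∂Ω × [0,T]`: in a relatively open neighbourhood of `∂Ω × [0,T]` in `closure Ω × [0,T]` it has a
representative that is continuous there, up to the boundary. -/
def IsContinuousNearBoundary (Ω : Set Plane) (T : ℝ) (u : Plane × ℝ → Plane) : Prop :=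
  ∃ (N : Set (Plane × ℝ)) (v : Plane × ℝ → Plane), IsOpen N ∧ frontier Ω ×ˢ Icc 0 T ⊆ N ∧
    ContinuousOn v (N ∩ closure Ω ×ˢ Icc 0 T) ∧
    v =ᵐ[volume.restrict (N ∩ Ω ×ˢ Ioo 0 T)] u

end Euler2D

/-!
Weak-strong uniqueness by the relative energy method. Write `w = u - U` and
`F(τ) = ∫_Ω |w(τ)|²`. If the weak formulation of `u` may be tested with `U`, then the energy
inequality for `u` and the energy balance of `U` combine to
`F(τ) ≤ -2 ∫₀^τ ∫_Ω (DU w) · w ≤ 2 ‖DU‖_∞ ∫₀^τ F` (`IsStrongSolution.relative_energy_le`): the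
pressure gradient and `∇|U|²` drop out, since fields in `H(Ω)` and tangential divergence-free
fields are orthogonal to bounded gradients. Grönwall's inequality gives `F = 0`.

The point is that `U` is only tangential to the boundary and not compactly supported. Near a
boundary point, let `ρ` be a defining function; since `U` is divergence-free and tangential, it has
a stream function `ψ` that vanishes on the boundary, so `ψ = O(|ρ|)`
(`IsBoundaryChart.exists_stream`). Any two of these local stream functions agree near the boundary,
and they are cut off by a partition of unity near the boundary. For a cut-off `θ` equal to one near
zero, the field with stream function `θ(nρ) ψ` carries the boundary values of `U` into a layer of
width `O(1/n)`; it is bounded together with its time derivative, and its spatial gradient is of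
order `n`. That is too large in general, but each term of order `n` in the contraction of
the gradient with `u ⊗ u` contains the component along `∇ρ` of `u` or of `U`. By hypothesis `u` is
continuous up to the boundary, and its normal trace is zero because `u(t) ∈ H(Ω)`
(`MemSolenoidal.inner_gradient_eq_zero`). So these components are uniformly small in the layer, and
the layer contributes nothing to the weak formulation as `n → ∞` (`IsLayerField.tendsto_transport`,
`exists_isNegligible`). Subtracting the layers from `U` leaves admissible test fields, and
`IsStrongSolution.weak_form` follows in the limit.

As `U` is `C¹` on the closed time interval only, the argument is run for `U(x, λ(t))`, with `λ`
an affine map of `[0,T]` into `(0,T)`, which is then sent to the identity.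
-/

/-! ### Calculus in the plane -/

namespace Euler2D

open Filter Topology

/-- The rotation of the plane by a right angle, `(a, b) ↦ (-b, a)`. -/
noncomputable def rot : Plane →L[ℝ] Plane :=
  LinearMap.toContinuousLinearMap
    { toFun := fun v => !₂[-v 1, v 0]
      map_add' := by
        intro v w; ext i; fin_cases i <;> simp [add_comm]
      map_smul' := by
        intro c v; ext i; fin_cases i <;> simp }

@[simp] lemma rot_zero_coord (v : Plane) : rot v 0 = -v 1 := by simp [rot]

@[simp] lemma rot_one_coord (v : Plane) : rot v 1 = v 0 := by simp [rot]

lemma inner_coords (v w : Plane) : inner ℝ v w = v 0 * w 0 + v 1 * w 1 := by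
  simp [PiLp.inner_apply, Fin.sum_univ_two, mul_comm]

lemma inner_rot_left (v w : Plane) : inner ℝ (rot v) w = -inner ℝ v (rot w) := by
  simp only [inner_coords, rot_zero_coord, rot_one_coord]; ring

@[simp] lemma inner_rot_rot (v w : Plane) : inner ℝ (rot v) (rot w) = inner ℝ v w := by
  simp only [inner_coords, rot_zero_coord, rot_one_coord]; ring

@[simp] lemma norm_rot (v : Plane) : ‖rot v‖ = ‖v‖ := by
  rw [norm_eq_sqrt_real_inner, inner_rot_rot, ← norm_eq_sqrt_real_inner]

lemma eq_coords (v : Plane) :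
    v = v 0 • EuclideanSpace.single 0 1 + v 1 • EuclideanSpace.single 1 1 := by
  ext i; fin_cases i <;> simp

/-- In the plane, two vectors that are both almost orthogonal to `g` are almost parallel: an
identity controlling `⟨v, rot a⟩` by the components of `v` and `a` along `g`. -/
lemma inner_rot_mul_norm_sq (v a g : Plane) :
    inner ℝ v (rot a) * ‖g‖ ^ 2
      = inner ℝ g v * inner ℝ g (rot a) - inner ℝ g a * inner ℝ g (rot v) := by
  rw [← real_inner_self_eq_norm_sq]
  simp only [inner_coords, rot_zero_coord, rot_one_coord]; ring

lemma abs_inner_rot_mul_norm_le {v a g : Plane} :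
    |inner ℝ v (rot a)| * ‖g‖ ^ 2
      ≤ ‖g‖ * (‖a‖ * |inner ℝ g v| + ‖v‖ * |inner ℝ g a|) := by
  have h := inner_rot_mul_norm_sq v a g
  have h1 : |inner ℝ g (rot a)| ≤ ‖g‖ * ‖a‖ := by
    simpa using abs_real_inner_le_norm g (rot a)
  have h2 : |inner ℝ g (rot v)| ≤ ‖g‖ * ‖v‖ := by
    simpa using abs_real_inner_le_norm g (rot v)
  calc |inner ℝ v (rot a)| * ‖g‖ ^ 2 = |inner ℝ v (rot a) * ‖g‖ ^ 2| := by
        rw [abs_mul, abs_of_nonneg (sq_nonneg ‖g‖)]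
    _ ≤ |inner ℝ g v| * |inner ℝ g (rot a)| + |inner ℝ g a| * |inner ℝ g (rot v)| := by
        rw [h, ← abs_mul, ← abs_mul]; exact abs_sub _ _
    _ ≤ |inner ℝ g v| * (‖g‖ * ‖a‖) + |inner ℝ g a| * (‖g‖ * ‖v‖) := by gcongr
    _ = _ := by ring

/-- The trace of an endomorphism of the plane. -/
noncomputable def planeTrace (A : Plane →L[ℝ] Plane) : ℝ :=
  ∑ i : Fin 2, A (EuclideanSpace.single i 1) i

lemma apply_coords (A : Plane →L[ℝ] Plane) (v : Plane) (i : Fin 2) :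
    A v i = v 0 * A (EuclideanSpace.single 0 1) i + v 1 * A (EuclideanSpace.single 1 1) i := by
  conv_lhs => rw [eq_coords v]
  simp

/-- For a trace-free endomorphism `A` of the plane, `rot ∘ A` is symmetric. -/
lemma inner_rot_apply_comm {A : Plane →L[ℝ] Plane} (hA : planeTrace A = 0) (v w : Plane) :
    inner ℝ (rot (A v)) w = inner ℝ (rot (A w)) v := by
  simp only [planeTrace, Fin.sum_univ_two] at hA
  simp only [inner_coords, rot_zero_coord, rot_one_coord, apply_coords A v, apply_coords A w]
  linear_combination (w 1 * v 0 - v 1 * w 0) * hA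

section bridging

variable {F : Type*} [NormedAddCommGroup F] [NormedSpace ℝ F]

/-- The derivative in the space variable of a function on space-time. -/
noncomputable def spaceDeriv (V : Plane × ℝ → F) (z : Plane × ℝ) : Plane →L[ℝ] F :=
  (fderiv ℝ V z).comp (ContinuousLinearMap.inl ℝ Plane ℝ)

/-- The derivative in the time variable of a function on space-time. -/
noncomputable def timeDeriv (V : Plane × ℝ → F) (z : Plane × ℝ) : F :=
  fderiv ℝ V z (0, 1)

lemma spaceDeriv_apply (V : Plane × ℝ → F) (z : Plane × ℝ) (a : Plane) :
    spaceDeriv V z a = fderiv ℝ V z (a, 0) := rfl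

lemma norm_spaceDeriv_le (V : Plane × ℝ → F) (z : Plane × ℝ) :
    ‖spaceDeriv V z‖ ≤ ‖fderiv ℝ V z‖ := by
  refine ContinuousLinearMap.opNorm_le_bound _ (norm_nonneg _) fun a => ?_
  refine ((fderiv ℝ V z).le_opNorm (a, 0)).trans ?_
  simp

lemma norm_timeDeriv_le (V : Plane × ℝ → F) (z : Plane × ℝ) :
    ‖timeDeriv V z‖ ≤ ‖fderiv ℝ V z‖ := by
  refine ((fderiv ℝ V z).le_opNorm (0, 1)).trans ?_
  simp

lemma hasFDerivAt_spaceSlice {V : Plane × ℝ → F} {x : Plane} {t : ℝ}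
    (h : DifferentiableAt ℝ V (x, t)) :
    HasFDerivAt (fun y => V (y, t)) (spaceDeriv V (x, t)) x :=
  h.hasFDerivAt.comp x (hasFDerivAt_prodMk_left x t)

lemma hasDerivAt_timeSlice {V : Plane × ℝ → F} {x : Plane} {t : ℝ}
    (h : DifferentiableAt ℝ V (x, t)) :
    HasDerivAt (fun s => V (x, s)) (timeDeriv V (x, t)) t := by
  have h1 := (h.hasFDerivAt.comp t (hasFDerivAt_prodMk_right x t)).hasDerivAt
  simpa [timeDeriv, Function.comp_def] using h1

lemma spaceDeriv_congr {V W : Plane × ℝ → F} {z : Plane × ℝ} (h : V =ᶠ[𝓝 z] W) :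
    spaceDeriv V z = spaceDeriv W z := by
  rw [spaceDeriv, h.fderiv_eq]; rfl

lemma timeDeriv_congr {V W : Plane × ℝ → F} {z : Plane × ℝ} (h : V =ᶠ[𝓝 z] W) :
    timeDeriv V z = timeDeriv W z := by
  rw [timeDeriv, h.fderiv_eq]; rfl

end bridging

lemma partialDeriv_comp {V : Plane → Plane} {A : Plane →L[ℝ] Plane} {x : Plane}
    (h : HasFDerivAt V A x) (i j : Fin 2) :
    partialDeriv j (fun y => V y i) x = A (EuclideanSpace.single j 1) i := by
  have h1 : HasFDerivAt (fun y => V y i) ((EuclideanSpace.proj i).comp A) x :=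
    (EuclideanSpace.proj i : Plane →L[ℝ] ℝ).hasFDerivAt.comp x h
  rw [partialDeriv, h1.fderiv]; rfl

lemma divergence_eq {V : Plane → Plane} {A : Plane →L[ℝ] Plane} {x : Plane}
    (h : HasFDerivAt V A x) : divergence V x = planeTrace A := by
  simp only [divergence, partialDeriv_comp h, planeTrace]

lemma gradContract_eq {V : Plane → Plane} {A : Plane →L[ℝ] Plane} {x : Plane}
    (h : HasFDerivAt V A x) (a : Plane) : gradContract V x a = inner ℝ (A a) a := by
  simp only [gradContract, partialDeriv_comp h, inner_coords, apply_coords A a, Fin.sum_univ_two]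
  ring

/-- For a divergence-free field, `div (V ⊗ V) = (V · ∇) V`. -/
lemma divTensorSelf_eq {V : Plane → Plane} {A : Plane →L[ℝ] Plane} {x : Plane}
    (h : HasFDerivAt V A x) (hA : planeTrace A = 0) : divTensorSelf V x = A (V x) := by
  have h1 : ∀ i : Fin 2, HasFDerivAt (fun y => V y i) ((EuclideanSpace.proj i).comp A) x :=
    fun i => (EuclideanSpace.proj i : Plane →L[ℝ] ℝ).hasFDerivAt.comp x h
  simp only [planeTrace, Fin.sum_univ_two] at hA
  ext i
  simp only [divTensorSelf, partialDeriv, Fin.sum_univ_two]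
  have h2 : ∀ j : Fin 2, fderiv ℝ (fun y => V y i * V y j) x = _ :=
    fun j => ((h1 i).mul (h1 j)).fderiv
  rw [h2, h2, apply_coords A (V x) i]
  simp only [add_apply, smul_apply,
    ContinuousLinearMap.comp_apply, PiLp.proj_apply, smul_eq_mul]
  linear_combination V x i * hA

lemma divergence_spaceSlice {V : Plane × ℝ → Plane} {x : Plane} {t : ℝ}
    (h : DifferentiableAt ℝ V (x, t)) :
    divergence (fun y => V (y, t)) x = planeTrace (spaceDeriv V (x, t)) :=
  divergence_eq (hasFDerivAt_spaceSlice h)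

lemma gradContract_spaceSlice {V : Plane × ℝ → Plane} {x : Plane} {t : ℝ}
    (h : DifferentiableAt ℝ V (x, t)) (a : Plane) :
    gradContract (fun y => V (y, t)) x a = inner ℝ (spaceDeriv V (x, t) a) a :=
  gradContract_eq (hasFDerivAt_spaceSlice h) a

lemma contDiff_gradient {m : Plane → ℝ} (h : ContDiff ℝ ∞ m) : ContDiff ℝ ∞ (gradient m) := by
  have h1 : ContDiff ℝ ∞ (fderiv ℝ m) := h.fderiv_right (by simp)
  exact (InnerProductSpace.toDual ℝ Plane).symm.toContinuousLinearEquiv.contDiff.comp h1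

lemma fderiv_gradient_symm {m : Plane → ℝ} (h : ContDiff ℝ ∞ m) (x a b : Plane) :
    inner ℝ (fderiv ℝ (gradient m) x a) b = inner ℝ (fderiv ℝ (gradient m) x b) a := by
  have hs : IsSymmSndFDerivAt ℝ m x := by
    apply h.contDiffAt.isSymmSndFDerivAt
    simp only [minSmoothness_of_isRCLikeNormedField]
    exact WithTop.coe_le_coe.2 le_top
  have hd : DifferentiableAt ℝ (fderiv ℝ m) x :=
    ((h.fderiv_right (m := ∞) (by simp)).differentiable (by simp)) x
  have hg : DifferentiableAt ℝ (gradient m) x := (contDiff_gradient h).differentiable (by simp) x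
  have key : ∀ c d : Plane, inner ℝ (fderiv ℝ (gradient m) x c) d = fderiv ℝ (fderiv ℝ m) x c d := by
    intro c d
    have h1 : HasFDerivAt (fun y => fderiv ℝ m y d)
        ((ContinuousLinearMap.apply ℝ ℝ d).comp (fderiv ℝ (fderiv ℝ m) x)) x :=
      (ContinuousLinearMap.apply ℝ ℝ d).hasFDerivAt.comp x hd.hasFDerivAt
    have h2 : HasFDerivAt (fun y => fderiv ℝ m y d)
        ((innerSL ℝ d).comp (fderiv ℝ (gradient m) x)) x := by
      refine ((innerSL ℝ d).hasFDerivAt.comp x hg.hasFDerivAt).congr_of_eventuallyEq ?_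
      exact Eventually.of_forall fun y => by
        simp only [Function.comp_apply, innerSL_apply_apply]
        rw [real_inner_comm, inner_gradient_left]
    have h3 := congrArg (fun L : Plane →L[ℝ] ℝ => L c) (h2.unique h1)
    simpa [real_inner_comm] using h3
  rw [key, key]; exact hs a b

end Euler2D

/-! ### Stream functions -/

namespace Euler2D

open Filter Topology

/-- On the open subset `O` of space-time, `ψ` is a `C¹` stream function of the `C¹` divergence-free
field `V`, that is `V = rot (∇ψ)`; the relation is stated as `∂ₐψ = ⟨V, rot a⟩`. -/
structure IsStreamPair (O : Set (Plane × ℝ)) (ψ : Plane × ℝ → ℝ) (V : Plane × ℝ → Plane) :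
    Prop where
  contDiffOn_stream : ContDiffOn ℝ 1 ψ O
  contDiffOn_field : ContDiffOn ℝ 1 V O
  spaceDeriv_stream : ∀ z ∈ O, ∀ a, spaceDeriv ψ z a = inner ℝ (V z) (rot a)
  trace_eq_zero : ∀ z ∈ O, planeTrace (spaceDeriv V z) = 0

/-- The field with stream function `m ψ`, for a cut-off `m` depending on space alone, when `V` has
stream function `ψ`. -/
noncomputable def cutField (m : Plane → ℝ) (ψ : Plane × ℝ → ℝ) (V : Plane × ℝ → Plane)
    (z : Plane × ℝ) : Plane :=
  m z.1 • V z + ψ z • rot (gradient m z.1)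

section
variable {m : Plane → ℝ} {ψ : Plane × ℝ → ℝ} {V : Plane × ℝ → Plane} {z : Plane × ℝ}

lemma hasFDerivAt_comp_fst {F : Type*} [NormedAddCommGroup F] [NormedSpace ℝ F] {f : Plane → F}
    (h : DifferentiableAt ℝ f z.1) :
    HasFDerivAt (fun w : Plane × ℝ => f w.1)
      ((fderiv ℝ f z.1).comp (ContinuousLinearMap.fst ℝ Plane ℝ)) z :=
  h.hasFDerivAt.comp z hasFDerivAt_fst

lemma hasFDerivAt_cutField (hm : ContDiff ℝ ∞ m) (hψ : DifferentiableAt ℝ ψ z)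
    (hV : DifferentiableAt ℝ V z) :
    HasFDerivAt (cutField m ψ V)
      ((m z.1 • fderiv ℝ V z
          + ((fderiv ℝ m z.1).comp (ContinuousLinearMap.fst ℝ Plane ℝ)).smulRight (V z))
        + (ψ z • (rot.comp
            ((fderiv ℝ (gradient m) z.1).comp (ContinuousLinearMap.fst ℝ Plane ℝ)))
          + (fderiv ℝ ψ z).smulRight (rot (gradient m z.1)))) z := by
  have h1 := hasFDerivAt_comp_fst (z := z) (hm.differentiable (by simp) z.1)
  have h2 := hasFDerivAt_comp_fst (z := z)
    ((contDiff_gradient hm).differentiable (by simp) z.1)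
  exact (h1.smul hV.hasFDerivAt).add (hψ.hasFDerivAt.smul (rot.hasFDerivAt.comp z h2))

lemma spaceDeriv_cutField (hm : ContDiff ℝ ∞ m) (hψ : DifferentiableAt ℝ ψ z)
    (hV : DifferentiableAt ℝ V z) (a : Plane) :
    spaceDeriv (cutField m ψ V) z a
      = (m z.1 • spaceDeriv V z a + inner ℝ (gradient m z.1) a • V z)
        + (ψ z • rot (fderiv ℝ (gradient m) z.1 a)
          + spaceDeriv ψ z a • rot (gradient m z.1)) := by
  rw [spaceDeriv_apply, (hasFDerivAt_cutField hm hψ hV).fderiv]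
  simp [spaceDeriv_apply, inner_gradient_left]

lemma timeDeriv_cutField (hm : ContDiff ℝ ∞ m) (hψ : DifferentiableAt ℝ ψ z)
    (hV : DifferentiableAt ℝ V z) :
    timeDeriv (cutField m ψ V) z
      = m z.1 • timeDeriv V z + timeDeriv ψ z • rot (gradient m z.1) := by
  rw [timeDeriv, (hasFDerivAt_cutField hm hψ hV).fderiv]
  simp [timeDeriv]

lemma spaceDeriv_mul_stream (hm : ContDiff ℝ ∞ m) (hψ : DifferentiableAt ℝ ψ z) (a : Plane) :
    spaceDeriv (fun w => m w.1 * ψ w) z a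
      = m z.1 * spaceDeriv ψ z a + ψ z * inner ℝ (gradient m z.1) a := by
  have h1 : HasFDerivAt (fun w => m w.1 * ψ w) _ z :=
    (hasFDerivAt_comp_fst (z := z) (hm.differentiable (by simp) z.1)).mul hψ.hasFDerivAt
  rw [spaceDeriv_apply, h1.fderiv]
  simp [spaceDeriv_apply, inner_gradient_left]

lemma timeDeriv_mul_stream (hm : ContDiff ℝ ∞ m) (hψ : DifferentiableAt ℝ ψ z) :
    timeDeriv (fun w => m w.1 * ψ w) z = m z.1 * timeDeriv ψ z := by
  have h1 : HasFDerivAt (fun w => m w.1 * ψ w) _ z :=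
    (hasFDerivAt_comp_fst (z := z) (hm.differentiable (by simp) z.1)).mul hψ.hasFDerivAt
  rw [timeDeriv, h1.fderiv]
  simp [timeDeriv]

lemma IsStreamPair.cutField {O : Set (Plane × ℝ)} (hO : IsOpen O) (h : IsStreamPair O ψ V)
    (hm : ContDiff ℝ ∞ m) : IsStreamPair O (fun w => m w.1 * ψ w) (cutField m ψ V) := by
  have hψ : ∀ z ∈ O, DifferentiableAt ℝ ψ z := fun z hz =>
    (h.contDiffOn_stream.contDiffAt (hO.mem_nhds hz)).differentiableAt (by simp)
  have hV : ∀ z ∈ O, DifferentiableAt ℝ V z := fun z hz =>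
    (h.contDiffOn_field.contDiffAt (hO.mem_nhds hz)).differentiableAt (by simp)
  have hm1 : ContDiff ℝ 1 (fun w : Plane × ℝ => m w.1) :=
    (hm.of_le (by simp)).comp contDiff_fst
  have hm2 : ContDiff ℝ 1 (fun w : Plane × ℝ => rot (gradient m w.1)) :=
    rot.contDiff.comp (((contDiff_gradient hm).of_le (by simp)).comp contDiff_fst)
  refine ⟨hm1.contDiffOn.mul h.contDiffOn_stream,
    (hm1.contDiffOn.smul h.contDiffOn_field).add (h.contDiffOn_stream.smul hm2.contDiffOn),
    fun z hz a => ?_, fun z hz => ?_⟩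
  · rw [spaceDeriv_mul_stream hm (hψ z hz), h.spaceDeriv_stream z hz]
    simp [Euler2D.cutField, inner_add_left, real_inner_smul_left]
  · have hs := fderiv_gradient_symm hm z.1 (EuclideanSpace.single 0 1) (EuclideanSpace.single 1 1)
    have ht := h.trace_eq_zero z hz
    simp only [planeTrace, Fin.sum_univ_two] at ht ⊢
    simp only [spaceDeriv_cutField hm (hψ z hz) (hV z hz), h.spaceDeriv_stream z hz]
    simp [inner_coords, -inner_gradient_left] at hs ⊢
    linear_combination m z.1 * ht - ψ z * hs
end

end Euler2D

/-! ### Boundary charts -/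

namespace Euler2D

open Filter Topology

lemma eq_zero_of_mem_frontier {Ω V : Set Plane} {ρ : Plane → ℝ} (hΩ : IsOpen Ω) (hV : IsOpen V)
    (hρ : Continuous ρ) (h : ∀ y ∈ V, (y ∈ Ω ↔ ρ y < 0)) {z : Plane} (hzV : z ∈ V)
    (hz : z ∈ frontier Ω) : ρ z = 0 := by
  have hzΩ : z ∉ Ω := by
    rw [hΩ.frontier_eq] at hz; exact hz.2
  refine le_antisymm ?_ (not_lt.1 fun hlt => hzΩ ((h z hzV).2 hlt))
  by_contra! hpos
  obtain ⟨y, ⟨hyV, hy⟩, hyΩ⟩ := mem_closure_iff.1 (frontier_subset_closure hz) _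
    (hV.inter (isOpen_lt continuous_const hρ)) ⟨hzV, hpos⟩
  exact absurd ((h y hyV).1 hyΩ) (not_lt.2 (le_of_lt hy))

/-- Local coordinates of `Ω` near the boundary point `z`. On the ball of radius `R`, `Ω` is the
set where `ρ < 0`, and `ρ` grows in the unit direction `e` at a rate at least `c`; on the ball of
radius `r`, `y + β(y) e` is the boundary point on the line through `y` of direction `e`. -/
structure IsBoundaryChart (Ω : Set Plane) (z : Plane) (R r : ℝ) (ρ : Plane → ℝ) (e : Plane)
    (β : Plane → ℝ) (c : ℝ) : Prop where
  mem_frontier : z ∈ frontier Ω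
  r_pos : 0 < r
  c_pos : 0 < c
  smooth : ContDiff ℝ ∞ ρ
  mem_iff : ∀ y ∈ Metric.ball z R, (y ∈ Ω ↔ ρ y < 0)
  norm_dir : ‖e‖ = 1
  le_inner : ∀ y ∈ Metric.ball z R, c ≤ inner ℝ (gradient ρ y) e
  contDiffOn_height : ContDiffOn ℝ 1 β (Metric.ball z r)
  root : ∀ y ∈ Metric.ball z r, ρ (y + β y • e) = 0
  height_lt : ∀ y ∈ Metric.ball z r, |β y| < R - r

theorem exists_isBoundaryChart {Ω : Set Plane} {z : Plane} (hΩ : IsSmoothBoundedDomain Ω)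
    (hz : z ∈ frontier Ω) {r₀ : ℝ} (hr₀ : 0 < r₀) :
    ∃ R r ρ e β c, R ≤ r₀ ∧ IsBoundaryChart Ω z R r ρ e β c := by
  obtain ⟨ρ, hρ, hne, V, hVo, hzV, hV⟩ := hΩ.smooth_boundary z hz
  have hρz : ρ z = 0 := eq_zero_of_mem_frontier hΩ.isOpen hVo hρ.continuous hV hzV hz
  set g := gradient ρ z with hg
  have hgpos : 0 < ‖g‖ := norm_pos_iff.2 hne
  set e : Plane := ‖g‖⁻¹ • g with he
  have hge : inner ℝ g e = ‖g‖ := by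
    rw [he, real_inner_smul_right, real_inner_self_eq_norm_sq]; field_simp
  have hnorm : ‖e‖ = 1 := by
    rw [he, norm_smul, norm_inv, norm_norm, inv_mul_cancel₀ hgpos.ne']
  -- the implicit equation for the height above `x`
  set Φ : Plane × ℝ → ℝ := fun w => ρ (w.1 + w.2 • e) with hΦ
  have hΦs : ContDiff ℝ ∞ Φ := hρ.comp (contDiff_fst.add (contDiff_snd.smul contDiff_const))
  have hΦ1 : ContDiffAt ℝ 1 Φ (z, 0) := (hΦs.of_le (by simp)).contDiffAt
  have hΦd : HasFDerivAt Φ ((fderiv ℝ ρ z).comp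
      (ContinuousLinearMap.fst ℝ Plane ℝ + (ContinuousLinearMap.snd ℝ Plane ℝ).smulRight e))
      (z, 0) := by
    have h1 : HasFDerivAt (fun w : Plane × ℝ => w.1 + w.2 • e)
        (ContinuousLinearMap.fst ℝ Plane ℝ + (ContinuousLinearMap.snd ℝ Plane ℝ).smulRight e)
        (z, 0) := hasFDerivAt_fst.add (hasFDerivAt_snd.smul_const e)
    have h2 : HasFDerivAt ρ (fderiv ℝ ρ z) ((z, (0 : ℝ)).1 + (z, (0 : ℝ)).2 • e) := by
      simpa using (hρ.differentiable (by simp) z).hasFDerivAt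
    exact h2.comp (z, (0 : ℝ)) h1
  have hinv : (fderiv ℝ Φ (z, 0) ∘L .inr ℝ Plane ℝ).IsInvertible := by
    refine ⟨ContinuousLinearEquiv.unitsEquivAut ℝ (Units.mk0 ‖g‖ hgpos.ne'), ?_⟩
    ext
    rw [hΦd.fderiv]
    simp only [ContinuousLinearEquiv.coe_coe, ContinuousLinearEquiv.unitsEquivAut_apply,
      Units.val_mk0, ContinuousLinearMap.comp_apply, ContinuousLinearMap.inr_apply]
    simp only [add_apply, ContinuousLinearMap.coe_fst', zero_add,
      ContinuousLinearMap.smulRight_apply, ContinuousLinearMap.coe_snd', one_smul]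
    rw [← inner_gradient_left, ← hg, hge]; simp
  set β := hΦ1.implicitFunction one_ne_zero hinv with hβ
  have hβz : β z = 0 := hΦ1.implicitFunction_apply_self one_ne_zero hinv
  have hβroot : ∀ᶠ x in 𝓝 z, Φ (x, β x) = Φ (z, 0) :=
    hΦ1.eventually_apply_implicitFunction one_ne_zero hinv
  have hβc : ContDiffAt ℝ 1 β z := hΦ1.contDiffAt_implicitFunction one_ne_zero hinv
  have hβev : ∀ᶠ x in 𝓝 z, ContDiffAt ℝ 1 β x := hβc.eventually (by simp)
  have hinner : ∀ᶠ x in 𝓝 z, ‖g‖ / 2 < inner ℝ (gradient ρ x) e := by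
    have hcont : Continuous fun x => inner ℝ (gradient ρ x) e :=
      (contDiff_gradient hρ).continuous.inner continuous_const
    refine hcont.continuousAt.eventually (lt_mem_nhds ?_)
    simp only [← hg, hge]; linarith
  obtain ⟨r₁, hr₁, h₁⟩ := Metric.eventually_nhds_iff_ball.1 (hinner.and (hVo.mem_nhds hzV))
  set R := min r₀ r₁
  have hR : 0 < R := lt_min hr₀ hr₁
  have hβsmall : ∀ᶠ x in 𝓝 z, |β x| < R / 2 := by
    have : Tendsto (fun x => |β x|) (𝓝 z) (𝓝 |β z|) := hβc.continuousAt.abs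
    refine this.eventually (gt_mem_nhds ?_)
    rw [hβz, abs_zero]; linarith
  obtain ⟨r₃, hr₃, h₃⟩ := Metric.eventually_nhds_iff_ball.1 (hβroot.and (hβev.and hβsmall))
  have hsub : ∀ y ∈ Metric.ball z R, y ∈ Metric.ball z r₁ := fun y hy =>
    Metric.ball_subset_ball (min_le_right _ _) hy
  have hsub' : ∀ y ∈ Metric.ball z (min (R / 2) r₃), y ∈ Metric.ball z r₃ := fun y hy =>
    Metric.ball_subset_ball (min_le_right _ _) hy
  refine ⟨R, min (R / 2) r₃, ρ, e, β, ‖g‖ / 2, min_le_left _ _, hz, lt_min (by linarith) hr₃,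
    by positivity, hρ, fun y hy => hV y (h₁ y (hsub y hy)).2, hnorm,
    fun y hy => (h₁ y (hsub y hy)).1.le,
    fun y hy => (h₃ y (hsub' y hy)).2.1.contDiffWithinAt, fun y hy => ?_, fun y hy => ?_⟩
  · have := (h₃ y (hsub' y hy)).1
    simpa [hΦ, hρz] using this
  · have h1 := (h₃ y (hsub' y hy)).2.2
    have h2 : min (R / 2) r₃ ≤ R / 2 := min_le_left _ _
    linarith

namespace IsBoundaryChart

variable {Ω : Set Plane} {z : Plane} {R r : ℝ} {ρ : Plane → ℝ} {e : Plane} {β : Plane → ℝ} {c : ℝ}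

lemma r_lt (h : IsBoundaryChart Ω z R r ρ e β c) : r < R := by
  have := h.height_lt z (Metric.mem_ball_self h.r_pos)
  linarith [abs_nonneg (β z)]

lemma ball_subset (h : IsBoundaryChart Ω z R r ρ e β c) : Metric.ball z r ⊆ Metric.ball z R :=
  Metric.ball_subset_ball h.r_lt.le

lemma closedBall_subset (h : IsBoundaryChart Ω z R r ρ e β c) :
    Metric.closedBall z r ⊆ Metric.ball z R :=
  Metric.closedBall_subset_ball h.r_lt

lemma eq_zero_of_frontier (h : IsBoundaryChart Ω z R r ρ e β c) (hΩ : IsOpen Ω) {y : Plane}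
    (hy : y ∈ Metric.ball z R) (hyf : y ∈ frontier Ω) : ρ y = 0 :=
  eq_zero_of_mem_frontier hΩ Metric.isOpen_ball h.smooth.continuous h.mem_iff hy hyf

lemma mem_frontier_of_eq_zero (h : IsBoundaryChart Ω z R r ρ e β c) (hΩ : IsOpen Ω) {y : Plane}
    (hy : y ∈ Metric.ball z R) (hyc : y ∈ closure Ω) (hy0 : ρ y = 0) : y ∈ frontier Ω := by
  rw [hΩ.frontier_eq]
  exact ⟨hyc, fun hmem => by have := (h.mem_iff y hy).1 hmem; linarith⟩

lemma gradient_ne_zero (h : IsBoundaryChart Ω z R r ρ e β c) {y : Plane}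
    (hy : y ∈ Metric.ball z R) : gradient ρ y ≠ 0 := by
  intro h0
  have := h.le_inner y hy
  rw [h0, inner_zero_left] at this
  linarith [h.c_pos]

lemma le_norm_gradient (h : IsBoundaryChart Ω z R r ρ e β c) {y : Plane}
    (hy : y ∈ Metric.ball z R) : c ≤ ‖gradient ρ y‖ := by
  have := (h.le_inner y hy).trans (real_inner_le_norm _ _)
  rwa [h.norm_dir, mul_one] at this

lemma isDefiningFunctionAt (h : IsBoundaryChart Ω z R r ρ e β c) {y : Plane}
    (hy : y ∈ Metric.ball z R) : IsDefiningFunctionAt Ω y ρ :=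
  ⟨h.smooth, h.gradient_ne_zero hy, _, Metric.isOpen_ball, hy, h.mem_iff⟩

/-- The defining function grows at a rate at least `c` along the direction of the chart. -/
lemma mul_le_sub (h : IsBoundaryChart Ω z R r ρ e β c) {y : Plane} {s : ℝ} (hs : 0 ≤ s)
    (hy : y ∈ Metric.ball z R) (hys : y + s • e ∈ Metric.ball z R) :
    c * s ≤ ρ (y + s • e) - ρ y := by
  have hd : ∀ σ : ℝ, HasDerivAt (fun σ => ρ (y + σ • e)) (inner ℝ (gradient ρ (y + σ • e)) e) σ := by
    intro σ
    have h1 : HasDerivAt (fun σ : ℝ => y + σ • e) e σ := by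
      simpa using ((hasDerivAt_id σ).smul_const e).const_add y
    have h2 := ((h.smooth.differentiable (by simp) (y + σ • e)).hasFDerivAt).comp_hasDerivAt σ h1
    rwa [← inner_gradient_left] at h2
  have hmem : ∀ σ ∈ Icc 0 s, y + σ • e ∈ Metric.ball z R := by
    intro σ hσ
    rcases hs.eq_or_lt with rfl | hs'
    · have : σ = 0 := le_antisymm hσ.2 hσ.1
      simpa [this] using hy
    have h3 := (convex_ball z R) hy hys (a := 1 - σ / s) (b := σ / s)
      (by rw [sub_nonneg, div_le_one hs']; exact hσ.2) (div_nonneg hσ.1 hs) (by ring)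
    convert h3 using 1
    rw [smul_add, ← add_assoc, ← add_smul, smul_smul, div_mul_cancel₀ _ hs'.ne']
    simp
  have := (convex_Icc 0 s).mul_sub_le_image_sub_of_le_deriv
    (fun σ _ => (hd σ).continuousAt.continuousWithinAt)
    (fun σ _ => (hd σ).differentiableAt.differentiableWithinAt) (C := c)
    (fun σ hσ => by rw [(hd σ).deriv]; exact h.le_inner _ (hmem σ (interior_subset hσ)))
    0 (left_mem_Icc.2 hs) s (right_mem_Icc.2 hs) hs
  simpa using this

lemma segment_mem_ball (h : IsBoundaryChart Ω z R r ρ e β c) {y : Plane}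
    (hy : y ∈ Metric.ball z r) {s : ℝ} (hs : s ∈ Icc (0 : ℝ) 1) :
    y + (s * β y) • e ∈ Metric.ball z R := by
  have h1 := h.height_lt y hy
  rw [Metric.mem_ball, dist_eq_norm] at hy ⊢
  calc ‖y + (s * β y) • e - z‖ = ‖(y - z) + (s * β y) • e‖ := by congr 1; abel
    _ ≤ ‖y - z‖ + ‖(s * β y) • e‖ := norm_add_le _ _
    _ = ‖y - z‖ + s * |β y| := by
        rw [norm_smul, h.norm_dir, mul_one, Real.norm_eq_abs, abs_mul, abs_of_nonneg hs.1]
    _ ≤ ‖y - z‖ + 1 * |β y| := by gcongr; exact hs.2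
    _ < R := by linarith

lemma foot_mem_ball (h : IsBoundaryChart Ω z R r ρ e β c) {y : Plane}
    (hy : y ∈ Metric.ball z r) : y + β y • e ∈ Metric.ball z R := by
  simpa using h.segment_mem_ball hy (right_mem_Icc.2 zero_le_one)

lemma height_pos (h : IsBoundaryChart Ω z R r ρ e β c) {y : Plane}
    (hy : y ∈ Metric.ball z r) (hyΩ : y ∈ Ω) : 0 < β y := by
  by_contra! hle
  have h1 := h.mul_le_sub (y := y + β y • e) (s := -β y) (by linarith) (h.foot_mem_ball hy)
    (by simpa using h.ball_subset hy)
  have h2 := (h.mem_iff y (h.ball_subset hy)).1 hyΩ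
  simp only [neg_smul, add_neg_cancel_right, h.root y hy] at h1
  nlinarith [h.c_pos]

lemma mul_height_le (h : IsBoundaryChart Ω z R r ρ e β c) {y : Plane}
    (hy : y ∈ Metric.ball z r) (hyΩ : y ∈ Ω) : c * β y ≤ |ρ y| := by
  have h1 := h.mul_le_sub (h.height_pos hy hyΩ).le (h.ball_subset hy) (h.foot_mem_ball hy)
  rw [h.root y hy] at h1
  exact (h1.trans (by simp)).trans (neg_le_abs _)

lemma segment_mem (h : IsBoundaryChart Ω z R r ρ e β c) {y : Plane}
    (hy : y ∈ Metric.ball z r) (hyΩ : y ∈ Ω) {s : ℝ} (hs : s ∈ Ico (0 : ℝ) 1) :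
    y + (s * β y) • e ∈ Ω := by
  have hs' : s ∈ Icc (0 : ℝ) 1 := ⟨hs.1, hs.2.le⟩
  have hm := h.segment_mem_ball hy hs'
  have hβ := h.height_pos hy hyΩ
  have hpos : 0 < (1 - s) * β y := mul_pos (by linarith [hs.2]) hβ
  have heq : y + (s * β y) • e + ((1 - s) * β y) • e = y + β y • e := by
    rw [add_assoc, ← add_smul]; congr 2; ring
  have h1 := h.mul_le_sub hpos.le hm (by rw [heq]; exact h.foot_mem_ball hy)
  rw [heq, h.root y hy] at h1
  exact (h.mem_iff _ hm).2 (by nlinarith [h.c_pos])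

lemma foot_mem_frontier (h : IsBoundaryChart Ω z R r ρ e β c) (hΩ : IsOpen Ω) {y : Plane}
    (hy : y ∈ Metric.ball z r) (hyΩ : y ∈ Ω) : y + β y • e ∈ frontier Ω := by
  refine h.mem_frontier_of_eq_zero hΩ (h.foot_mem_ball hy) ?_ (h.root y hy)
  have hcont : Continuous fun s : ℝ => y + (s * β y) • e := by fun_prop
  have h1 : (1 : ℝ) ∈ closure (Ico (0 : ℝ) 1) := by
    rw [closure_Ico zero_ne_one]; exact right_mem_Icc.2 zero_le_one
  have h2 := map_mem_closure hcont h1 (fun s hs => h.segment_mem hy hyΩ hs)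
  simpa using h2

/-- The part of the chart where `-ε ≤ ρ ≤ 0` has area `O(ε)`: its translates by the multiples of
`(2 ε / c) e` are disjoint, and about `c / (2 ε)` of them fit in a bounded set. -/
theorem exists_volume_strip_le (h : IsBoundaryChart Ω z R r ρ e β c) :
    ∃ C : ℝ, ∀ ε > 0, volume.real (Metric.closedBall z r ∩ {y | -ε ≤ ρ y ∧ ρ y ≤ 0}) ≤ C * ε := by
  set Q := volume.real (Metric.closedBall z (r + 1)) with hQ
  have hQ0 : 0 ≤ Q := measureReal_nonneg
  refine ⟨4 * Q / c, fun ε hε => ?_⟩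
  set A := Metric.closedBall z r ∩ {y | -ε ≤ ρ y ∧ ρ y ≤ 0} with hA
  have hAm : MeasurableSet A :=
    (Metric.isClosed_closedBall.inter ((isClosed_le continuous_const h.smooth.continuous).inter
      (isClosed_le h.smooth.continuous continuous_const))).measurableSet
  have hfin : volume (Metric.closedBall z (r + 1)) ≠ ⊤ := measure_closedBall_lt_top.ne
  have hc := h.c_pos
  set d := 2 * ε / c with hd
  have hd0 : 0 < d := by positivity
  set n := ⌊1 / d⌋₊ with hn
  have key : n * volume.real A ≤ Q := by
    have hdisj : (↑(Finset.range n) : Set ℕ).PairwiseDisjoint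
        fun k : ℕ => (fun y : Plane => y + (-(k * d)) • e) ⁻¹' A := by
      have aux : ∀ j k : ℕ, j < k → ∀ y : Plane, y + (-(j * d)) • e ∈ A → y + (-(k * d)) • e ∈ A →
          False := by
        intro j k hjk y hj hk
        have hjk' : (1 : ℝ) ≤ (k : ℝ) - j := by
          have : (j : ℝ) + 1 ≤ k := by exact_mod_cast hjk
          linarith
        have heq : y + (-(k * d)) • e + ((k - j) * d) • e = y + (-(j * d)) • e := by
          rw [add_assoc, ← add_smul]; congr 2; ring
        have h1 := h.mul_le_sub (y := y + (-(k * d)) • e) (s := (k - j) * d) (by positivity)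
          (h.closedBall_subset hk.1) (by rw [heq]; exact h.closedBall_subset hj.1)
        rw [heq] at h1
        have h2 : c * ((k - j) * d) ≥ 2 * ε := by
          have : c * d = 2 * ε := by rw [hd]; field_simp
          nlinarith
        have h3 := hj.2.2
        have h4 := hk.2.1
        linarith
      intro j _ k _ hjk
      rw [Function.onFun, Set.disjoint_left]
      intro y hj hk
      rcases lt_or_gt_of_ne hjk with hlt | hlt
      · exact aux j k hlt y hj hk
      · exact aux k j hlt y hk hj
    have hsub : (⋃ k ∈ Finset.range n, (fun y : Plane => y + (-(k * d)) • e) ⁻¹' A)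
        ⊆ Metric.closedBall z (r + 1) := by
      simp only [iUnion_subset_iff, Finset.mem_range]
      intro k hk y hy
      have h1 : ‖y + (-(k * d)) • e - z‖ ≤ r := by
        have := hy.1; rwa [Metric.mem_closedBall, dist_eq_norm] at this
      have h2 : (k : ℝ) * d ≤ 1 := by
        have h3 : (k : ℝ) ≤ 1 / d := by
          have : (k : ℝ) ≤ n := by exact_mod_cast hk.le
          exact this.trans (Nat.floor_le (by positivity))
        rwa [le_div_iff₀ hd0] at h3
      rw [Metric.mem_closedBall, dist_eq_norm]
      calc ‖y - z‖ = ‖(y + (-(k * d)) • e - z) + (k * d) • e‖ := by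
            congr 1; rw [neg_smul]; abel
        _ ≤ ‖y + (-(k * d)) • e - z‖ + ‖(k * d) • e‖ := norm_add_le _ _
        _ ≤ r + 1 := by
            rw [norm_smul, h.norm_dir, mul_one, Real.norm_eq_abs, abs_of_nonneg (by positivity)]
            exact add_le_add h1 h2
    have hsum : volume.real (⋃ k ∈ Finset.range n, (fun y : Plane => y + (-(k * d)) • e) ⁻¹' A)
        = n * volume.real A := by
      rw [measureReal_biUnion_finset hdisj
        (fun k _ => (measurable_add_const _) hAm)
        (fun k _ => by
          rw [measure_preimage_add_right]
          exact ((measure_mono inter_subset_left).trans_lt measure_closedBall_lt_top).ne)]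
      simp [measureReal_def, measure_preimage_add_right]
    rw [← hsum]
    exact measureReal_mono hsub hfin
  have hA0 : 0 ≤ volume.real A := measureReal_nonneg
  have hgoal : volume.real A ≤ 2 * d * Q := by
    rcases le_or_gt d 1 with hle | hlt
    · have h1 : 1 / (2 * d) ≤ n := by
        have h2 : 1 / d < n + 1 := Nat.lt_floor_add_one _
        have h3 : (1 : ℝ) ≤ n := by
          have : 1 ≤ n := Nat.le_floor (by rw [Nat.cast_one, le_div_iff₀ hd0]; linarith)
          exact_mod_cast this
        have h4 : 1 / (2 * d) = (1 / d) / 2 := by field_simp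
        rw [h4]; linarith
      have h5 : 1 / (2 * d) * volume.real A ≤ Q :=
        (mul_le_mul_of_nonneg_right h1 hA0).trans key
      rw [div_mul_eq_mul_div, one_mul, div_le_iff₀ (by positivity)] at h5
      linarith
    · have h1 : volume.real A ≤ Q := measureReal_mono
        (inter_subset_left.trans (Metric.closedBall_subset_closedBall (by linarith))) hfin
      nlinarith
  calc volume.real A ≤ 2 * d * Q := hgoal
    _ = 4 * Q / c * ε := by rw [hd]; ring

end IsBoundaryChart

end Euler2D

/-! ### The stream function in a boundary chart -/

namespace Euler2D

open Filter Topology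

/-- A bounded divergence-free field on `Ω × J`, of class `C¹` with bounded derivative in the
interior, continuous up to the boundary and tangential there. -/
structure IsTangentField (Ω : Set Plane) (J : Set ℝ) (V : Plane × ℝ → Plane) : Prop where
  contDiffOn : ContDiffOn ℝ 1 V (Ω ×ˢ J)
  continuousOn : ContinuousOn V (closure Ω ×ˢ J)
  bound : ∃ M : ℝ, 0 < M ∧ ∀ z ∈ Ω ×ˢ J, ‖V z‖ ≤ M ∧ ‖fderiv ℝ V z‖ ≤ M
  trace_eq_zero : ∀ z ∈ Ω ×ˢ J, planeTrace (spaceDeriv V z) = 0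
  slip : ∀ x ∈ frontier Ω, ∀ t ∈ J, ∀ ρ, IsDefiningFunctionAt Ω x ρ →
    inner ℝ (gradient ρ x) (V (x, t)) = 0

/-- The point of space-time at the fraction `s` of the way from `w` to the boundary, in the
direction `e`. -/
noncomputable def chartPath (e : Plane) (β : Plane → ℝ) (s : ℝ) (w : Plane × ℝ) : Plane × ℝ :=
  (w.1 + (s * β w.1) • e, w.2)

/-- The derivative of `chartPath e β s`. -/
noncomputable def chartPathDeriv (e : Plane) (β : Plane → ℝ) (s : ℝ) (w : Plane × ℝ) :
    Plane × ℝ →L[ℝ] Plane × ℝ :=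
  (ContinuousLinearMap.fst ℝ Plane ℝ
    + (s • (fderiv ℝ β w.1).comp (ContinuousLinearMap.fst ℝ Plane ℝ)).smulRight e).prod
  (ContinuousLinearMap.snd ℝ Plane ℝ)

/-- The stream function of `V` in a boundary chart: the flux of `V` through the segment from a
point to the boundary. -/
noncomputable def chartStream (V : Plane × ℝ → Plane) (e : Plane) (β : Plane → ℝ)
    (w : Plane × ℝ) : ℝ :=
  ∫ s in Ioo (0 : ℝ) 1, β w.1 * inner ℝ e (rot (V (chartPath e β s w)))

/-- The derivative in `w` of the integrand of `chartStream`. -/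
noncomputable def streamIntegrandDeriv (V : Plane × ℝ → Plane) (e : Plane) (β : Plane → ℝ)
    (w : Plane × ℝ) (s : ℝ) : Plane × ℝ →L[ℝ] ℝ :=
  β w.1 • (innerSL ℝ e).comp (rot.comp ((fderiv ℝ V (chartPath e β s w)).comp
      (chartPathDeriv e β s w)))
    + inner ℝ e (rot (V (chartPath e β s w))) •
        (fderiv ℝ β w.1).comp (ContinuousLinearMap.fst ℝ Plane ℝ)

lemma norm_rot_clm_le : ‖rot‖ ≤ 1 :=
  ContinuousLinearMap.opNorm_le_bound _ zero_le_one fun v => by simp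

namespace IsBoundaryChart

variable {Ω : Set Plane} {z : Plane} {R r : ℝ} {ρ : Plane → ℝ} {e : Plane} {β : Plane → ℝ} {c : ℝ}
  {J : Set ℝ} {V : Plane × ℝ → Plane} {w : Plane × ℝ}

lemma isOpen_inter (hΩ : IsOpen Ω) (hJ : IsOpen J) : IsOpen ((Ω ∩ Metric.ball z r) ×ˢ J) :=
  (hΩ.inter Metric.isOpen_ball).prod hJ

lemma differentiableAt_height (h : IsBoundaryChart Ω z R r ρ e β c) {y : Plane}
    (hy : y ∈ Metric.ball z r) : DifferentiableAt ℝ β y :=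
  (h.contDiffOn_height.contDiffAt (Metric.isOpen_ball.mem_nhds hy)).differentiableAt (by simp)

lemma continuousOn_fderiv_height (h : IsBoundaryChart Ω z R r ρ e β c) :
    ContinuousOn (fderiv ℝ β) (Metric.ball z r) :=
  h.contDiffOn_height.continuousOn_fderiv_of_isOpen Metric.isOpen_ball (by simp)

lemma chartPath_mem (h : IsBoundaryChart Ω z R r ρ e β c)
    (hw : w ∈ (Ω ∩ Metric.ball z r) ×ˢ J) {s : ℝ} (hs : s ∈ Ico (0 : ℝ) 1) :
    chartPath e β s w ∈ Ω ×ˢ J :=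
  ⟨h.segment_mem hw.1.2 hw.1.1 hs, hw.2⟩

lemma chartPath_mem_closure (h : IsBoundaryChart Ω z R r ρ e β c) (hΩ : IsOpen Ω)
    (hw : w ∈ (Ω ∩ Metric.ball z r) ×ˢ J) {s : ℝ} (hs : s ∈ Icc (0 : ℝ) 1) :
    chartPath e β s w ∈ closure Ω ×ˢ J := by
  rcases hs.2.lt_or_eq with h1 | rfl
  · exact ⟨subset_closure (h.segment_mem hw.1.2 hw.1.1 ⟨hs.1, h1⟩), hw.2⟩
  · refine ⟨?_, hw.2⟩
    simpa [chartPath] using frontier_subset_closure (h.foot_mem_frontier hΩ hw.1.2 hw.1.1)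

lemma hasFDerivAt_chartPath (h : IsBoundaryChart Ω z R r ρ e β c)
    (hw : w.1 ∈ Metric.ball z r) (s : ℝ) :
    HasFDerivAt (chartPath e β s) (chartPathDeriv e β s w) w := by
  have h1 := hasFDerivAt_comp_fst (z := w) (h.differentiableAt_height hw)
  exact (hasFDerivAt_fst.add ((h1.const_mul s).smul_const e)).prodMk hasFDerivAt_snd

lemma hasFDerivAt_streamIntegrand (h : IsBoundaryChart Ω z R r ρ e β c) (hΩ : IsOpen Ω)
    (hJ : IsOpen J) (hV : IsTangentField Ω J V) (hw : w ∈ (Ω ∩ Metric.ball z r) ×ˢ J) {s : ℝ}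
    (hs : s ∈ Ioo (0 : ℝ) 1) :
    HasFDerivAt (fun w : Plane × ℝ => β w.1 * inner ℝ e (rot (V (chartPath e β s w))))
      (streamIntegrandDeriv V e β w s) w := by
  have hm := h.chartPath_mem hw ⟨hs.1.le, hs.2⟩
  have hVd : DifferentiableAt ℝ V (chartPath e β s w) :=
    (hV.contDiffOn.contDiffAt ((hΩ.prod hJ).mem_nhds hm)).differentiableAt (by simp)
  have h1 := hasFDerivAt_comp_fst (z := w) (h.differentiableAt_height hw.1.2)
  have h2 := (innerSL ℝ e).hasFDerivAt.comp w (rot.hasFDerivAt.comp w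
    (hVd.hasFDerivAt.comp w (h.hasFDerivAt_chartPath hw.1.2 s)))
  exact h1.mul h2

lemma norm_chartPathDeriv_le (h : IsBoundaryChart Ω z R r ρ e β c) {s : ℝ}
    (hs : s ∈ Icc (0 : ℝ) 1) : ‖chartPathDeriv e β s w‖ ≤ 1 + ‖fderiv ℝ β w.1‖ := by
  refine ContinuousLinearMap.opNorm_le_bound _ (by positivity) fun a => ?_
  have h1 : ‖a.1‖ ≤ ‖a‖ := norm_fst_le a
  have h2 : ‖a.2‖ ≤ ‖a‖ := norm_snd_le a
  have h3 : ‖fderiv ℝ β w.1 a.1‖ ≤ ‖fderiv ℝ β w.1‖ * ‖a‖ :=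
    ((fderiv ℝ β w.1).le_opNorm a.1).trans (by gcongr)
  have h4 : 0 ≤ ‖fderiv ℝ β w.1‖ * ‖a‖ := by positivity
  have h5 : chartPathDeriv e β s w a = (a.1 + (s * fderiv ℝ β w.1 a.1) • e, a.2) := by
    simp [chartPathDeriv]
  rw [h5, Prod.norm_mk]
  refine max_le ?_ (by linarith)
  calc ‖a.1 + (s * fderiv ℝ β w.1 a.1) • e‖
      ≤ ‖a.1‖ + s * ‖fderiv ℝ β w.1 a.1‖ := by
        refine (norm_add_le _ _).trans ?_
        rw [norm_smul, h.norm_dir, mul_one, norm_mul, Real.norm_of_nonneg hs.1]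
    _ ≤ ‖a‖ + 1 * (‖fderiv ℝ β w.1‖ * ‖a‖) := by
        gcongr
        exact hs.2
    _ = (1 + ‖fderiv ℝ β w.1‖) * ‖a‖ := by ring

lemma abs_inner_dir_rot_le (h : IsBoundaryChart Ω z R r ρ e β c) (v : Plane) :
    |inner ℝ e (rot v)| ≤ ‖v‖ := by
  have := abs_real_inner_le_norm e (rot v)
  rwa [h.norm_dir, one_mul, norm_rot] at this

lemma norm_streamIntegrandDeriv_le (h : IsBoundaryChart Ω z R r ρ e β c) {M : ℝ}
    (hM : ∀ z ∈ Ω ×ˢ J, ‖V z‖ ≤ M ∧ ‖fderiv ℝ V z‖ ≤ M)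
    (hw : w ∈ (Ω ∩ Metric.ball z r) ×ˢ J) {s : ℝ} (hs : s ∈ Ioo (0 : ℝ) 1) :
    ‖streamIntegrandDeriv V e β w s‖
      ≤ |β w.1| * (M * (1 + ‖fderiv ℝ β w.1‖)) + M * ‖fderiv ℝ β w.1‖ := by
  obtain ⟨hm1, hm2⟩ := hM _ (h.chartPath_mem hw ⟨hs.1.le, hs.2⟩)
  have h1 := h.norm_chartPathDeriv_le (w := w) ⟨hs.1.le, hs.2.le⟩
  refine (norm_add_le _ _).trans (add_le_add ?_ ?_)
  · rw [norm_smul, Real.norm_eq_abs]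
    gcongr
    refine (ContinuousLinearMap.opNorm_comp_le _ _).trans ?_
    rw [innerSL_apply_norm, h.norm_dir, one_mul]
    refine (ContinuousLinearMap.opNorm_comp_le _ _).trans ?_
    refine (mul_le_of_le_one_left (norm_nonneg _) norm_rot_clm_le).trans ?_
    refine (ContinuousLinearMap.opNorm_comp_le _ _).trans ?_
    gcongr
    exact (norm_nonneg _).trans hm2
  · rw [norm_smul, Real.norm_eq_abs]
    have h2 := (h.abs_inner_dir_rot_le (V (chartPath e β s w))).trans hm1
    have h3 : ‖(fderiv ℝ β w.1).comp (ContinuousLinearMap.fst ℝ Plane ℝ)‖ ≤ ‖fderiv ℝ β w.1‖ := by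
      refine (ContinuousLinearMap.opNorm_comp_le _ _).trans ?_
      exact mul_le_of_le_one_right (norm_nonneg _) (ContinuousLinearMap.norm_fst_le ℝ _ _)
    exact mul_le_mul h2 h3 (norm_nonneg _) ((abs_nonneg _).trans h2)

lemma continuousAt_streamIntegrandDeriv (h : IsBoundaryChart Ω z R r ρ e β c) (hΩ : IsOpen Ω)
    (hJ : IsOpen J) (hV : IsTangentField Ω J V) (hw : w ∈ (Ω ∩ Metric.ball z r) ×ˢ J) {s : ℝ}
    (hs : s ∈ Ioo (0 : ℝ) 1) :
    ContinuousAt (fun p : (Plane × ℝ) × ℝ => streamIntegrandDeriv V e β p.1 p.2) (w, s) := by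
  have hm := h.chartPath_mem hw ⟨hs.1.le, hs.2⟩
  have hnb := (hΩ.prod hJ).mem_nhds hm
  have hβ : ContinuousAt (fun p : (Plane × ℝ) × ℝ => β p.1.1) (w, s) :=
    ContinuousAt.comp' (g := β) (h.differentiableAt_height hw.1.2).continuousAt (by fun_prop)
  have hβ' : ContinuousAt (fun p : (Plane × ℝ) × ℝ => fderiv ℝ β p.1.1) (w, s) :=
    ContinuousAt.comp' (g := fderiv ℝ β)
      (h.continuousOn_fderiv_height.continuousAt (Metric.isOpen_ball.mem_nhds hw.1.2))
      (by fun_prop)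
  have hpath : ContinuousAt (fun p : (Plane × ℝ) × ℝ => chartPath e β p.2 p.1) (w, s) := by
    have h1 : ContinuousAt (fun p : (Plane × ℝ) × ℝ => p.1.1) (w, s) := by fun_prop
    have h2 : ContinuousAt (fun p : (Plane × ℝ) × ℝ => p.2) (w, s) := by fun_prop
    have h3 : ContinuousAt (fun p : (Plane × ℝ) × ℝ => p.1.2) (w, s) := by fun_prop
    exact (h1.add ((h2.mul hβ).smul continuousAt_const)).prodMk h3
  have hVc : ContinuousAt (fun p : (Plane × ℝ) × ℝ => V (chartPath e β p.2 p.1)) (w, s) :=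
    ContinuousAt.comp' (g := V) (hV.contDiffOn.continuousOn.continuousAt hnb) hpath
  have hV' : ContinuousAt (fun p : (Plane × ℝ) × ℝ => fderiv ℝ V (chartPath e β p.2 p.1)) (w, s) :=
    ContinuousAt.comp' (g := fderiv ℝ V) ((hV.contDiffOn.continuousOn_fderiv_of_isOpen (hΩ.prod hJ)
      (by simp)).continuousAt hnb) hpath
  have hpd : ContinuousAt (fun p : (Plane × ℝ) × ℝ => chartPathDeriv e β p.2 p.1) (w, s) := by
    have h1 : ContinuousAt (fun p : (Plane × ℝ) × ℝ =>
        (p.2 • (fderiv ℝ β p.1.1).comp (ContinuousLinearMap.fst ℝ Plane ℝ))) (w, s) := by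
      fun_prop
    have h2 : ContinuousAt (fun p : (Plane × ℝ) × ℝ =>
        (p.2 • (fderiv ℝ β p.1.1).comp (ContinuousLinearMap.fst ℝ Plane ℝ)).smulRight e)
        (w, s) :=
      ((ContinuousLinearMap.smulRightL ℝ (Plane × ℝ) Plane).flip e).continuous.continuousAt.comp' h1
    have h3 : ContinuousAt (fun L : Plane × ℝ →L[ℝ] Plane =>
        (ContinuousLinearMap.fst ℝ Plane ℝ + L).prod (ContinuousLinearMap.snd ℝ Plane ℝ))
        ((s • (fderiv ℝ β w.1).comp (ContinuousLinearMap.fst ℝ Plane ℝ)).smulRight e) := by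
      have h4 : Continuous fun L : (Plane × ℝ →L[ℝ] Plane) =>
          ContinuousLinearMap.prodₗᵢ ℝ (L, ContinuousLinearMap.snd ℝ Plane ℝ) :=
        (ContinuousLinearMap.prodₗᵢ ℝ).continuous.comp (by fun_prop)
      exact (h4.comp (continuous_const.add continuous_id)).continuousAt
    exact ContinuousAt.comp' (g := fun L : Plane × ℝ →L[ℝ] Plane =>
      (ContinuousLinearMap.fst ℝ Plane ℝ + L).prod (ContinuousLinearMap.snd ℝ Plane ℝ)) h3 h2
  unfold streamIntegrandDeriv
  refine ContinuousAt.add (hβ.smul ?_) (ContinuousAt.fun_smul ?_ ?_)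
  · exact continuousAt_const.clm_comp (continuousAt_const.clm_comp (hV'.clm_comp hpd))
  · exact ((innerSL ℝ e).continuous.comp rot.continuous).continuousAt.comp' hVc
  · exact hβ'.clm_comp continuousAt_const

lemma aestronglyMeasurable_streamIntegrand (h : IsBoundaryChart Ω z R r ρ e β c) (hΩ : IsOpen Ω)
    (hV : IsTangentField Ω J V) (hw : w ∈ (Ω ∩ Metric.ball z r) ×ˢ J) :
    AEStronglyMeasurable (fun s => β w.1 * inner ℝ e (rot (V (chartPath e β s w))))
      (volume.restrict (Ioo (0 : ℝ) 1)) := by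
  refine ContinuousOn.aestronglyMeasurable ?_ measurableSet_Ioo
  have h1 : ContinuousOn (fun s => V (chartPath e β s w)) (Ioo (0 : ℝ) 1) := by
    refine hV.continuousOn.comp ?_ fun s hs => h.chartPath_mem_closure hΩ hw ⟨hs.1.le, hs.2.le⟩
    unfold chartPath
    fun_prop
  exact continuousOn_const.mul
    (((innerSL ℝ e).continuous.comp rot.continuous).comp_continuousOn h1)

lemma abs_streamIntegrand_le (h : IsBoundaryChart Ω z R r ρ e β c) {M : ℝ}
    (hM : ∀ z ∈ Ω ×ˢ J, ‖V z‖ ≤ M ∧ ‖fderiv ℝ V z‖ ≤ M)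
    (hw : w ∈ (Ω ∩ Metric.ball z r) ×ˢ J) {s : ℝ} (hs : s ∈ Ioo (0 : ℝ) 1) :
    ‖β w.1 * inner ℝ e (rot (V (chartPath e β s w)))‖ ≤ |β w.1| * M := by
  rw [norm_mul]
  exact mul_le_mul_of_nonneg_left ((h.abs_inner_dir_rot_le _).trans
    (hM _ (h.chartPath_mem hw ⟨hs.1.le, hs.2⟩)).1) (norm_nonneg _)

lemma aestronglyMeasurable_streamIntegrandDeriv (h : IsBoundaryChart Ω z R r ρ e β c)
    (hΩ : IsOpen Ω) (hJ : IsOpen J) (hV : IsTangentField Ω J V)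
    (hw : w ∈ (Ω ∩ Metric.ball z r) ×ˢ J) :
    AEStronglyMeasurable (streamIntegrandDeriv V e β w) (volume.restrict (Ioo (0 : ℝ) 1)) := by
  refine ContinuousOn.aestronglyMeasurable (fun s hs => ?_) measurableSet_Ioo
  exact (ContinuousAt.comp' (f := fun s : ℝ => (w, s))
    (h.continuousAt_streamIntegrandDeriv hΩ hJ hV hw hs) (by fun_prop)).continuousWithinAt

/-- Near each point of the chart, the derivatives of the integrand of the stream function have a
common bound. -/
lemma exists_bound_streamIntegrandDeriv (h : IsBoundaryChart Ω z R r ρ e β c)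
    (hΩ : IsOpen Ω) (hJ : IsOpen J) (hV : IsTangentField Ω J V)
    (hw : w ∈ (Ω ∩ Metric.ball z r) ×ˢ J) :
    ∃ K : ℝ, ∀ᶠ w' in 𝓝 w, w' ∈ (Ω ∩ Metric.ball z r) ×ˢ J ∧
      ∀ s ∈ Ioo (0 : ℝ) 1, ‖streamIntegrandDeriv V e β w' s‖ ≤ K := by
  obtain ⟨M, -, hM⟩ := hV.bound
  have hcont : ContinuousAt (fun w' : Plane × ℝ =>
      |β w'.1| * (M * (1 + ‖fderiv ℝ β w'.1‖)) + M * ‖fderiv ℝ β w'.1‖) w := by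
    have hβ : ContinuousAt (fun p : Plane × ℝ => β p.1) w :=
      ContinuousAt.comp' (g := β) (h.differentiableAt_height hw.1.2).continuousAt (by fun_prop)
    have hβ' : ContinuousAt (fun p : Plane × ℝ => fderiv ℝ β p.1) w :=
      ContinuousAt.comp' (g := fderiv ℝ β)
        (h.continuousOn_fderiv_height.continuousAt (Metric.isOpen_ball.mem_nhds hw.1.2))
        (by fun_prop)
    have hn := hβ'.norm
    exact (hβ.abs.mul (continuousAt_const.mul (continuousAt_const.add hn))).add
      (continuousAt_const.mul hn)
  obtain ⟨K, hK⟩ := exists_gt (|β w.1| * (M * (1 + ‖fderiv ℝ β w.1‖)) + M * ‖fderiv ℝ β w.1‖)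
  have hmem : ∀ᶠ w' in 𝓝 w, w' ∈ (Ω ∩ Metric.ball z r) ×ˢ J := (isOpen_inter hΩ hJ).mem_nhds hw
  refine ⟨K, ?_⟩
  filter_upwards [hmem, hcont.eventually (gt_mem_nhds hK)] with w' hw' hlt
  exact ⟨hw', fun s hs => (h.norm_streamIntegrandDeriv_le hM hw' hs).trans hlt.le⟩

lemma integrable_streamIntegrandDeriv (h : IsBoundaryChart Ω z R r ρ e β c)
    (hΩ : IsOpen Ω) (hJ : IsOpen J) (hV : IsTangentField Ω J V)
    (hw : w ∈ (Ω ∩ Metric.ball z r) ×ˢ J) :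
    Integrable (streamIntegrandDeriv V e β w) (volume.restrict (Ioo (0 : ℝ) 1)) := by
  obtain ⟨K, hK⟩ := h.exists_bound_streamIntegrandDeriv hΩ hJ hV hw
  refine Integrable.of_bound (h.aestronglyMeasurable_streamIntegrandDeriv hΩ hJ hV hw) K ?_
  exact (ae_restrict_iff' measurableSet_Ioo).2 (Eventually.of_forall fun s hs =>
    hK.self_of_nhds.2 s hs)

lemma hasFDerivAt_chartStream (h : IsBoundaryChart Ω z R r ρ e β c)
    (hΩ : IsOpen Ω) (hJ : IsOpen J) (hV : IsTangentField Ω J V)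
    (hw : w ∈ (Ω ∩ Metric.ball z r) ×ˢ J) :
    HasFDerivAt (chartStream V e β)
      (∫ s in Ioo (0 : ℝ) 1, streamIntegrandDeriv V e β w s) w := by
  obtain ⟨M, -, hM⟩ := hV.bound
  obtain ⟨K, hK⟩ := h.exists_bound_streamIntegrandDeriv hΩ hJ hV hw
  refine hasFDerivAt_integral_of_dominated_of_fderiv_le (bound := fun _ => K) hK
    (hK.mono fun w' hw' => h.aestronglyMeasurable_streamIntegrand hΩ hV hw'.1) ?_
    (h.aestronglyMeasurable_streamIntegrandDeriv hΩ hJ hV hw) ?_ (integrable_const K) ?_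
  · refine Integrable.of_bound (h.aestronglyMeasurable_streamIntegrand hΩ hV hw) (|β w.1| * M) ?_
    exact (ae_restrict_iff' measurableSet_Ioo).2 (Eventually.of_forall fun s hs =>
      h.abs_streamIntegrand_le hM hw hs)
  · exact (ae_restrict_iff' measurableSet_Ioo).2 (Eventually.of_forall fun s hs w' hw' =>
      hw'.2 s hs)
  · exact (ae_restrict_iff' measurableSet_Ioo).2 (Eventually.of_forall fun s hs w' hw' =>
      h.hasFDerivAt_streamIntegrand hΩ hJ hV hw'.1 hs)

lemma contDiffOn_chartStream (h : IsBoundaryChart Ω z R r ρ e β c)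
    (hΩ : IsOpen Ω) (hJ : IsOpen J) (hV : IsTangentField Ω J V) :
    ContDiffOn ℝ 1 (chartStream V e β) ((Ω ∩ Metric.ball z r) ×ˢ J) := by
  have hO : IsOpen ((Ω ∩ Metric.ball z r) ×ˢ J) := isOpen_inter hΩ hJ
  rw [show (1 : WithTop ℕ∞) = 0 + 1 from (zero_add 1).symm, contDiffOn_succ_iff_fderiv_of_isOpen hO]
  refine ⟨fun w hw => (h.hasFDerivAt_chartStream hΩ hJ hV
    hw).differentiableAt.differentiableWithinAt, by simp, ?_⟩
  rw [contDiffOn_zero]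
  refine ContinuousOn.congr (f := fun w => ∫ s in Ioo (0 : ℝ) 1, streamIntegrandDeriv V e β w s)
    (fun w hw => ContinuousAt.continuousWithinAt ?_)
    fun w hw => (h.hasFDerivAt_chartStream hΩ hJ hV hw).fderiv
  obtain ⟨K, hK⟩ := h.exists_bound_streamIntegrandDeriv hΩ hJ hV hw
  refine continuousAt_of_dominated (bound := fun _ => K)
    (hK.mono fun w' hw' => h.aestronglyMeasurable_streamIntegrandDeriv hΩ hJ hV hw'.1)
    (hK.mono fun w' hw' => (ae_restrict_iff' measurableSet_Ioo).2 (Eventually.of_forall fun s hs =>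
      hw'.2 s hs)) (integrable_const K)
    ((ae_restrict_iff' measurableSet_Ioo).2 (Eventually.of_forall fun s hs => ?_))
  exact ContinuousAt.comp' (f := fun w : Plane × ℝ => (w, s))
    (h.continuousAt_streamIntegrandDeriv hΩ hJ hV hw hs) (by fun_prop)

/-- The boundary value of the field is tangential, and so are the variations of the foot of a
point on the boundary. -/
lemma inner_rot_foot_eq_zero (h : IsBoundaryChart Ω z R r ρ e β c) (hΩ : IsOpen Ω)
    (hV : IsTangentField Ω J V) (hw : w ∈ (Ω ∩ Metric.ball z r) ×ˢ J) (a : Plane) :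
    inner ℝ (a + fderiv ℝ β w.1 a • e) (rot (V (chartPath e β 1 w))) = 0 := by
  set P := w.1 + β w.1 • e with hP
  have hPb : P ∈ Metric.ball z R := h.foot_mem_ball hw.1.2
  have hpath : chartPath e β 1 w = (P, w.2) := by simp [chartPath, hP]
  have h1 : inner ℝ (gradient ρ P) (V (P, w.2)) = 0 :=
    hV.slip P (h.foot_mem_frontier hΩ hw.1.2 hw.1.1) w.2 hw.2 ρ (h.isDefiningFunctionAt hPb)
  have h2 : inner ℝ (gradient ρ P) (a + fderiv ℝ β w.1 a • e) = 0 := by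
    have hd : HasFDerivAt (fun y => ρ (y + β y • e))
        ((fderiv ℝ ρ P).comp (ContinuousLinearMap.id ℝ Plane + (fderiv ℝ β w.1).smulRight e))
        w.1 := by
      have h3 : HasFDerivAt (fun y : Plane => y + β y • e)
          (ContinuousLinearMap.id ℝ Plane + (fderiv ℝ β w.1).smulRight e) w.1 :=
        (hasFDerivAt_id _).add ((h.differentiableAt_height hw.1.2).hasFDerivAt.smul_const e)
      exact HasFDerivAt.comp (g := ρ) w.1 ((h.smooth.differentiable (by simp) P).hasFDerivAt) h3
    have h0 : HasFDerivAt (fun y => ρ (y + β y • e)) (0 : Plane →L[ℝ] ℝ) w.1 := by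
      refine (hasFDerivAt_const (0 : ℝ) w.1).congr_of_eventuallyEq ?_
      filter_upwards [Metric.isOpen_ball.mem_nhds hw.1.2] with y hy
      exact h.root y hy
    have h4 := congrArg (fun L : Plane →L[ℝ] ℝ => L a) (hd.unique h0)
    simp only [ContinuousLinearMap.comp_apply, add_apply, ContinuousLinearMap.id_apply,
      ContinuousLinearMap.smulRight_apply, zero_apply] at h4
    rw [inner_gradient_left]
    exact h4
  have h3 := inner_rot_mul_norm_sq (a + fderiv ℝ β w.1 a • e) (V (P, w.2)) (gradient ρ P)
  rw [h1, h2, zero_mul, zero_mul, sub_zero] at h3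
  have h4 : ‖gradient ρ P‖ ^ 2 ≠ 0 := pow_ne_zero 2 (norm_ne_zero_iff.2 (h.gradient_ne_zero hPb))
  rw [hpath]
  exact (mul_eq_zero.1 h3).resolve_right h4

/-- Since `V` is divergence-free, the space derivative of the integrand of the stream function is
the derivative of `s ↦ ⟨a + s (∂ₐβ) e, rot V⟩` along the segment. -/
lemma spaceDeriv_chartStream (h : IsBoundaryChart Ω z R r ρ e β c)
    (hΩ : IsOpen Ω) (hJ : IsOpen J) (hV : IsTangentField Ω J V)
    (hw : w ∈ (Ω ∩ Metric.ball z r) ×ˢ J) (a : Plane) :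
    spaceDeriv (chartStream V e β) w a = inner ℝ (V w) (rot a) := by
  have hint := h.integrable_streamIntegrandDeriv hΩ hJ hV hw
  rw [spaceDeriv_apply, (h.hasFDerivAt_chartStream hΩ hJ hV hw).fderiv,
    ContinuousLinearMap.integral_apply hint]
  have hI : IntegrableOn (fun s => streamIntegrandDeriv V e β w s (a, 0)) (Ioo (0 : ℝ) 1) :=
    hint.apply_continuousLinearMap _
  set g : ℝ → ℝ := fun s =>
    inner ℝ (a + (s * fderiv ℝ β w.1 a) • e) (rot (V (chartPath e β s w))) with hg
  have hgc : ContinuousOn g (Icc 0 1) := by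
    have h1 : ContinuousOn (fun s => V (chartPath e β s w)) (Icc (0 : ℝ) 1) := by
      refine hV.continuousOn.comp ?_ fun s hs => h.chartPath_mem_closure hΩ hw hs
      unfold chartPath
      fun_prop
    exact ContinuousOn.inner (𝕜 := ℝ) (by fun_prop) (rot.continuous.comp_continuousOn h1)
  have hgd : ∀ s ∈ Ioo (0 : ℝ) 1, HasDerivAt g (streamIntegrandDeriv V e β w s (a, 0)) s := by
    intro s hs
    have hm := h.chartPath_mem hw ⟨hs.1.le, hs.2⟩
    have hVd : DifferentiableAt ℝ V (chartPath e β s w) :=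
      (hV.contDiffOn.contDiffAt ((hΩ.prod hJ).mem_nhds hm)).differentiableAt (by simp)
    have h1 : HasDerivAt (fun s => chartPath e β s w) (β w.1 • e, 0) s := by
      have h2 : HasDerivAt (fun s : ℝ => w.1 + (s * β w.1) • e) (β w.1 • e) s := by
        simpa using (((hasDerivAt_id s).mul_const (β w.1)).smul_const e).const_add w.1
      exact h2.prodMk (hasDerivAt_const s w.2)
    have h3 : HasDerivAt (fun s => rot (V (chartPath e β s w)))
        (rot (fderiv ℝ V (chartPath e β s w) (β w.1 • e, 0))) s :=
      rot.hasFDerivAt.comp_hasDerivAt s (hVd.hasFDerivAt.comp_hasDerivAt s h1)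
    have h4 : HasDerivAt (fun s : ℝ => a + (s * fderiv ℝ β w.1 a) • e)
        (fderiv ℝ β w.1 a • e) s := by
      simpa using (((hasDerivAt_id s).mul_const (fderiv ℝ β w.1 a)).smul_const e).const_add a
    have h5 := h4.inner ℝ h3
    refine h5.congr_deriv ?_
    have h6 : chartPathDeriv e β s w (a, 0) = (a + (s * fderiv ℝ β w.1 a) • e, 0) := by
      simp [chartPathDeriv]
    have h7 := inner_rot_apply_comm (hV.trace_eq_zero _ hm) e (a + (s * fderiv ℝ β w.1 a) • e)
    have h8 : ((β w.1 • e, 0) : Plane × ℝ) = β w.1 • (e, 0) := by simp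
    have h9 : streamIntegrandDeriv V e β w s (a, 0)
        = β w.1 * inner ℝ e (rot (fderiv ℝ V (chartPath e β s w) (chartPathDeriv e β s w (a, 0))))
          + inner ℝ e (rot (V (chartPath e β s w))) * fderiv ℝ β w.1 a := by
      simp [streamIntegrandDeriv]
    rw [h9, h6, h8, map_smul, map_smul, real_inner_smul_right, real_inner_smul_left,
      ← spaceDeriv_apply, ← spaceDeriv_apply, real_inner_comm, h7, real_inner_comm]
    ring
  have hftc := intervalIntegral.integral_eq_sub_of_hasDerivAt_of_le zero_le_one hgc hgd
    ((intervalIntegrable_iff_integrableOn_Ioo_of_le zero_le_one).2 hI)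
  rw [intervalIntegral.integral_of_le zero_le_one, integral_Ioc_eq_integral_Ioo] at hftc
  rw [hftc]
  have hg1 : g 1 = 0 := by
    simpa [hg] using h.inner_rot_foot_eq_zero hΩ hV hw a
  have hg0 : g 0 = inner ℝ a (rot (V w)) := by simp [hg, chartPath]
  rw [hg1, hg0, real_inner_comm, inner_rot_left]; ring

lemma abs_chartStream_le (h : IsBoundaryChart Ω z R r ρ e β c) {M : ℝ}
    (hM : ∀ z ∈ Ω ×ˢ J, ‖V z‖ ≤ M ∧ ‖fderiv ℝ V z‖ ≤ M)
    (hw : w ∈ (Ω ∩ Metric.ball z r) ×ˢ J) :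
    |chartStream V e β w| ≤ β w.1 * M := by
  have := norm_setIntegral_le_of_norm_le_const (μ := volume) (s := Ioo (0 : ℝ) 1)
    (f := fun s => β w.1 * inner ℝ e (rot (V (chartPath e β s w)))) (by simp)
    fun s hs => h.abs_streamIntegrand_le hM hw hs
  rw [abs_of_pos (h.height_pos hw.1.2 hw.1.1)] at this
  simpa [chartStream] using this

lemma abs_timeDeriv_chartStream_le (h : IsBoundaryChart Ω z R r ρ e β c)
    (hΩ : IsOpen Ω) (hJ : IsOpen J) (hV : IsTangentField Ω J V) {M : ℝ}
    (hM : ∀ z ∈ Ω ×ˢ J, ‖V z‖ ≤ M ∧ ‖fderiv ℝ V z‖ ≤ M)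
    (hw : w ∈ (Ω ∩ Metric.ball z r) ×ˢ J) :
    |timeDeriv (chartStream V e β) w| ≤ β w.1 * M := by
  have hint := h.integrable_streamIntegrandDeriv hΩ hJ hV hw
  rw [timeDeriv, (h.hasFDerivAt_chartStream hΩ hJ hV hw).fderiv,
    ContinuousLinearMap.integral_apply hint]
  have hβ := h.height_pos hw.1.2 hw.1.1
  have := norm_setIntegral_le_of_norm_le_const (μ := volume) (s := Ioo (0 : ℝ) 1)
    (f := fun s => streamIntegrandDeriv V e β w s (0, 1)) (C := β w.1 * M) (by simp)
    fun s hs => ?_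
  · simpa using this
  · have h9 : streamIntegrandDeriv V e β w s (0, 1)
        = β w.1 * inner ℝ e (rot (timeDeriv V (chartPath e β s w))) := by
      simp [streamIntegrandDeriv, chartPathDeriv, timeDeriv]
    rw [h9, norm_mul, Real.norm_of_nonneg hβ.le]
    gcongr
    exact (h.abs_inner_dir_rot_le _).trans ((norm_timeDeriv_le _ _).trans
      (hM _ (h.chartPath_mem hw ⟨hs.1.le, hs.2⟩)).2)

/-- In a boundary chart, a tangential divergence-free field has a stream function that vanishes on
the boundary to first order, together with its time derivative. -/
theorem exists_stream (h : IsBoundaryChart Ω z R r ρ e β c) (hΩ : IsOpen Ω) (hJ : IsOpen J)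
    (hV : IsTangentField Ω J V) :
    ∃ (ψ : Plane × ℝ → ℝ) (C : ℝ), 0 < C ∧ IsStreamPair ((Ω ∩ Metric.ball z r) ×ˢ J) ψ V ∧
      ∀ w ∈ (Ω ∩ Metric.ball z r) ×ˢ J,
        |ψ w| ≤ C * |ρ w.1| ∧ |timeDeriv ψ w| ≤ C * |ρ w.1| := by
  obtain ⟨M, hM0, hM⟩ := hV.bound
  have hsub : (Ω ∩ Metric.ball z r) ×ˢ J ⊆ Ω ×ˢ J := prod_mono inter_subset_left subset_rfl
  have hle : ∀ w ∈ (Ω ∩ Metric.ball z r) ×ˢ J, β w.1 * M ≤ M / c * |ρ w.1| := by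
    intro w hw
    have h1 := h.mul_height_le hw.1.2 hw.1.1
    have hc := h.c_pos
    calc β w.1 * M = M / c * (c * β w.1) := by field_simp
      _ ≤ M / c * |ρ w.1| := by gcongr
  exact ⟨chartStream V e β, M / c, div_pos hM0 h.c_pos,
    ⟨h.contDiffOn_chartStream hΩ hJ hV, hV.contDiffOn.mono hsub,
      fun w hw a => h.spaceDeriv_chartStream hΩ hJ hV hw a,
      fun w hw => hV.trace_eq_zero w (hsub hw)⟩,
    fun w hw => ⟨(h.abs_chartStream_le hM hw).trans (hle w hw),
      (h.abs_timeDeriv_chartStream_le hΩ hJ hV hM hw).trans (hle w hw)⟩⟩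

end IsBoundaryChart

end Euler2D

/-! ### Boundary layers -/

namespace Euler2D

open Filter Topology

lemma exists_cutoff : ∃ (θ : ℝ → ℝ) (B : ℝ), ContDiff ℝ ∞ θ ∧ (∀ s, |s| ≤ 1 → θ s = 1) ∧
    (∀ s, 2 ≤ |s| → θ s = 0) ∧ 0 < B ∧
    ∀ s, |θ s| ≤ B ∧ |deriv θ s| ≤ B ∧ |deriv (deriv θ) s| ≤ B := by
  let f : ContDiffBump (0 : ℝ) := ⟨1, 2, one_pos, one_lt_two⟩
  have h0 : ContDiff ℝ ∞ (f : ℝ → ℝ) := f.contDiff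
  have h1 : ContDiff ℝ ∞ (deriv f) := (contDiff_infty_iff_deriv.1 h0).2
  have h2 : ContDiff ℝ ∞ (deriv (deriv f)) := (contDiff_infty_iff_deriv.1 h1).2
  have hs := f.hasCompactSupport
  obtain ⟨B₀, hB₀⟩ := h0.continuous.bounded_above_of_compact_support hs
  obtain ⟨B₁, hB₁⟩ := h1.continuous.bounded_above_of_compact_support hs.deriv
  obtain ⟨B₂, hB₂⟩ := h2.continuous.bounded_above_of_compact_support hs.deriv.deriv
  refine ⟨f, max B₀ (max B₁ B₂) + 1, h0, fun s hs' => ?_, fun s hs' => ?_, ?_, fun s => ?_⟩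
  · exact f.one_of_mem_closedBall (by simpa [f] using hs')
  · exact f.zero_of_le_dist (by simpa [f] using hs')
  · have := (norm_nonneg _).trans ((hB₀ 0).trans (le_max_left B₀ (max B₁ B₂)))
    linarith
  · have h3 := hB₀ s
    have h4 := hB₁ s
    have h5 := hB₂ s
    rw [Real.norm_eq_abs] at h3 h4 h5
    have h6 := le_max_left B₀ (max B₁ B₂)
    have h7 := le_max_right B₀ (max B₁ B₂)
    have h8 := le_max_left B₁ B₂
    have h9 := le_max_right B₁ B₂
    exact ⟨by linarith, by linarith, by linarith⟩

/-- On a compact set, a continuous function that vanishes on the zero set of `g` is uniformly small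
where `g` is small. -/
lemma _root_.IsCompact.exists_forall_abs_le {X : Type*} [TopologicalSpace X] [T2Space X]
    {K : Set X} (hK : IsCompact K) {f g : X → ℝ} (hf : ContinuousOn f K) (hg : ContinuousOn g K)
    (h0 : ∀ p ∈ K, g p = 0 → f p = 0) {κ : ℝ} (hκ : 0 < κ) :
    ∃ ε > 0, ∀ p ∈ K, |g p| ≤ ε → |f p| ≤ κ := by
  have hK' : IsCompact (K ∩ (fun p => |f p|) ⁻¹' Ici κ) :=
    hK.of_isClosed_subset (hf.abs.preimage_isClosed_of_isClosed hK.isClosed isClosed_Ici)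
      inter_subset_left
  rcases (K ∩ (fun p => |f p|) ⁻¹' Ici κ).eq_empty_or_nonempty with he | hne
  · refine ⟨1, one_pos, fun p hp _ => ?_⟩
    by_contra! hlt
    exact (he ▸ (⟨hp, hlt.le⟩ : p ∈ K ∩ (fun p => |f p|) ⁻¹' Ici κ) : p ∈ (∅ : Set X))
  · obtain ⟨q, hq, hmin⟩ := hK'.exists_isMinOn hne (hg.abs.mono inter_subset_left)
    have hpos : 0 < |g q| := by
      refine abs_pos.2 fun hgq => ?_
      have h1 : κ ≤ |f q| := hq.2
      rw [h0 q hq.1 hgq, abs_zero] at h1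
      exact absurd hκ (not_lt.2 h1)
    refine ⟨|g q| / 2, half_pos hpos, fun p hp hgp => ?_⟩
    by_contra! hlt
    have h1 : |g q| ≤ |g p| := hmin (⟨hp, hlt.le⟩ : p ∈ K ∩ (fun p => |f p|) ⁻¹' Ici κ)
    linarith

lemma gradient_comp_mul {θ : ℝ → ℝ} {ρ : Plane → ℝ} (hθ : ContDiff ℝ ∞ θ) (hρ : ContDiff ℝ ∞ ρ)
    (k : ℝ) (x : Plane) :
    gradient (fun y => θ (k * ρ y)) x = (k * deriv θ (k * ρ x)) • gradient ρ x := by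
  have h1 : HasFDerivAt (fun y => θ (k * ρ y)) (deriv θ (k * ρ x) • (k • fderiv ℝ ρ x)) x :=
    (hθ.differentiable (by simp) _).hasDerivAt.comp_hasFDerivAt x
      ((hρ.differentiable (by simp) x).hasFDerivAt.const_mul k)
  apply ext_inner_right ℝ
  intro a
  rw [inner_gradient_left, h1.fderiv, real_inner_smul_left, inner_gradient_left]
  simp only [smul_apply, smul_eq_mul]
  ring

lemma fderiv_gradient_comp_mul {θ : ℝ → ℝ} {ρ : Plane → ℝ} (hθ : ContDiff ℝ ∞ θ)
    (hρ : ContDiff ℝ ∞ ρ) (k : ℝ) (x a : Plane) :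
    fderiv ℝ (gradient fun y => θ (k * ρ y)) x a
      = (k * deriv θ (k * ρ x)) • fderiv ℝ (gradient ρ) x a
        + (k ^ 2 * deriv (deriv θ) (k * ρ x) * inner ℝ (gradient ρ x) a) • gradient ρ x := by
  have hθ' : ContDiff ℝ ∞ (deriv θ) := (contDiff_infty_iff_deriv.1 hθ).2
  have h0 : gradient (fun y => θ (k * ρ y))
      = fun y => (k * deriv θ (k * ρ y)) • gradient ρ y :=
    funext fun y => gradient_comp_mul hθ hρ k y
  have h1 : HasFDerivAt (fun y => k * deriv θ (k * ρ y))
      (k • (deriv (deriv θ) (k * ρ x) • (k • fderiv ℝ ρ x))) x :=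
    ((hθ'.differentiable (by simp) _).hasDerivAt.comp_hasFDerivAt x
      ((hρ.differentiable (by simp) x).hasFDerivAt.const_mul k)).const_mul k
  have h2 := h1.smul ((contDiff_gradient hρ).differentiable (by simp) x).hasFDerivAt
  rw [h0]
  erw [h2.fderiv]
  simp only [add_apply, smul_apply, smul_eq_mul, ContinuousLinearMap.smulRight_apply,
    inner_gradient_left]
  congr 2
  ring

/-- A field `F` with a stream function `Ψ` that lives in a boundary chart: both vanish away from
the compact set `S`, `Ψ` vanishes to first order on the boundary, and `F` is tangential there. -/
structure IsLayerField (Ω : Set Plane) (z : Plane) (r : ℝ) (ρ : Plane → ℝ) (J : Set ℝ) (T : ℝ)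
    (S : Set Plane) (Ψ : Plane × ℝ → ℝ) (F : Plane × ℝ → Plane) : Prop where
  pair : IsStreamPair ((Ω ∩ Metric.ball z r) ×ˢ J) Ψ F
  isCompact : IsCompact S
  subset_ball : S ⊆ Metric.ball z r
  zero_off : ∀ w : Plane × ℝ, w.1 ∉ S → Ψ w = 0 ∧ F w = 0
  bound : ∃ C : ℝ, 0 < C ∧ ∀ w ∈ (Ω ∩ Metric.ball z r) ×ˢ J, |Ψ w| ≤ C * |ρ w.1| ∧
    |timeDeriv Ψ w| ≤ C * |ρ w.1| ∧ ‖F w‖ ≤ C ∧ ‖timeDeriv F w‖ ≤ C ∧ ‖spaceDeriv F w‖ ≤ C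
  normal : ∀ κ > 0, ∃ ε > 0, ∀ x ∈ Ω ∩ S, ∀ t ∈ Icc 0 T, |ρ x| ≤ ε →
    |inner ℝ (gradient ρ x) (F (x, t))| ≤ κ

/-- The part of the field `F` in the boundary layer of width `2 / (n + 1)`. -/
noncomputable def boundaryLayer (θ : ℝ → ℝ) (ρ : Plane → ℝ) (Ψ : Plane × ℝ → ℝ)
    (F : Plane × ℝ → Plane) (n : ℕ) : Plane × ℝ → Plane :=
  cutField (fun x => θ ((n + 1 : ℝ) * ρ x)) Ψ F

namespace IsLayerField

variable {Ω : Set Plane} {z : Plane} {R r : ℝ} {ρ : Plane → ℝ} {e : Plane} {β : Plane → ℝ} {c : ℝ}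
  {J : Set ℝ} {T : ℝ} {S : Set Plane} {Ψ : Plane × ℝ → ℝ} {F : Plane × ℝ → Plane} {θ : ℝ → ℝ}
  {n : ℕ} {w : Plane × ℝ}

lemma contDiff_cutoff (hθ : ContDiff ℝ ∞ θ) (hρ : ContDiff ℝ ∞ ρ) (k : ℝ) :
    ContDiff ℝ ∞ fun x => θ (k * ρ x) :=
  hθ.comp (contDiff_const.mul hρ)

lemma differentiableAt_stream (hF : IsLayerField Ω z r ρ J T S Ψ F) (hΩ : IsOpen Ω) (hJ : IsOpen J)
    (hw : w ∈ (Ω ∩ Metric.ball z r) ×ˢ J) : DifferentiableAt ℝ Ψ w :=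
  (hF.pair.contDiffOn_stream.contDiffAt
    ((IsBoundaryChart.isOpen_inter hΩ hJ).mem_nhds hw)).differentiableAt (by simp)

lemma differentiableAt_field (hF : IsLayerField Ω z r ρ J T S Ψ F) (hΩ : IsOpen Ω) (hJ : IsOpen J)
    (hw : w ∈ (Ω ∩ Metric.ball z r) ×ˢ J) : DifferentiableAt ℝ F w :=
  (hF.pair.contDiffOn_field.contDiffAt
    ((IsBoundaryChart.isOpen_inter hΩ hJ).mem_nhds hw)).differentiableAt (by simp)

lemma eventually_notMem (hF : IsLayerField Ω z r ρ J T S Ψ F) (hw : w.1 ∉ S) :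
    ∀ᶠ w' in 𝓝 w, w'.1 ∉ S :=
  (hF.isCompact.isClosed.isOpen_compl.preimage continuous_fst).mem_nhds hw

lemma cutField_eq_zero_off (hF : IsLayerField Ω z r ρ J T S Ψ F) (m : Plane → ℝ) (hw : w.1 ∉ S) :
    cutField m Ψ F w = 0 := by
  simp [cutField, hF.zero_off w hw]

lemma cutField_eventuallyEq_zero (hF : IsLayerField Ω z r ρ J T S Ψ F) (m : Plane → ℝ)
    (hw : w.1 ∉ S) : cutField m Ψ F =ᶠ[𝓝 w] 0 :=
  (hF.eventually_notMem hw).mono fun _ hw' => hF.cutField_eq_zero_off m hw'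

lemma contDiffOn_cutField (hF : IsLayerField Ω z r ρ J T S Ψ F) (hΩ : IsOpen Ω) (hJ : IsOpen J)
    {m : Plane → ℝ} (hm : ContDiff ℝ ∞ m) : ContDiffOn ℝ 1 (cutField m Ψ F) (Ω ×ˢ J) := by
  intro w hw
  by_cases hS : w.1 ∈ S
  · have hO := (IsBoundaryChart.isOpen_inter (z := z) (r := r) hΩ hJ)
    exact ((hF.pair.cutField hO hm).contDiffOn_field.contDiffAt
      (hO.mem_nhds ⟨⟨hw.1, hF.subset_ball hS⟩, hw.2⟩)).contDiffWithinAt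
  · exact (contDiffAt_const.congr_of_eventuallyEq
      (hF.cutField_eventuallyEq_zero m hS)).contDiffWithinAt

lemma planeTrace_cutField (hF : IsLayerField Ω z r ρ J T S Ψ F) (hΩ : IsOpen Ω) (hJ : IsOpen J)
    {m : Plane → ℝ} (hm : ContDiff ℝ ∞ m) (hw : w ∈ Ω ×ˢ J) :
    planeTrace (spaceDeriv (cutField m Ψ F) w) = 0 := by
  by_cases hS : w.1 ∈ S
  · exact (hF.pair.cutField (IsBoundaryChart.isOpen_inter hΩ hJ) hm).trace_eq_zero w
      ⟨⟨hw.1, hF.subset_ball hS⟩, hw.2⟩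
  · rw [spaceDeriv_congr (hF.cutField_eventuallyEq_zero m hS)]
    simp [planeTrace, spaceDeriv]

/-- Outside the layer, `boundaryLayer` vanishes. -/
lemma boundaryLayer_eventuallyEq_zero (hF : IsLayerField Ω z r ρ J T S Ψ F) (hρ : Continuous ρ)
    (hθ0 : ∀ s, 2 ≤ |s| → θ s = 0) (hw : w.1 ∉ S ∨ 2 < (n + 1 : ℝ) * |ρ w.1|) :
    boundaryLayer θ ρ Ψ F n =ᶠ[𝓝 w] 0 := by
  rcases hw with hw | hw
  · exact hF.cutField_eventuallyEq_zero _ hw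
  · have h1 : ∀ᶠ y in 𝓝 w.1, 2 < (n + 1 : ℝ) * |ρ y| :=
      (continuous_const.mul hρ.abs).continuousAt.eventually (lt_mem_nhds hw)
    have h2 : ∀ y : Plane, 2 < (n + 1 : ℝ) * |ρ y| → θ ((n + 1 : ℝ) * ρ y) = 0 := fun y hy => by
      apply hθ0
      rw [abs_mul, abs_of_pos (by positivity : (0 : ℝ) < n + 1)]
      exact hy.le
    have h3 : ∀ᶠ y in 𝓝 w.1, (fun x => θ ((n + 1 : ℝ) * ρ x)) =ᶠ[𝓝 y] fun _ => 0 :=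
      h1.eventually_nhds.mono fun y hy => hy.mono fun x hx => h2 x hx
    have h4 : ∀ᶠ w' in 𝓝 w, (fun x => θ ((n + 1 : ℝ) * ρ x)) =ᶠ[𝓝 w'.1] fun _ => 0 :=
      continuous_fst.continuousAt.eventually h3
    filter_upwards [h4] with w' hw'
    have h5 : gradient (fun x => θ ((n + 1 : ℝ) * ρ x)) w'.1 = 0 := by
      rw [gradient, hw'.fderiv_eq]; simp
    have h6 : θ ((n + 1 : ℝ) * ρ w'.1) = 0 := hw'.self_of_nhds
    simp [boundaryLayer, cutField, h5, h6]

/-- Close to the boundary, `boundaryLayer` coincides with the field. -/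
lemma boundaryLayer_eq_field (hF : IsLayerField Ω z r ρ J T S Ψ F) (hρ : Continuous ρ)
    (hθ1 : ∀ s, |s| ≤ 1 → θ s = 1) (hw : w.1 ∉ S ∨ (n + 1 : ℝ) * |ρ w.1| < 1) :
    boundaryLayer θ ρ Ψ F n w = F w := by
  rcases hw with hw | hw
  · rw [boundaryLayer, hF.cutField_eq_zero_off _ hw, (hF.zero_off w hw).2]
  · have h1 : ∀ᶠ y in 𝓝 w.1, (n + 1 : ℝ) * |ρ y| < 1 :=
      (continuous_const.mul hρ.abs).continuousAt.eventually (gt_mem_nhds hw)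
    have h2 : (fun x => θ ((n + 1 : ℝ) * ρ x)) =ᶠ[𝓝 w.1] fun _ => 1 := h1.mono fun y hy => by
      apply hθ1
      rw [abs_mul, abs_of_pos (by positivity : (0 : ℝ) < n + 1)]
      exact hy.le
    have h5 : gradient (fun x => θ ((n + 1 : ℝ) * ρ x)) w.1 = 0 := by
      rw [gradient, h2.fderiv_eq]; simp
    have h6 : θ ((n + 1 : ℝ) * ρ w.1) = 1 := h2.self_of_nhds
    simp [boundaryLayer, cutField, h5, h6]

/-- The boundary layers and their time derivatives are bounded uniformly in the width: the factor
`n + 1` of the derivative of the cut-off is compensated by the size of the stream function. -/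
lemma exists_norm_boundaryLayer_le (hF : IsLayerField Ω z r ρ J T S Ψ F) (hΩ : IsOpen Ω)
    (hJ : IsOpen J) (hρ : ContDiff ℝ ∞ ρ) (hθ : ContDiff ℝ ∞ θ)
    (hθ0 : ∀ s, 2 ≤ |s| → θ s = 0) {B : ℝ}
    (hB : ∀ s, |θ s| ≤ B ∧ |deriv θ s| ≤ B ∧ |deriv (deriv θ) s| ≤ B) :
    ∃ D : ℝ, ∀ n : ℕ, ∀ w ∈ Ω ×ˢ J,
      ‖boundaryLayer θ ρ Ψ F n w‖ ≤ D ∧ ‖timeDeriv (boundaryLayer θ ρ Ψ F n) w‖ ≤ D := by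
  obtain ⟨C, hC0, hC⟩ := hF.bound
  obtain ⟨G, hG⟩ := hF.isCompact.exists_bound_of_continuousOn
    (contDiff_gradient hρ).continuous.continuousOn
  have hB0 : 0 ≤ B := (abs_nonneg _).trans (hB 0).1
  refine ⟨max 0 (B * C + 2 * C * B * G), fun n w hw => ?_⟩
  by_cases hcase : w.1 ∉ S ∨ 2 < (n + 1 : ℝ) * |ρ w.1|
  · have h0 := hF.boundaryLayer_eventuallyEq_zero hρ.continuous hθ0 hcase
    rw [h0.self_of_nhds, timeDeriv_congr h0]
    simp [timeDeriv]
  push Not at hcase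
  obtain ⟨hS, hle⟩ := hcase
  have hwO : w ∈ (Ω ∩ Metric.ball z r) ×ˢ J := ⟨⟨hw.1, hF.subset_ball hS⟩, hw.2⟩
  obtain ⟨h1, h2, h3, h4, -⟩ := hC w hwO
  have hk : (0 : ℝ) < n + 1 := by positivity
  have hGw := hG w.1 hS
  have hG0 : 0 ≤ G := (norm_nonneg _).trans hGw
  have key : ∀ p : ℝ, |p| ≤ C * |ρ w.1| →
      ‖p • rot (gradient (fun x => θ ((n + 1 : ℝ) * ρ x)) w.1)‖ ≤ 2 * C * B * G := by
    intro p hp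
    rw [norm_smul, norm_rot, gradient_comp_mul hθ hρ, norm_smul, Real.norm_eq_abs,
      Real.norm_eq_abs, abs_mul, abs_of_pos hk]
    have h5 := (hB ((n + 1 : ℝ) * ρ w.1)).2.1
    calc |p| * ((n + 1) * |deriv θ ((n + 1) * ρ w.1)| * ‖gradient ρ w.1‖)
        ≤ (C * |ρ w.1|) * ((n + 1) * B * G) := by gcongr
      _ = C * ((n + 1) * |ρ w.1|) * (B * G) := by ring
      _ ≤ C * 2 * (B * G) := by gcongr
      _ = 2 * C * B * G := by ring
  have hθw := (hB ((n + 1 : ℝ) * ρ w.1)).1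
  constructor
  · refine le_trans ?_ (le_max_right _ _)
    refine (norm_add_le _ _).trans (add_le_add ?_ (key _ h1))
    rw [norm_smul, Real.norm_eq_abs]
    exact mul_le_mul hθw h3 (norm_nonneg _) hB0
  · refine le_trans ?_ (le_max_right _ _)
    rw [boundaryLayer, timeDeriv_cutField (contDiff_cutoff hθ hρ _)
      (hF.differentiableAt_stream hΩ hJ hwO) (hF.differentiableAt_field hΩ hJ hwO)]
    refine (norm_add_le _ _).trans (add_le_add ?_ (key _ h2))
    rw [norm_smul, Real.norm_eq_abs]
    exact mul_le_mul hθw h4 (norm_nonneg _) hB0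

set_option maxHeartbeats 800000 in
/-- In the layer, the gradient of `boundaryLayer` is of order `n + 1`, but the leading term of its
contraction with `a ⊗ a` contains the normal component of `a` or of `F`. -/
lemma exists_abs_inner_spaceDeriv_boundaryLayer_le (hF : IsLayerField Ω z r ρ J T S Ψ F)
    (h : IsBoundaryChart Ω z R r ρ e β c) (hΩ : IsOpen Ω) (hJ : IsOpen J) (hθ : ContDiff ℝ ∞ θ)
    {B : ℝ} (hB : ∀ s, |θ s| ≤ B ∧ |deriv θ s| ≤ B ∧ |deriv (deriv θ) s| ≤ B) (A : ℝ) :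
    ∃ D : ℝ, 0 < D ∧ ∀ n : ℕ, ∀ w ∈ Ω ×ˢ J, w.1 ∈ S → (n + 1 : ℝ) * |ρ w.1| ≤ 2 → ∀ a, ‖a‖ ≤ A →
      |inner ℝ (spaceDeriv (boundaryLayer θ ρ Ψ F n) w a) a|
        ≤ D * (1 + (n + 1) * (|inner ℝ (gradient ρ w.1) a| + |inner ℝ (gradient ρ w.1) (F w)|)) := by
  have hρ := h.smooth
  obtain ⟨C, hC0, hC⟩ := hF.bound
  obtain ⟨G, hG⟩ := hF.isCompact.exists_bound_of_continuousOn
    (contDiff_gradient hρ).continuous.continuousOn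
  obtain ⟨H, hH⟩ := hF.isCompact.exists_bound_of_continuousOn
    ((contDiff_gradient hρ).continuous_fderiv (by simp)).continuousOn
  have hB0 : 0 ≤ B := (abs_nonneg _).trans (hB 0).1
  have hc := h.c_pos
  set D₁ := B * C * A ^ 2 + 2 * C * B * H * A ^ 2 with hD₁
  set D₂ := B * C * A + 2 * C * B * G * A + B * G * A * (A + C) / c with hD₂
  refine ⟨|D₁| + |D₂| + 1, by positivity, fun n w hw hS hle a ha => ?_⟩
  have hwO : w ∈ (Ω ∩ Metric.ball z r) ×ˢ J := ⟨⟨hw.1, hF.subset_ball hS⟩, hw.2⟩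
  obtain ⟨h1, -, h3, -, h5⟩ := hC w hwO
  have hk : (0 : ℝ) < n + 1 := by positivity
  set k : ℝ := n + 1 with hkdef
  set g := gradient ρ w.1 with hg
  have hgG : ‖g‖ ≤ G := hG w.1 hS
  have hgc : c ≤ ‖g‖ := h.le_norm_gradient (h.ball_subset (hF.subset_ball hS))
  have hHw : ‖fderiv ℝ (gradient ρ) w.1‖ ≤ H := hH w.1 hS
  have hA0 : 0 ≤ A := (norm_nonneg _).trans ha
  have hG0 : 0 ≤ G := (norm_nonneg _).trans hgG
  have hH0 : 0 ≤ H := (norm_nonneg _).trans hHw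
  obtain ⟨hb0, hb1, hb2⟩ := hB (k * ρ w.1)
  set t0 := θ (k * ρ w.1)
  set t1 := deriv θ (k * ρ w.1)
  set t2 := deriv (deriv θ) (k * ρ w.1)
  set α := |inner ℝ g a| with hα
  set γ := |inner ℝ g (F w)| with hγ
  have hα0 : 0 ≤ α := abs_nonneg _
  have hγ0 : 0 ≤ γ := abs_nonneg _
  have hΨ : k * |Ψ w| ≤ 2 * C := by
    calc k * |Ψ w| ≤ k * (C * |ρ w.1|) := by gcongr
      _ = C * (k * |ρ w.1|) := by ring
      _ ≤ C * 2 := by gcongr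
      _ = 2 * C := by ring
  have hra : |inner ℝ (rot (fderiv ℝ (gradient ρ) w.1 a)) a| ≤ H * A ^ 2 := by
    refine (abs_real_inner_le_norm _ _).trans ?_
    rw [norm_rot]
    calc ‖fderiv ℝ (gradient ρ) w.1 a‖ * ‖a‖ ≤ (H * A) * A := by
          gcongr
          exact ((fderiv ℝ (gradient ρ) w.1).le_opNorm a).trans (by gcongr)
      _ = H * A ^ 2 := by ring
  have hrg : |inner ℝ (rot g) a| ≤ G * A := by
    refine (abs_real_inner_le_norm _ _).trans ?_
    rw [norm_rot]; gcongr
  have hFa : |inner ℝ (F w) a| ≤ C * A :=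
    (abs_real_inner_le_norm _ _).trans (by gcongr)
  have hDa : |inner ℝ (spaceDeriv F w a) a| ≤ C * A ^ 2 := by
    refine (abs_real_inner_le_norm _ _).trans ?_
    calc ‖spaceDeriv F w a‖ * ‖a‖ ≤ (C * A) * A := by
          gcongr
          exact ((spaceDeriv F w).le_opNorm a).trans (by gcongr)
      _ = C * A ^ 2 := by ring
  have hFr : |inner ℝ (F w) (rot a)| ≤ (A * γ + C * α) / c := by
    have h6 := abs_inner_rot_mul_norm_le (v := F w) (a := a) (g := g)
    have hg0 : 0 < ‖g‖ := hc.trans_le hgc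
    have h7 : |inner ℝ (F w) (rot a)| * ‖g‖ ≤ ‖a‖ * γ + ‖F w‖ * α := by
      have : ‖g‖ * (|inner ℝ (F w) (rot a)| * ‖g‖) ≤ ‖g‖ * (‖a‖ * γ + ‖F w‖ * α) := by
        calc _ = |inner ℝ (F w) (rot a)| * ‖g‖ ^ 2 := by ring
          _ ≤ _ := h6
      exact le_of_mul_le_mul_left this hg0
    rw [le_div_iff₀ hc]
    calc |inner ℝ (F w) (rot a)| * c ≤ |inner ℝ (F w) (rot a)| * ‖g‖ := by gcongr
      _ ≤ ‖a‖ * γ + ‖F w‖ * α := h7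
      _ ≤ A * γ + C * α := by gcongr
  have hexp : inner ℝ (spaceDeriv (boundaryLayer θ ρ Ψ F n) w a) a
      = t0 * inner ℝ (spaceDeriv F w a) a + (k * t1 * inner ℝ g a) * inner ℝ (F w) a
        + (Ψ w * (k * t1 * inner ℝ (rot (fderiv ℝ (gradient ρ) w.1 a)) a
            + k ^ 2 * t2 * inner ℝ g a * inner ℝ (rot g) a)
          + inner ℝ (F w) (rot a) * (k * t1 * inner ℝ (rot g) a)) := by
    rw [boundaryLayer, spaceDeriv_cutField (contDiff_cutoff hθ hρ _)
      (hF.differentiableAt_stream hΩ hJ hwO) (hF.differentiableAt_field hΩ hJ hwO),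
      hF.pair.spaceDeriv_stream w hwO, gradient_comp_mul hθ hρ, fderiv_gradient_comp_mul hθ hρ]
    simp only [inner_add_left, real_inner_smul_left, map_add, map_smul, smul_add, ← hg]
    rw [mul_add (Ψ w)]
  have T1 : |t0 * inner ℝ (spaceDeriv F w a) a| ≤ B * (C * A ^ 2) := by
    rw [abs_mul]; gcongr
  have T2 : |(k * t1 * inner ℝ g a) * inner ℝ (F w) a| ≤ k * α * (B * C * A) := by
    rw [abs_mul, abs_mul, abs_mul, abs_of_pos hk]
    calc k * |t1| * α * |inner ℝ (F w) a| ≤ k * B * α * (C * A) := by gcongr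
      _ = _ := by ring
  have T3 : |Ψ w * (k * t1 * inner ℝ (rot (fderiv ℝ (gradient ρ) w.1 a)) a
      + k ^ 2 * t2 * inner ℝ g a * inner ℝ (rot g) a)|
      ≤ 2 * C * (B * (H * A ^ 2) + k * α * (B * (G * A))) := by
    have : |k * t1 * inner ℝ (rot (fderiv ℝ (gradient ρ) w.1 a)) a
        + k ^ 2 * t2 * inner ℝ g a * inner ℝ (rot g) a|
        ≤ k * B * (H * A ^ 2) + k ^ 2 * B * α * (G * A) := by
      refine (abs_add_le _ _).trans ?_
      rw [abs_mul, abs_mul, abs_mul, abs_mul, abs_mul, abs_of_pos hk, abs_of_pos (pow_pos hk 2)]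
      gcongr
    rw [abs_mul]
    calc |Ψ w| * _ ≤ |Ψ w| * (k * B * (H * A ^ 2) + k ^ 2 * B * α * (G * A)) := by gcongr
      _ = (k * |Ψ w|) * (B * (H * A ^ 2) + k * α * (B * (G * A))) := by ring
      _ ≤ 2 * C * (B * (H * A ^ 2) + k * α * (B * (G * A))) := by gcongr
  have T4 : |inner ℝ (F w) (rot a) * (k * t1 * inner ℝ (rot g) a)|
      ≤ k * (α + γ) * (B * G * A * (A + C) / c) := by
    rw [abs_mul, abs_mul, abs_mul, abs_of_pos hk]
    calc |inner ℝ (F w) (rot a)| * (k * |t1| * |inner ℝ (rot g) a|)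
        ≤ ((A * γ + C * α) / c) * (k * B * (G * A)) := by gcongr
      _ ≤ (((A + C) * (α + γ)) / c) * (k * B * (G * A)) := by
          gcongr
          nlinarith [mul_nonneg hA0 hα0, mul_nonneg hC0.le hγ0]
      _ = _ := by ring
  have hsum : |inner ℝ (spaceDeriv (boundaryLayer θ ρ Ψ F n) w a) a|
      ≤ D₁ + D₂ * (k * (α + γ)) := by
    rw [hexp]
    refine (abs_add_le _ _).trans ((add_le_add
      ((abs_add_le _ _).trans (add_le_add T1 T2)) ((abs_add_le _ _).trans (add_le_add T3 T4))).trans ?_)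
    have h8 : 0 ≤ k * γ * (B * C * A + 2 * C * B * G * A) := by positivity
    calc (B * (C * A ^ 2) + k * α * (B * C * A))
          + (2 * C * (B * (H * A ^ 2) + k * α * (B * (G * A)))
            + k * (α + γ) * (B * G * A * (A + C) / c))
      _ = D₁ + D₂ * (k * (α + γ)) - k * γ * (B * C * A + 2 * C * B * G * A) := by
          rw [hD₁, hD₂]; ring
      _ ≤ _ := by linarith
  have hX : 0 ≤ k * (α + γ) := by positivity
  refine hsum.trans ?_
  have h9 := le_abs_self D₁
  have h10 : D₂ * (k * (α + γ)) ≤ |D₂| * (k * (α + γ)) :=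
    mul_le_mul_of_nonneg_right (le_abs_self D₂) hX
  have h11 := abs_nonneg D₂
  have h12 := abs_nonneg D₁
  nlinarith [mul_nonneg h12 hX]

end IsLayerField

/-- Near the boundary, the field `u` coincides with `v`, which is continuous up to the boundary and
tangential there. -/
structure IsTangentTrace (Ω : Set Plane) (T : ℝ) (u : Plane × ℝ → Plane) (N : Set (Plane × ℝ))
    (v : Plane × ℝ → Plane) : Prop where
  isOpen : IsOpen N
  subset : frontier Ω ×ˢ Icc 0 T ⊆ N
  continuousOn : ContinuousOn v (N ∩ closure Ω ×ˢ Icc 0 T)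
  ae_eq : v =ᵐ[volume.restrict (N ∩ Ω ×ˢ Ioo 0 T)] u
  normal : ∀ x ∈ frontier Ω, ∀ t ∈ Icc 0 T, ∀ ρ, IsDefiningFunctionAt Ω x ρ →
    inner ℝ (gradient ρ x) (v (x, t)) = 0

/-- A sequence of `C¹` fields that vanishes eventually near each point, is bounded together with
its time derivatives, and whose spatial gradients, of any size, contribute nothing in the limit to
the weak formulation satisfied by `u`. -/
structure IsNegligible (Ω : Set Plane) (T : ℝ) (J : Set ℝ) (u : Plane × ℝ → Plane)
    (W : ℕ → Plane × ℝ → Plane) : Prop where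
  contDiffOn : ∀ n, ContDiffOn ℝ 1 (W n) (Ω ×ˢ J)
  eventually_zero : ∀ w ∈ Ω ×ˢ J, ∀ᶠ n in atTop, W n =ᶠ[𝓝 w] 0
  bound : ∃ D : ℝ, ∀ n, ∀ w ∈ Ω ×ˢ J, ‖W n w‖ ≤ D ∧ ‖timeDeriv (W n) w‖ ≤ D
  transport : Tendsto (fun n => ∫⁻ w in Ω ×ˢ Ioo 0 T,
    ‖inner ℝ (spaceDeriv (W n) w (u w)) (u w)‖ₑ) atTop (𝓝 0)

namespace IsLayerField

variable {Ω : Set Plane} {z : Plane} {R r : ℝ} {ρ : Plane → ℝ} {e : Plane} {β : Plane → ℝ} {c : ℝ}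
  {J : Set ℝ} {T : ℝ} {S : Set Plane} {Ψ : Plane × ℝ → ℝ} {F : Plane × ℝ → Plane} {θ : ℝ → ℝ}
  {u v : Plane × ℝ → Plane} {N : Set (Plane × ℝ)}

lemma eventually_lt_mul_abs {a : ℝ} (ha : a ≠ 0) : ∀ᶠ n : ℕ in atTop, 2 < (n + 1 : ℝ) * |a| := by
  have h1 : Tendsto (fun n : ℕ => (n + 1 : ℝ) * |a|) atTop atTop :=
    (tendsto_natCast_atTop_atTop.atTop_add tendsto_const_nhds).atTop_mul_const (abs_pos.2 ha)
  exact h1.eventually_gt_atTop 2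

/-- The layer has width of order `1 / n`, the gradient there is of order `n` times the normal
components of `u` and `F`, and these are uniformly small in the layer. -/
lemma tendsto_transport (hF : IsLayerField Ω z r ρ J T S Ψ F)
    (h : IsBoundaryChart Ω z R r ρ e β c) (hΩ : IsOpen Ω) (hJ : IsOpen J) (hTJ : Icc 0 T ⊆ J)
    (hv : IsTangentTrace Ω T u N v) (hN : Metric.closedBall z r ×ˢ Icc 0 T ⊆ N)
    (hθ : ContDiff ℝ ∞ θ) (hθ0 : ∀ s, 2 ≤ |s| → θ s = 0)
    {B : ℝ} (hB : ∀ s, |θ s| ≤ B ∧ |deriv θ s| ≤ B ∧ |deriv (deriv θ) s| ≤ B) :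
    Tendsto (fun n => ∫⁻ w in Ω ×ˢ Ioo 0 T,
      ‖inner ℝ (spaceDeriv (boundaryLayer θ ρ Ψ F n) w (u w)) (u w)‖ₑ) atTop (𝓝 0) := by
  have hρ := h.smooth
  -- the compact set on which `v` is continuous
  set K : Set (Plane × ℝ) := (Metric.closedBall z r ∩ closure Ω) ×ˢ Icc 0 T with hK
  have hKc : IsCompact K :=
    ((isCompact_closedBall z r).inter_right isClosed_closure).prod isCompact_Icc
  have hvK : ContinuousOn v K := hv.continuousOn.mono fun w hw =>
    ⟨hN ⟨hw.1.1, hw.2⟩, hw.1.2, hw.2⟩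
  obtain ⟨A, hA⟩ := hKc.exists_bound_of_continuousOn hvK
  obtain ⟨D, hD0, hD⟩ := hF.exists_abs_inner_spaceDeriv_boundaryLayer_le h hΩ hJ hθ hB A
  obtain ⟨C, hC⟩ := h.exists_volume_strip_le
  have hnormal : ∀ κ > 0, ∃ ε > 0, ∀ w ∈ K, |ρ w.1| ≤ ε →
      |inner ℝ (gradient ρ w.1) (v w)| ≤ κ := by
    intro κ hκ
    refine hKc.exists_forall_abs_le (f := fun w => inner ℝ (gradient ρ w.1) (v w))
      (g := fun w => ρ w.1) ?_ (hρ.continuous.comp continuous_fst).continuousOn ?_ hκ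
    · exact ContinuousOn.inner (𝕜 := ℝ)
        ((contDiff_gradient hρ).continuous.comp continuous_fst).continuousOn hvK
    · intro w hw h0
      have hb := h.closedBall_subset hw.1.1
      exact hv.normal w.1 (h.mem_frontier_of_eq_zero hΩ hb hw.1.2 h0) w.2 hw.2 ρ
        (h.isDefiningFunctionAt hb)
  set E : ℕ → Set (Plane × ℝ) := fun n =>
    (Metric.closedBall z r ∩ {y | -(2 / (n + 1 : ℝ)) ≤ ρ y ∧ ρ y ≤ 0}) ×ˢ Ioo 0 T with hE
  have hEm : ∀ n, MeasurableSet (E n) := fun n =>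
    (Metric.isClosed_closedBall.inter ((isClosed_le continuous_const h.smooth.continuous).inter
      (isClosed_le h.smooth.continuous continuous_const))).measurableSet.prod measurableSet_Ioo
  have hEv : ∀ n : ℕ, volume (E n) ≤ ENNReal.ofReal (C * (2 / (n + 1)) * |T|) := by
    intro n
    have h1 := hC (2 / (n + 1 : ℝ)) (by positivity)
    rw [hE, Measure.volume_eq_prod, Measure.prod_prod, Real.volume_Ioo, sub_zero,
      ENNReal.ofReal_mul (measureReal_nonneg.trans h1)]
    refine mul_le_mul' ?_ (ENNReal.ofReal_le_ofReal (le_abs_self T))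
    rw [← ofReal_measureReal ((measure_mono inter_subset_left).trans_lt
      measure_closedBall_lt_top).ne]
    exact ENNReal.ofReal_le_ofReal h1
  -- the estimate of the integral, for a given bound `κ` of the normal components
  have hmain : ∀ κ > 0, ∀ᶠ n : ℕ in atTop, ∫⁻ w in Ω ×ˢ Ioo 0 T,
      ‖inner ℝ (spaceDeriv (boundaryLayer θ ρ Ψ F n) w (u w)) (u w)‖ₑ
        ≤ ENNReal.ofReal (D * (1 + (n + 1) * (κ + κ)) * (C * (2 / (n + 1)) * |T|)) := by
    intro κ hκ
    obtain ⟨ε₁, hε₁, h₁⟩ := hnormal κ hκ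
    obtain ⟨ε₂, hε₂, h₂⟩ := hF.normal κ hκ
    filter_upwards [eventually_lt_mul_abs (lt_min hε₁ hε₂).ne'] with n hn
    have hk : (0 : ℝ) < n + 1 := by positivity
    rw [abs_of_pos (lt_min hε₁ hε₂)] at hn
    have hQ0 : 0 ≤ D * (1 + (n + 1) * (κ + κ)) := by positivity
    have hae : ∀ᵐ w ∂(volume.restrict (Ω ×ˢ Ioo 0 T)),
        ‖inner ℝ (spaceDeriv (boundaryLayer θ ρ Ψ F n) w (u w)) (u w)‖ₑ
          ≤ (E n).indicator (fun _ => ENNReal.ofReal (D * (1 + (n + 1) * (κ + κ)))) w := by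
      have hNm : MeasurableSet (N ∩ Ω ×ˢ Ioo 0 T) :=
        (hv.isOpen.inter (hΩ.prod isOpen_Ioo)).measurableSet
      have h3 := (ae_restrict_iff' hNm).1 hv.ae_eq
      rw [ae_restrict_iff' (hΩ.prod isOpen_Ioo).measurableSet]
      filter_upwards [h3] with w hw hwΩ
      have hwJ : w ∈ Ω ×ˢ J := ⟨hwΩ.1, hTJ ⟨hwΩ.2.1.le, hwΩ.2.2.le⟩⟩
      by_cases hcase : w.1 ∉ S ∨ 2 < (n + 1 : ℝ) * |ρ w.1|
      · have h0 := hF.boundaryLayer_eventuallyEq_zero hρ.continuous hθ0 hcase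
        rw [spaceDeriv_congr h0]
        simp [spaceDeriv]
      push Not at hcase
      obtain ⟨hS, hle⟩ := hcase
      have hb := hF.subset_ball hS
      have hcb : w.1 ∈ Metric.closedBall z r := Metric.ball_subset_closedBall hb
      have hwT : w.2 ∈ Icc 0 T := ⟨hwΩ.2.1.le, hwΩ.2.2.le⟩
      have hwK : w ∈ K := ⟨⟨hcb, subset_closure hwΩ.1⟩, hwT⟩
      have huv : v w = u w := hw ⟨hN ⟨hcb, hwT⟩, hwΩ⟩
      have hneg : ρ w.1 < 0 := (h.mem_iff w.1 (h.ball_subset hb)).1 hwΩ.1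
      have hle' : |ρ w.1| ≤ 2 / (n + 1) := by rw [le_div_iff₀ hk]; linarith
      have hwE : w ∈ E n := by
        refine ⟨⟨hcb, ?_, hneg.le⟩, hwΩ.2⟩
        have := neg_le_of_abs_le hle'
        exact this
      have hsmall : |ρ w.1| ≤ min ε₁ ε₂ := by
        by_contra! hlt
        have : (n + 1 : ℝ) * min ε₁ ε₂ < (n + 1) * |ρ w.1| := by gcongr
        linarith
      rw [indicator_of_mem hwE, ← ofReal_norm, Real.norm_eq_abs]
      refine ENNReal.ofReal_le_ofReal ((hD n w hwJ hS hle (u w) (by rw [← huv]; exact hA w hwK)).trans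
        ?_)
      gcongr
      · rw [← huv]; exact h₁ w hwK (hsmall.trans (min_le_left _ _))
      · exact h₂ w.1 ⟨hwΩ.1, hS⟩ w.2 hwT (hsmall.trans (min_le_right _ _))
    calc _ ≤ ∫⁻ w in Ω ×ˢ Ioo 0 T,
          (E n).indicator (fun _ => ENNReal.ofReal (D * (1 + (n + 1) * (κ + κ)))) w :=
          lintegral_mono_ae hae
      _ ≤ ∫⁻ w, (E n).indicator (fun _ => ENNReal.ofReal (D * (1 + (n + 1) * (κ + κ)))) w :=
          setLIntegral_le_lintegral _ _
      _ = ENNReal.ofReal (D * (1 + (n + 1) * (κ + κ))) * volume (E n) := by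
          rw [lintegral_indicator_const (hEm n)]
      _ ≤ _ := by
          rw [ENNReal.ofReal_mul hQ0]
          gcongr
          exact hEv n
  rw [ENNReal.tendsto_nhds_zero]
  intro δ hδ
  obtain ⟨δ', hδ'0, hδ'⟩ : ∃ δ' : ℝ, 0 < δ' ∧ ENNReal.ofReal δ' ≤ δ := by
    rcases eq_or_ne δ ⊤ with rfl | htop
    · exact ⟨1, one_pos, le_top⟩
    · exact ⟨δ.toReal, ENNReal.toReal_pos hδ.ne' htop, (ENNReal.ofReal_toReal htop).le⟩
  set P := 2 * D * |C| * |T| with hP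
  have hP0 : 0 ≤ P := by positivity
  set κ := δ' / (4 * (P + 1)) with hκ
  have hκ0 : 0 < κ := by positivity
  have hlim : ∀ᶠ n : ℕ in atTop, (1 : ℝ) / (n + 1) < κ :=
    tendsto_one_div_add_atTop_nhds_zero_nat.eventually (gt_mem_nhds hκ0)
  filter_upwards [hmain κ hκ0, hlim] with n hn hnκ
  refine hn.trans ((ENNReal.ofReal_le_ofReal ?_).trans hδ')
  have hk : (0 : ℝ) < n + 1 := by positivity
  calc D * (1 + (n + 1) * (κ + κ)) * (C * (2 / (n + 1)) * |T|)
      ≤ D * (1 + (n + 1) * (κ + κ)) * (|C| * (2 / (n + 1)) * |T|) := by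
        gcongr; exact le_abs_self C
    _ = P * (1 / (n + 1) + 2 * κ) := by rw [hP]; field_simp; ring
    _ ≤ (P + 1) * (κ + 2 * κ) := by gcongr; linarith
    _ ≤ δ' := by
        have : (P + 1) * κ = δ' / 4 := by rw [hκ]; field_simp
        nlinarith

lemma isNegligible_boundaryLayer (hF : IsLayerField Ω z r ρ J T S Ψ F)
    (h : IsBoundaryChart Ω z R r ρ e β c) (hΩ : IsOpen Ω) (hJ : IsOpen J) (hTJ : Icc 0 T ⊆ J)
    (hv : IsTangentTrace Ω T u N v) (hN : Metric.closedBall z r ×ˢ Icc 0 T ⊆ N)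
    (hθ : ContDiff ℝ ∞ θ) (hθ0 : ∀ s, 2 ≤ |s| → θ s = 0)
    {B : ℝ} (hB : ∀ s, |θ s| ≤ B ∧ |deriv θ s| ≤ B ∧ |deriv (deriv θ) s| ≤ B) :
    IsNegligible Ω T J u (boundaryLayer θ ρ Ψ F) := by
  refine ⟨fun n => hF.contDiffOn_cutField hΩ hJ (contDiff_cutoff hθ h.smooth _), fun w hw => ?_,
    hF.exists_norm_boundaryLayer_le hΩ hJ h.smooth hθ hθ0 hB,
    hF.tendsto_transport h hΩ hJ hTJ hv hN hθ hθ0 hB⟩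
  by_cases hS : w.1 ∈ S
  · have hne : ρ w.1 ≠ 0 :=
      ((h.mem_iff w.1 (h.ball_subset (hF.subset_ball hS))).1 hw.1).ne
    exact (eventually_lt_mul_abs hne).mono fun n hn =>
      hF.boundaryLayer_eventuallyEq_zero h.smooth.continuous hθ0 (Or.inr hn)
  · exact Eventually.of_forall fun n =>
      hF.boundaryLayer_eventuallyEq_zero h.smooth.continuous hθ0 (Or.inl hS)

end IsLayerField

end Euler2D

/-! ### Approximation by test fields -/

namespace Euler2D

open Filter Topology

section gluing

variable {Ω : Set Plane} {J : Set ℝ} {V : Plane × ℝ → Plane}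

/-- Two stream functions of `V` that vanish on a part of the boundary coincide near it: they have
the same gradient along the segment that joins a point to its nearest boundary point. -/
theorem exists_nhds_stream_eq (hΩ : IsOpen Ω) (hJ : IsOpen J) {ψ₁ ψ₂ : Plane × ℝ → ℝ}
    {O₁ O₂ : Set Plane} (hO₁ : IsOpen O₁) (hO₂ : IsOpen O₂)
    (h₁ : IsStreamPair ((Ω ∩ O₁) ×ˢ J) ψ₁ V) (h₂ : IsStreamPair ((Ω ∩ O₂) ×ˢ J) ψ₂ V)
    {g₁ g₂ : Plane → ℝ} (hg₁ : Continuous g₁) (hg₂ : Continuous g₂)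
    (hle₁ : ∀ w ∈ (Ω ∩ O₁) ×ˢ J, |ψ₁ w| ≤ g₁ w.1) (hle₂ : ∀ w ∈ (Ω ∩ O₂) ×ˢ J, |ψ₂ w| ≤ g₂ w.1)
    (hz₁ : ∀ y ∈ frontier Ω, y ∈ O₁ → g₁ y = 0) (hz₂ : ∀ y ∈ frontier Ω, y ∈ O₂ → g₂ y = 0)
    {y₀ : Plane} (hy₀ : y₀ ∈ frontier Ω) (hy₁ : y₀ ∈ O₁) (hy₂ : y₀ ∈ O₂) :
    ∀ᶠ x in 𝓝 y₀, x ∈ Ω → ∀ t ∈ J, ψ₁ (x, t) = ψ₂ (x, t) := by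
  obtain ⟨δ, hδ, hball⟩ := Metric.isOpen_iff.1 (hO₁.inter hO₂) y₀ ⟨hy₁, hy₂⟩
  have hy₀Ω : y₀ ∈ Ωᶜ := by rw [hΩ.frontier_eq] at hy₀; exact hy₀.2
  filter_upwards [Metric.ball_mem_nhds y₀ (half_pos hδ)] with x hx hxΩ t ht
  obtain ⟨P, hPc, hPd⟩ := hΩ.isClosed_compl.exists_infDist_eq_dist ⟨y₀, hy₀Ω⟩ x
  set d := Metric.infDist x Ωᶜ with hd
  have hdlt : d < δ / 2 := (Metric.infDist_le_dist_of_mem hy₀Ω).trans_lt hx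
  set γ : ℝ → Plane := fun s => x + s • (P - x) with hγ
  have hγdist : ∀ s ∈ Icc (0 : ℝ) 1, dist (γ s) x = s * d := by
    intro s hs
    rw [dist_eq_norm, hγ, hPd, dist_comm, dist_eq_norm]
    simp [norm_smul, abs_of_nonneg hs.1]
  have hd0 : 0 < d := by
    rw [hPd]
    exact dist_pos.2 fun h => hPc (h ▸ hxΩ)
  have hγΩ : ∀ s ∈ Ico (0 : ℝ) 1, γ s ∈ Ω := by
    intro s hs
    refine Metric.ball_infDist_compl_subset (x := x) ?_
    rw [Metric.mem_ball, hγdist s ⟨hs.1, hs.2.le⟩]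
    nlinarith [hs.2]
  have hγO : ∀ s ∈ Icc (0 : ℝ) 1, γ s ∈ O₁ ∩ O₂ := by
    intro s hs
    refine hball ?_
    rw [Metric.mem_ball] at hx ⊢
    have h3 := dist_triangle (γ s) x y₀
    rw [hγdist s hs] at h3
    nlinarith [hs.2]
  have hγc : Continuous γ := by fun_prop
  have hP1 : γ 1 ∈ frontier Ω := by
    have h1 : (1 : ℝ) ∈ closure (Ico (0 : ℝ) 1) := by
      rw [closure_Ico zero_ne_one]; exact right_mem_Icc.2 zero_le_one
    rw [hΩ.frontier_eq]
    exact ⟨map_mem_closure hγc h1 hγΩ, by simpa [hγ] using hPc⟩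
  set g : ℝ → ℝ := fun s => ψ₁ (γ s, t) - ψ₂ (γ s, t) with hg
  have hgd : ∀ s ∈ Ico (0 : ℝ) 1, HasDerivAt g 0 s := by
    intro s hs
    have hγd : HasDerivAt γ (P - x) s := by
      exact (((hasDerivAt_id s).smul_const (P - x)).const_add x).congr_deriv (one_smul _ _)
    have hm₁ : (γ s, t) ∈ (Ω ∩ O₁) ×ˢ J := ⟨⟨hγΩ s hs, (hγO s ⟨hs.1, hs.2.le⟩).1⟩, ht⟩
    have hm₂ : (γ s, t) ∈ (Ω ∩ O₂) ×ˢ J := ⟨⟨hγΩ s hs, (hγO s ⟨hs.1, hs.2.le⟩).2⟩, ht⟩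
    have hd₁ : DifferentiableAt ℝ ψ₁ (γ s, t) := (h₁.contDiffOn_stream.contDiffAt
      (((hΩ.inter hO₁).prod hJ).mem_nhds hm₁)).differentiableAt (by simp)
    have hd₂ : DifferentiableAt ℝ ψ₂ (γ s, t) := (h₂.contDiffOn_stream.contDiffAt
      (((hΩ.inter hO₂).prod hJ).mem_nhds hm₂)).differentiableAt (by simp)
    have h3 := ((hasFDerivAt_spaceSlice hd₁).comp_hasDerivAt s hγd).sub
      ((hasFDerivAt_spaceSlice hd₂).comp_hasDerivAt s hγd)
    refine h3.congr_deriv ?_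
    rw [h₁.spaceDeriv_stream _ hm₁, h₂.spaceDeriv_stream _ hm₂, sub_self]
  have hconst : ∀ s ∈ Ico (0 : ℝ) 1, g s = g 0 := by
    intro s hs
    have hsub : Icc 0 s ⊆ Ico (0 : ℝ) 1 := fun σ hσ => ⟨hσ.1, hσ.2.trans_lt hs.2⟩
    exact constant_of_has_deriv_right_zero
      (fun σ hσ => (hgd σ (hsub hσ)).continuousAt.continuousWithinAt)
      (fun σ hσ => (hgd σ (hsub ⟨hσ.1, hσ.2.le⟩)).hasDerivWithinAt) s (right_mem_Icc.2 hs.1)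
  have hlim : Tendsto (fun s => g₁ (γ s) + g₂ (γ s)) (𝓝[<] 1) (𝓝 (g₁ (γ 1) + g₂ (γ 1))) :=
    (((hg₁.comp hγc).add (hg₂.comp hγc)).tendsto 1).mono_left nhdsWithin_le_nhds
  have hO1 := hγO 1 (right_mem_Icc.2 zero_le_one)
  rw [hz₁ _ hP1 hO1.1, hz₂ _ hP1 hO1.2, add_zero] at hlim
  have hbound : ∀ᶠ s in 𝓝[<] (1 : ℝ), |g 0| ≤ g₁ (γ s) + g₂ (γ s) := by
    filter_upwards [Ico_mem_nhdsLT (zero_lt_one' ℝ)] with s hs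
    rw [← hconst s hs]
    refine (abs_sub _ _).trans (add_le_add ?_ ?_)
    · exact hle₁ _ ⟨⟨hγΩ s hs, (hγO s ⟨hs.1, hs.2.le⟩).1⟩, ht⟩
    · exact hle₂ _ ⟨⟨hγΩ s hs, (hγO s ⟨hs.1, hs.2.le⟩).2⟩, ht⟩
  have h0 : |g 0| ≤ 0 := ge_of_tendsto hlim hbound
  have h1 : g 0 = 0 := abs_nonpos_iff.1 h0
  simpa [hg, hγ, sub_eq_zero] using h1

end gluing

lemma gradient_eq_zero_of_notMem_tsupport {η : Plane → ℝ} {x : Plane} (hx : x ∉ tsupport η) :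
    gradient η x = 0 := by
  rw [gradient, fderiv_of_notMem_tsupport ℝ hx, map_zero]

/-- Localizing a tangential field and its stream function in a boundary chart. -/
theorem isLayerField_cutField {Ω : Set Plane} {z : Plane} {R r : ℝ} {ρ : Plane → ℝ} {e : Plane}
    {β : Plane → ℝ} {c : ℝ} {J : Set ℝ} {T : ℝ} {V : Plane × ℝ → Plane} {ψ : Plane × ℝ → ℝ}
    {C : ℝ} {η : Plane → ℝ}
    (h : IsBoundaryChart Ω z R r ρ e β c) (hΩ : IsOpen Ω) (hJ : IsOpen J) (hTJ : Icc 0 T ⊆ J)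
    (hV : IsTangentField Ω J V) (hC : 0 < C) (hψ : IsStreamPair ((Ω ∩ Metric.ball z r) ×ˢ J) ψ V)
    (hψC : ∀ w ∈ (Ω ∩ Metric.ball z r) ×ˢ J,
      |ψ w| ≤ C * |ρ w.1| ∧ |timeDeriv ψ w| ≤ C * |ρ w.1|)
    (hη : ContDiff ℝ ∞ η) (hηs : tsupport η ⊆ Metric.ball z r) :
    IsLayerField Ω z r ρ J T (tsupport η) (fun w => η w.1 * ψ w) (cutField η ψ V) := by
  have hO := IsBoundaryChart.isOpen_inter (z := z) (r := r) hΩ hJ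
  have hS : IsCompact (tsupport η) :=
    (isCompact_closedBall z r).of_isClosed_subset (isClosed_tsupport η)
      (hηs.trans Metric.ball_subset_closedBall)
  obtain ⟨M, hM0, hM⟩ := hV.bound
  obtain ⟨A₀, hA₀⟩ := hS.exists_bound_of_continuousOn hη.continuous.continuousOn
  obtain ⟨A₁, hA₁⟩ := hS.exists_bound_of_continuousOn (contDiff_gradient hη).continuous.continuousOn
  obtain ⟨A₂, hA₂⟩ := hS.exists_bound_of_continuousOn
    ((contDiff_gradient hη).continuous_fderiv (by simp)).continuousOn
  obtain ⟨L, hL⟩ := hS.exists_bound_of_continuousOn h.smooth.continuous.continuousOn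
  obtain ⟨G, hG⟩ := hS.exists_bound_of_continuousOn
    (contDiff_gradient h.smooth).continuous.continuousOn
  have hzero : ∀ w : Plane × ℝ, w.1 ∉ tsupport η → η w.1 * ψ w = 0 ∧ cutField η ψ V w = 0 := by
    intro w hw
    simp [cutField, gradient_eq_zero_of_notMem_tsupport hw, image_eq_zero_of_notMem_tsupport hw]
  refine ⟨hψ.cutField hO hη, hS, hηs, hzero, ?_, ?_⟩
  · set D := |A₀| * C + (|A₀| * M + C * |L| * |A₁|) + (|A₀| * M + |A₁| * M)
      + (C * |L| * |A₂| + M * |A₁|) with hD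
    have hp1 : 0 ≤ |A₀| * C := by positivity
    have hp2 : 0 ≤ |A₀| * M + C * |L| * |A₁| := by positivity
    have hp3 : 0 ≤ |A₀| * M + |A₁| * M := by positivity
    have hp4 : 0 ≤ C * |L| * |A₂| + M * |A₁| := by positivity
    have hD0 : 0 ≤ D := by positivity
    refine ⟨D + 1, by positivity, fun w hw => ?_⟩
    by_cases hwS : w.1 ∈ tsupport η
    swap
    · have hev : ∀ᶠ w' in 𝓝 w, w'.1 ∉ tsupport η :=
        (hS.isClosed.isOpen_compl.preimage continuous_fst).mem_nhds hwS
      have h1 : (fun w : Plane × ℝ => η w.1 * ψ w) =ᶠ[𝓝 w] fun _ => 0 :=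
        hev.mono fun w' hw' => (hzero w' hw').1
      have h2 : cutField η ψ V =ᶠ[𝓝 w] fun _ => 0 := hev.mono fun w' hw' => (hzero w' hw').2
      rw [(hzero w hwS).1, (hzero w hwS).2, timeDeriv_congr h1, timeDeriv_congr h2,
        spaceDeriv_congr h2]
      simp only [timeDeriv, spaceDeriv, fderiv_fun_const, Pi.zero_apply, zero_apply,
        ContinuousLinearMap.zero_comp, norm_zero, abs_zero]
      exact ⟨by positivity, by positivity, by positivity, by positivity, by positivity⟩
    have hwΩ : w ∈ Ω ×ˢ J := ⟨hw.1.1, hw.2⟩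
    have hψd : DifferentiableAt ℝ ψ w :=
      (hψ.contDiffOn_stream.contDiffAt (hO.mem_nhds hw)).differentiableAt (by simp)
    have hVd : DifferentiableAt ℝ V w :=
      (hψ.contDiffOn_field.contDiffAt (hO.mem_nhds hw)).differentiableAt (by simp)
    obtain ⟨hψ1, hψ2⟩ := hψC w hw
    obtain ⟨hM1, hM2⟩ := hM w hwΩ
    have a0 : |η w.1| ≤ |A₀| := (hA₀ _ hwS).trans (le_abs_self _)
    have a1 : ‖gradient η w.1‖ ≤ |A₁| := (hA₁ _ hwS).trans (le_abs_self _)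
    have a2 : ‖fderiv ℝ (gradient η) w.1‖ ≤ |A₂| := (hA₂ _ hwS).trans (le_abs_self _)
    have al : |ρ w.1| ≤ |L| := (hL _ hwS).trans (le_abs_self _)
    have hψ1' : |ψ w| ≤ C * |L| := hψ1.trans (by gcongr)
    have hψ2' : |timeDeriv ψ w| ≤ C * |L| := hψ2.trans (by gcongr)
    refine ⟨?_, ?_, ?_, ?_, ?_⟩
    · rw [abs_mul]
      calc |η w.1| * |ψ w| ≤ |A₀| * (C * |ρ w.1|) := by gcongr
        _ = (|A₀| * C) * |ρ w.1| := by ring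
        _ ≤ (D + 1) * |ρ w.1| := by gcongr; linarith
    · rw [timeDeriv_mul_stream hη hψd, abs_mul]
      calc |η w.1| * |timeDeriv ψ w| ≤ |A₀| * (C * |ρ w.1|) := by gcongr
        _ = (|A₀| * C) * |ρ w.1| := by ring
        _ ≤ (D + 1) * |ρ w.1| := by gcongr; linarith
    · refine (norm_add_le _ _).trans ?_
      rw [norm_smul, norm_smul, norm_rot, Real.norm_eq_abs, Real.norm_eq_abs]
      calc |η w.1| * ‖V w‖ + |ψ w| * ‖gradient η w.1‖ ≤ |A₀| * M + (C * |L|) * |A₁| := by gcongr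
        _ ≤ D + 1 := by linarith
    · rw [timeDeriv_cutField hη hψd hVd]
      refine (norm_add_le _ _).trans ?_
      rw [norm_smul, norm_smul, norm_rot, Real.norm_eq_abs, Real.norm_eq_abs]
      calc |η w.1| * ‖timeDeriv V w‖ + |timeDeriv ψ w| * ‖gradient η w.1‖
          ≤ |A₀| * M + (C * |L|) * |A₁| := by
            gcongr
            exact (norm_timeDeriv_le _ _).trans hM2
        _ ≤ D + 1 := by linarith
    · refine ContinuousLinearMap.opNorm_le_bound _ (by positivity) fun a => ?_
      rw [spaceDeriv_cutField hη hψd hVd, hψ.spaceDeriv_stream w hw]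
      have b1 : ‖η w.1 • spaceDeriv V w a‖ ≤ |A₀| * M * ‖a‖ := by
        rw [norm_smul, Real.norm_eq_abs, mul_assoc]
        gcongr
        exact ((spaceDeriv V w).le_opNorm a).trans
          (by gcongr; exact (norm_spaceDeriv_le _ _).trans hM2)
      have b2 : ‖inner ℝ (gradient η w.1) a • V w‖ ≤ |A₁| * M * ‖a‖ := by
        rw [norm_smul]
        calc ‖inner ℝ (gradient η w.1) a‖ * ‖V w‖ ≤ (‖gradient η w.1‖ * ‖a‖) * M := by
              gcongr; exact norm_inner_le_norm _ _
          _ ≤ (|A₁| * ‖a‖) * M := by gcongr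
          _ = _ := by ring
      have b3 : ‖ψ w • rot (fderiv ℝ (gradient η) w.1 a)‖ ≤ C * |L| * |A₂| * ‖a‖ := by
        rw [norm_smul, norm_rot, Real.norm_eq_abs, mul_assoc (C * |L|)]
        gcongr
        exact ((fderiv ℝ (gradient η) w.1).le_opNorm a).trans (by gcongr)
      have b4 : ‖inner ℝ (V w) (rot a) • rot (gradient η w.1)‖ ≤ M * |A₁| * ‖a‖ := by
        rw [norm_smul, norm_rot]
        calc ‖inner ℝ (V w) (rot a)‖ * ‖gradient η w.1‖ ≤ (‖V w‖ * ‖rot a‖) * |A₁| := by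
              gcongr; exact norm_inner_le_norm _ _
          _ ≤ (M * ‖a‖) * |A₁| := by rw [norm_rot]; gcongr
          _ = _ := by ring
      refine (norm_add_le _ _).trans ((add_le_add (norm_add_le _ _) (norm_add_le _ _)).trans ?_)
      calc _ ≤ (|A₀| * M * ‖a‖ + |A₁| * M * ‖a‖) + (C * |L| * |A₂| * ‖a‖ + M * |A₁| * ‖a‖) :=
            add_le_add (add_le_add b1 b2) (add_le_add b3 b4)
        _ = (|A₀| * M + |A₁| * M + (C * |L| * |A₂| + M * |A₁|)) * ‖a‖ := by ring
        _ ≤ (D + 1) * ‖a‖ := mul_le_mul_of_nonneg_right (by linarith) (norm_nonneg a)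
  · intro κ hκ
    set K : Set (Plane × ℝ) := (tsupport η ∩ closure Ω) ×ˢ Icc 0 T with hK
    have hKc : IsCompact K := (hS.inter_right isClosed_closure).prod isCompact_Icc
    have hκ' : 0 < κ / (2 * (|A₀| + 1)) := by positivity
    obtain ⟨ε, hε, hεK⟩ := hKc.exists_forall_abs_le
      (f := fun w => inner ℝ (gradient ρ w.1) (V w)) (g := fun w => ρ w.1)
      (ContinuousOn.inner (𝕜 := ℝ)
        ((contDiff_gradient h.smooth).continuous.comp continuous_fst).continuousOn
        (hV.continuousOn.mono fun w hw => ⟨hw.1.2, hTJ hw.2⟩))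
      (h.smooth.continuous.comp continuous_fst).continuousOn
      (fun w hw h0 => by
        have hb := h.ball_subset (hηs hw.1.1)
        exact hV.slip w.1 (h.mem_frontier_of_eq_zero hΩ hb hw.1.2 h0) w.2 (hTJ hw.2) ρ
          (h.isDefiningFunctionAt hb)) hκ'
    refine ⟨min ε (κ / (2 * (C * |G| * |A₁| + 1))), lt_min hε (by positivity),
      fun x hx t ht hle => ?_⟩
    have hw : (x, t) ∈ (Ω ∩ Metric.ball z r) ×ˢ J := ⟨⟨hx.1, hηs hx.2⟩, hTJ ht⟩
    have a0 : |η x| ≤ |A₀| := (hA₀ _ hx.2).trans (le_abs_self _)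
    have a1 : ‖gradient η x‖ ≤ |A₁| := (hA₁ _ hx.2).trans (le_abs_self _)
    have ag : ‖gradient ρ x‖ ≤ |G| := (hG _ hx.2).trans (le_abs_self _)
    have h1 := hεK (x, t) ⟨⟨hx.2, subset_closure hx.1⟩, ht⟩ (hle.trans (min_le_left _ _))
    have h2 : |ρ x| ≤ _ := hle.trans (min_le_right _ _)
    have h3 : |inner ℝ (gradient ρ x) (rot (gradient η x))| ≤ |G| * |A₁| := by
      refine (abs_real_inner_le_norm _ _).trans ?_
      rw [norm_rot]; gcongr
    simp only [cutField, inner_add_right, real_inner_smul_right]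
    refine (abs_add_le _ _).trans ?_
    rw [abs_mul, abs_mul]
    calc |η x| * |inner ℝ (gradient ρ x) (V (x, t))|
          + |ψ (x, t)| * |inner ℝ (gradient ρ x) (rot (gradient η x))|
        ≤ (|A₀| + 1) * (κ / (2 * (|A₀| + 1))) + (C * |ρ x|) * (|G| * |A₁|) := by
          gcongr
          · linarith
          · exact (hψC _ hw).1
      _ ≤ κ / 2 + κ / 2 := by
          gcongr
          · exact le_of_eq (by field_simp)
          · calc C * |ρ x| * (|G| * |A₁|) ≤ (C * |G| * |A₁| + 1) * |ρ x| := by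
                  nlinarith [abs_nonneg (ρ x)]
              _ ≤ (C * |G| * |A₁| + 1) * (κ / (2 * (C * |G| * |A₁| + 1))) := by gcongr
              _ = κ / 2 := by field_simp
      _ = κ := by ring

lemma aestronglyMeasurable_inner_spaceDeriv {u : Plane × ℝ → Plane} {μ : Measure (Plane × ℝ)}
    (hu : AEStronglyMeasurable u μ) (V : Plane × ℝ → Plane) :
    AEStronglyMeasurable (fun w => inner ℝ (spaceDeriv V w (u w)) (u w)) μ := by
  have h1 : AEStronglyMeasurable (fun w => fderiv ℝ V w) μ :=
    (measurable_fderiv ℝ V).aestronglyMeasurable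
  have h2 : Continuous fun p : (Plane × ℝ →L[ℝ] Plane) × Plane => p.1 (p.2, 0) := by fun_prop
  exact (h2.comp_aestronglyMeasurable (h1.prodMk hu)).inner hu

lemma aestronglyMeasurable_inner_timeDeriv {u : Plane × ℝ → Plane} {μ : Measure (Plane × ℝ)}
    (hu : AEStronglyMeasurable u μ) (V : Plane × ℝ → Plane) :
    AEStronglyMeasurable (fun w => inner ℝ (timeDeriv V w) (u w)) μ :=
  AEStronglyMeasurable.inner (measurable_fderiv_apply_const ℝ V (0, 1)).aestronglyMeasurable hu

section
variable {Ω : Set Plane} {T : ℝ} {J : Set ℝ} {u : Plane × ℝ → Plane}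

lemma differentiableAt_of_contDiffOn {F : Type*} [NormedAddCommGroup F] [NormedSpace ℝ F]
    {V : Plane × ℝ → F} (hΩ : IsOpen Ω) (hJ : IsOpen J)
    (hV : ContDiffOn ℝ 1 V (Ω ×ˢ J)) {w : Plane × ℝ} (hw : w ∈ Ω ×ˢ J) : DifferentiableAt ℝ V w :=
  (hV.contDiffAt ((hΩ.prod hJ).mem_nhds hw)).differentiableAt (by simp)

lemma isNegligible_zero : IsNegligible Ω T J u fun _ => 0 := by
  refine ⟨fun n => contDiffOn_const, fun w _ => Eventually.of_forall fun n => EventuallyEq.rfl,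
    ⟨0, fun n w _ => by simp [timeDeriv]⟩, ?_⟩
  simp [spaceDeriv]

lemma spaceDeriv_add {V W : Plane × ℝ → Plane} {w : Plane × ℝ} (hV : DifferentiableAt ℝ V w)
    (hW : DifferentiableAt ℝ W w) : spaceDeriv (V + W) w = spaceDeriv V w + spaceDeriv W w := by
  rw [spaceDeriv, fderiv_add hV hW]; rfl

lemma timeDeriv_add {V W : Plane × ℝ → Plane} {w : Plane × ℝ} (hV : DifferentiableAt ℝ V w)
    (hW : DifferentiableAt ℝ W w) : timeDeriv (V + W) w = timeDeriv V w + timeDeriv W w := by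
  rw [timeDeriv, fderiv_add hV hW]; rfl

lemma spaceDeriv_sub {V W : Plane × ℝ → Plane} {w : Plane × ℝ} (hV : DifferentiableAt ℝ V w)
    (hW : DifferentiableAt ℝ W w) : spaceDeriv (V - W) w = spaceDeriv V w - spaceDeriv W w := by
  rw [spaceDeriv, fderiv_sub hV hW]; rfl

lemma timeDeriv_sub {V W : Plane × ℝ → Plane} {w : Plane × ℝ} (hV : DifferentiableAt ℝ V w)
    (hW : DifferentiableAt ℝ W w) : timeDeriv (V - W) w = timeDeriv V w - timeDeriv W w := by
  rw [timeDeriv, fderiv_sub hV hW]; rfl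

lemma IsNegligible.add (hΩ : IsOpen Ω) (hJ : IsOpen J) (hTJ : Icc 0 T ⊆ J)
    (hu : AEStronglyMeasurable u (volume.restrict (Ω ×ˢ Ioo 0 T)))
    {W₁ W₂ : ℕ → Plane × ℝ → Plane} (h₁ : IsNegligible Ω T J u W₁) (h₂ : IsNegligible Ω T J u W₂) :
    IsNegligible Ω T J u fun n => W₁ n + W₂ n := by
  have hd₁ : ∀ n, ∀ w ∈ Ω ×ˢ J, DifferentiableAt ℝ (W₁ n) w := fun n w hw =>
    differentiableAt_of_contDiffOn hΩ hJ (h₁.contDiffOn n) hw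
  have hd₂ : ∀ n, ∀ w ∈ Ω ×ˢ J, DifferentiableAt ℝ (W₂ n) w := fun n w hw =>
    differentiableAt_of_contDiffOn hΩ hJ (h₂.contDiffOn n) hw
  refine ⟨fun n => (h₁.contDiffOn n).add (h₂.contDiffOn n), fun w hw => ?_, ?_, ?_⟩
  · filter_upwards [h₁.eventually_zero w hw, h₂.eventually_zero w hw] with n hn₁ hn₂
    simpa using hn₁.add hn₂
  · obtain ⟨D₁, hD₁⟩ := h₁.bound
    obtain ⟨D₂, hD₂⟩ := h₂.bound
    refine ⟨D₁ + D₂, fun n w hw => ⟨?_, ?_⟩⟩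
    · exact (norm_add_le _ _).trans (add_le_add (hD₁ n w hw).1 (hD₂ n w hw).1)
    · rw [timeDeriv_add (hd₁ n w hw) (hd₂ n w hw)]
      exact (norm_add_le _ _).trans (add_le_add (hD₁ n w hw).2 (hD₂ n w hw).2)
  · have hlim := h₁.transport.add h₂.transport
    rw [add_zero] at hlim
    refine tendsto_of_tendsto_of_tendsto_of_le_of_le tendsto_const_nhds hlim
      (fun n => zero_le) fun n => ?_
    rw [← lintegral_add_left' (aestronglyMeasurable_inner_spaceDeriv hu (W₁ n)).enorm]
    refine setLIntegral_mono_ae' (hΩ.prod isOpen_Ioo).measurableSet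
      (Eventually.of_forall fun w hw => ?_)
    have hwJ : w ∈ Ω ×ˢ J := ⟨hw.1, hTJ ⟨hw.2.1.le, hw.2.2.le⟩⟩
    rw [spaceDeriv_add (hd₁ n w hwJ) (hd₂ n w hwJ), add_apply, inner_add_left]
    exact enorm_add_le _ _

lemma IsNegligible.sum (hΩ : IsOpen Ω) (hJ : IsOpen J) (hTJ : Icc 0 T ⊆ J)
    (hu : AEStronglyMeasurable u (volume.restrict (Ω ×ˢ Ioo 0 T))) {ι : Type*} (s : Finset ι)
    {W : ι → ℕ → Plane × ℝ → Plane} (h : ∀ i ∈ s, IsNegligible Ω T J u (W i)) :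
    IsNegligible Ω T J u fun n => ∑ i ∈ s, W i n := by
  classical
  induction s using Finset.induction_on with
  | empty => simpa using isNegligible_zero
  | insert a s ha ih =>
    simp only [Finset.sum_insert ha]
    exact (h a (Finset.mem_insert_self a s)).add hΩ hJ hTJ hu
      (ih fun i hi => h i (Finset.mem_insert_of_mem hi))

lemma planeTrace_add (A B : Plane →L[ℝ] Plane) :
    planeTrace (A + B) = planeTrace A + planeTrace B := by
  simp [planeTrace, Finset.sum_add_distrib]

lemma planeTrace_sub (A B : Plane →L[ℝ] Plane) :
    planeTrace (A - B) = planeTrace A - planeTrace B := by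
  simp [planeTrace, Finset.sum_sub_distrib]

lemma planeTrace_spaceDeriv_sum {ι : Type*} (s : Finset ι) {W : ι → Plane × ℝ → Plane}
    {w : Plane × ℝ} (hd : ∀ i ∈ s, DifferentiableAt ℝ (W i) w)
    (h : ∀ i ∈ s, planeTrace (spaceDeriv (W i) w) = 0) :
    planeTrace (spaceDeriv (∑ i ∈ s, W i) w) = 0 := by
  have h1 : spaceDeriv (∑ i ∈ s, W i) w = ∑ i ∈ s, spaceDeriv (W i) w := by
    rw [spaceDeriv, fderiv_sum hd]
    ext a : 1
    simp [spaceDeriv]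
  have h2 : ∀ t : Finset ι, planeTrace (∑ i ∈ t, spaceDeriv (W i) w)
      = ∑ i ∈ t, planeTrace (spaceDeriv (W i) w) := by
    classical
    intro t
    induction t using Finset.induction_on with
    | empty => simp [planeTrace]
    | insert a t ha ih => rw [Finset.sum_insert ha, planeTrace_add, ih, Finset.sum_insert ha]
  rw [h1, h2]
  exact Finset.sum_eq_zero h

/-- A field is compactly supported in `Ω` as soon as it vanishes near each boundary point. -/
lemma exists_isCompact_of_vanish (hΩ : IsOpen Ω) (hb : Bornology.IsBounded Ω)
    {W : Plane × ℝ → Plane} (h : ∀ y ∈ frontier Ω, ∀ᶠ x in 𝓝 y, x ∈ Ω → ∀ t ∈ J, W (x, t) = 0) :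
    ∃ K : Set Plane, IsCompact K ∧ K ⊆ Ω ∧ ∀ x ∈ Ω, x ∉ K → ∀ t ∈ J, W (x, t) = 0 := by
  set G : Set Plane := {y | ∀ᶠ x in 𝓝 y, x ∈ Ω → ∀ t ∈ J, W (x, t) = 0} with hG
  have hGo : IsOpen G := isOpen_setOfPred_eventually_nhds
  refine ⟨closure Ω \ G, hb.isCompact_closure.diff hGo, fun x hx => ?_, fun x hx hxK t ht => ?_⟩
  · by_contra hxΩ
    exact hx.2 (h x (by rw [hΩ.frontier_eq]; exact ⟨hx.1, hxΩ⟩))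
  · have hxG : x ∈ G := by
      by_contra hxG
      exact hxK ⟨subset_closure hx, hxG⟩
    exact (Eventually.self_of_nhds hxG) hx t ht

end

/-- A tangential divergence-free field is the sum of a test field and of a negligible field. It is
localized near the boundary by means of its local stream functions and of a
partition of unity, and the negligible fields are the boundary layers of the pieces. -/
theorem exists_isNegligible {Ω : Set Plane} {T : ℝ} {J : Set ℝ} {u v V : Plane × ℝ → Plane}
    {N : Set (Plane × ℝ)} (hΩ : IsSmoothBoundedDomain Ω) (hJ : IsOpen J) (hTJ : Icc 0 T ⊆ J)
    (hu : AEStronglyMeasurable u (volume.restrict (Ω ×ˢ Ioo 0 T)))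
    (hv : IsTangentTrace Ω T u N v) (hV : IsTangentField Ω J V) :
    ∃ W : ℕ → Plane × ℝ → Plane, IsNegligible Ω T J u W ∧ ∀ n, IsTestField Ω T (V - W n) := by
  have hchart : ∀ z ∈ frontier Ω, ∃ R r ρ e β c ψ C, 0 < r ∧ IsBoundaryChart Ω z R r ρ e β c ∧
      Metric.closedBall z r ×ˢ Icc 0 T ⊆ N ∧ 0 < C ∧
      IsStreamPair ((Ω ∩ Metric.ball z r) ×ˢ J) ψ V ∧
      ∀ w ∈ (Ω ∩ Metric.ball z r) ×ˢ J,
        |ψ w| ≤ C * |ρ w.1| ∧ |timeDeriv ψ w| ≤ C * |ρ w.1| := by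
    intro z hz
    obtain ⟨O₁, O₂, hO₁, -, hzO₁, hO₂, hsub⟩ := generalized_tube_lemma (isCompact_singleton (x := z))
      (isCompact_Icc (a := (0 : ℝ)) (b := T)) hv.isOpen
      ((prod_mono (singleton_subset_iff.2 hz) subset_rfl).trans hv.subset)
    obtain ⟨r₀, hr₀, hball⟩ := Metric.isOpen_iff.1 hO₁ z (hzO₁ rfl)
    obtain ⟨R, r, ρ, e, β, c, hR, h⟩ := exists_isBoundaryChart hΩ hz hr₀
    obtain ⟨ψ, C, hC, hψ, hψC⟩ := h.exists_stream hΩ.isOpen hJ hV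
    refine ⟨R, r, ρ, e, β, c, ψ, C, h.r_pos, h, ?_, hC, hψ, hψC⟩
    exact (prod_mono (h.closedBall_subset.trans ((Metric.ball_subset_ball hR).trans hball))
      hO₂).trans hsub
  choose! R r ρ e β c ψ C hr h hN hC hψ hψC using hchart
  have hfc : IsCompact (frontier Ω) := hΩ.isBounded.isCompact_closure.of_isClosed_subset
    isClosed_frontier frontier_subset_closure
  obtain ⟨t, htf, hcover⟩ := hfc.elim_nhds_subcover (fun z => Metric.ball z (r z))
    fun z hz => Metric.ball_mem_nhds z (hr z hz)
  obtain ⟨δ, hδ, hthick⟩ := hfc.exists_cthickening_subset_open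
    (isOpen_biUnion fun z _ => Metric.isOpen_ball) hcover
  obtain ⟨f, hf⟩ := SmoothPartitionOfUnity.exists_isSubordinate (modelWithCornersSelf ℝ Plane)
    (Metric.isClosed_cthickening (δ := δ) (E := frontier Ω))
    (fun z : t => Metric.ball (z : Plane) (r z)) (fun _ => Metric.isOpen_ball)
    (fun x hx => by
      obtain ⟨z, hz, hxz⟩ := mem_iUnion₂.1 (hthick hx)
      exact mem_iUnion.2 ⟨⟨z, hz⟩, hxz⟩)
  set η : t → Plane → ℝ := fun z => f z with hηdef
  have hη : ∀ z, ContDiff ℝ ∞ (η z) := fun z => (f z).contMDiff.contDiff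
  have hηs : ∀ z : t, tsupport (η z) ⊆ Metric.ball (z : Plane) (r z) := fun z => hf z
  have hηsum : ∀ x ∈ Metric.cthickening δ (frontier Ω), ∑ z, η z x = 1 := by
    intro x hx
    have := f.sum_eq_one hx
    rwa [finsum_eq_sum_of_fintype] at this
  have hz : ∀ z : t, (z : Plane) ∈ frontier Ω := fun z => htf z z.2
  obtain ⟨θ, B, hθ, hθ1, hθ0, -, hB⟩ := exists_cutoff
  have hF : ∀ z : t, IsLayerField Ω z (r z) (ρ z) J T (tsupport (η z))
      (fun w => η z w.1 * ψ z w) (cutField (η z) (ψ z) V) := fun z =>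
    isLayerField_cutField (h z (hz z)) hΩ.isOpen hJ hTJ hV (hC z (hz z)) (hψ z (hz z))
      (hψC z (hz z)) (hη z) (hηs z)
  set L : t → ℕ → Plane × ℝ → Plane := fun z =>
    boundaryLayer θ (ρ z) (fun w => η z w.1 * ψ z w) (cutField (η z) (ψ z) V) with hL
  have hLd : ∀ z n, ContDiffOn ℝ 1 (L z n) (Ω ×ˢ J) := fun z n =>
    (hF z).contDiffOn_cutField hΩ.isOpen hJ
      (IsLayerField.contDiff_cutoff hθ (h z (hz z)).smooth _)
  have hWd : ∀ n, ContDiffOn ℝ 1 (∑ z, L z n) (Ω ×ˢ J) := fun n => by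
    have := ContDiffOn.sum (s := Finset.univ) fun z _ => hLd z n
    simpa [Finset.sum_fn] using this
  have hJsub : Ω ×ˢ Icc 0 T ⊆ Ω ×ˢ J := prod_mono subset_rfl hTJ
  refine ⟨fun n => ∑ z, L z n, IsNegligible.sum hΩ.isOpen hJ hTJ hu _ fun z _ =>
    (hF z).isNegligible_boundaryLayer (h z (hz z)) hΩ.isOpen hJ hTJ hv (hN z (hz z)) hθ hθ0 hB,
    fun n => ⟨(hV.contDiffOn.sub (hWd n)).mono hJsub, ?_, fun x hx s hs => ?_⟩⟩
  swap
  · have hw : (x, s) ∈ Ω ×ˢ J := hJsub ⟨hx, hs⟩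
    have hd1 := differentiableAt_of_contDiffOn hΩ.isOpen hJ hV.contDiffOn hw
    have hd2 := differentiableAt_of_contDiffOn hΩ.isOpen hJ (hWd n) hw
    rw [divergence_spaceSlice (hd1.sub hd2), spaceDeriv_sub hd1 hd2, planeTrace_sub,
      hV.trace_eq_zero _ hw, planeTrace_spaceDeriv_sum, sub_zero]
    · exact fun z _ => differentiableAt_of_contDiffOn hΩ.isOpen hJ (hLd z n) hw
    · exact fun z _ => (hF z).planeTrace_cutField hΩ.isOpen hJ
        (IsLayerField.contDiff_cutoff hθ (h z (hz z)).smooth _) hw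
  -- near the boundary, the layers add up to the field itself
  obtain ⟨K, hKc, hKΩ, hK⟩ := exists_isCompact_of_vanish (J := J) hΩ.isOpen hΩ.isBounded
    (W := V - ∑ z, L z n) fun y hy => by
      have hlayer : ∀ᶠ x in 𝓝 y, ∀ z : t, ∀ s, L z n (x, s) = cutField (η z) (ψ z) V (x, s) := by
        rw [eventually_all]
        intro z
        by_cases hyS : y ∈ tsupport (η z)
        · have hρ := (h z (hz z)).smooth.continuous
          have hy0 : ρ z y = 0 := (h z (hz z)).eq_zero_of_frontier hΩ.isOpen
            ((h z (hz z)).ball_subset (hηs z hyS)) hy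
          have hlt : ∀ᶠ x in 𝓝 y, (n + 1 : ℝ) * |ρ z x| < 1 :=
            (continuous_const.mul hρ.abs).continuousAt.eventually (gt_mem_nhds (by simp [hy0]))
          exact hlt.mono fun x hx s => (hF z).boundaryLayer_eq_field hρ hθ1 (Or.inr hx)
        · filter_upwards [(isClosed_tsupport (η z)).isOpen_compl.mem_nhds hyS] with x hx s
          exact (hF z).boundaryLayer_eq_field (h z (hz z)).smooth.continuous hθ1 (Or.inl hx)
      obtain ⟨z₀, hz₀t, hyz₀⟩ := mem_iUnion₂.1 (hcover hy)
      have hz₀ := htf z₀ hz₀t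
      have hstream : ∀ᶠ x in 𝓝 y, ∀ z : t, x ∈ Ω → ∀ s ∈ J,
          ψ z (x, s) • rot (gradient (η z) x) = ψ z₀ (x, s) • rot (gradient (η z) x) := by
        rw [eventually_all]
        intro z
        by_cases hyS : y ∈ tsupport (η z)
        · have hglue := exists_nhds_stream_eq hΩ.isOpen hJ Metric.isOpen_ball Metric.isOpen_ball
            (hψ z (hz z)) (hψ z₀ hz₀)
            (continuous_const.mul (h z (hz z)).smooth.continuous.abs)
            (continuous_const.mul (h z₀ hz₀).smooth.continuous.abs)
            (fun w hw => (hψC z (hz z) w hw).1) (fun w hw => (hψC z₀ hz₀ w hw).1)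
            (fun y hy hyb => by
              simp [(h z (hz z)).eq_zero_of_frontier hΩ.isOpen ((h z (hz z)).ball_subset hyb) hy])
            (fun y hy hyb => by
              simp [(h z₀ hz₀).eq_zero_of_frontier hΩ.isOpen ((h z₀ hz₀).ball_subset hyb) hy])
            hy (hηs z hyS) hyz₀
          exact hglue.mono fun x hx hxΩ s hs => by rw [hx hxΩ s hs]
        · filter_upwards [(isClosed_tsupport (η z)).isOpen_compl.mem_nhds hyS] with x hx _ s _
          simp [gradient_eq_zero_of_notMem_tsupport hx]
      have hone : ∀ᶠ x in 𝓝 y, (fun x => ∑ z, η z x) =ᶠ[𝓝 x] fun _ => 1 := by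
        have : Metric.thickening δ (frontier Ω) ∈ 𝓝 y :=
          Metric.isOpen_thickening.mem_nhds (Metric.self_subset_thickening hδ _ hy)
        have h1 : ∀ᶠ x in 𝓝 y, ∑ z, η z x = 1 := by
          filter_upwards [this] with x hx
          exact hηsum x (Metric.thickening_subset_cthickening _ _ hx)
        exact h1.eventually_nhds
      filter_upwards [hlayer, hstream, hone] with x hxl hxs hx1 hxΩ s hs
      have hgrad : ∑ z, gradient (η z) x = 0 := by
        have h1 : HasFDerivAt (fun x => ∑ z, η z x) (∑ z, fderiv ℝ (η z) x) x :=
          HasFDerivAt.fun_sum fun z _ => ((hη z).differentiable (by simp) x).hasFDerivAt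
        have h2 : ∑ z, fderiv ℝ (η z) x = 0 :=
          h1.unique ((hasFDerivAt_const (1 : ℝ) x).congr_of_eventuallyEq hx1)
        have h3 := congrArg (InnerProductSpace.toDual ℝ Plane).symm h2
        simpa [gradient] using h3
      have hsum1 : ∑ z, η z x = 1 := hx1.self_of_nhds
      -- the terms `ψ_z ∇η_z` cancel because all the stream functions near `y` equal `ψ z₀`
      simp only [Pi.sub_apply, Finset.sum_apply, hxl, cutField, hxs _ hxΩ s hs,
        Finset.sum_add_distrib, ← Finset.sum_smul, ← Finset.smul_sum, hsum1, ← map_sum, hgrad,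
        map_zero, smul_zero, one_smul, add_zero, sub_self]
  exact ⟨K, hKc, hKΩ, fun x hx hxK s hs => hK x hx hxK s (hTJ hs)⟩

end Euler2D

/-! ### Orthogonality to gradients and the normal trace -/

namespace Euler2D

open Filter Topology

lemma ae_ae_of_ae_prod_right {α β : Type*} [MeasurableSpace α] [MeasurableSpace β] {μ : Measure α}
    {ν : Measure β} [SFinite μ] [SFinite ν] {p : α × β → Prop} (h : ∀ᵐ z ∂μ.prod ν, p z) :
    ∀ᵐ y ∂ν, ∀ᵐ x ∂μ, p (x, y) :=
  Measure.ae_ae_of_ae_prod (p := fun z : β × α => p z.swap)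
    (Measure.measurePreserving_swap.quasiMeasurePreserving.ae h)

/-- A compactly supported `C¹` divergence-free field is orthogonal to gradients. -/
theorem integral_inner_gradient_eq_zero {Ω K : Set Plane} (hΩ : IsOpen Ω) {q : Plane → ℝ}
    (hq : ∀ x ∈ Ω, DifferentiableAt ℝ q x) (hq' : ContinuousOn (gradient q) Ω)
    {w : Plane → Plane} (hw : ContDiffOn ℝ 1 w Ω) (hK : IsCompact K) (hKΩ : K ⊆ Ω)
    (hwK : ∀ x ∈ Ω, x ∉ K → w x = 0) (hdiv : ∀ x ∈ Ω, divergence w x = 0) :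
    ∫ x in Ω, inner ℝ (gradient q x) (w x) = 0 := by
  -- the extension of `w` by zero
  set W : Plane → Plane := Ω.indicator w with hWdef
  have hW0 : ∀ x ∉ K, W x = 0 := fun x hx => by
    by_cases hxΩ : x ∈ Ω
    · rw [hWdef, indicator_of_mem hxΩ, hwK x hxΩ hx]
    · rw [hWdef, indicator_of_notMem hxΩ]
  have hWev0 : ∀ x ∉ K, W =ᶠ[𝓝 x] 0 := fun x hx => by
    filter_upwards [hK.isClosed.isOpen_compl.mem_nhds hx] with y hy using hW0 y hy
  have hWevΩ : ∀ x ∈ Ω, W =ᶠ[𝓝 x] w := fun x hx => by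
    filter_upwards [hΩ.mem_nhds hx] with y hy using indicator_of_mem hy w
  have hWC : ContDiff ℝ 1 W := by
    rw [contDiff_iff_contDiffAt]
    intro x
    by_cases hx : x ∈ K
    · exact (hw.contDiffAt (hΩ.mem_nhds (hKΩ hx))).congr_of_eventuallyEq (hWevΩ x (hKΩ hx))
    · exact contDiffAt_const.congr_of_eventuallyEq (hWev0 x hx)
  have hWd : ∀ x, HasFDerivAt W (fderiv ℝ W x) x := fun x =>
    (hWC.differentiable (by simp) x).hasFDerivAt
  have hWd0 : ∀ x ∉ K, fderiv ℝ W x = 0 := fun x hx => by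
    rw [(hWev0 x hx).fderiv_eq]; simp
  have htr : ∀ x, planeTrace (fderiv ℝ W x) = 0 := by
    intro x
    by_cases hx : x ∈ K
    · rw [(hWevΩ x (hKΩ hx)).fderiv_eq, ← divergence_eq
        ((hw.contDiffAt (hΩ.mem_nhds (hKΩ hx))).differentiableAt (by simp)).hasFDerivAt]
      exact hdiv x (hKΩ hx)
    · rw [hWd0 x hx]; simp [planeTrace]
  have hcomp : ∀ i : Fin 2, ∀ x, HasFDerivAt (fun y => W y i)
      ((EuclideanSpace.proj i : Plane →L[ℝ] ℝ).comp (fderiv ℝ W x)) x := fun i x =>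
    (EuclideanSpace.proj i : Plane →L[ℝ] ℝ).hasFDerivAt.comp x (hWd x)
  have hfc : ∀ (i : Fin 2) (x a : Plane), fderiv ℝ (fun y => W y i) x a = fderiv ℝ W x a i :=
    fun i x a => by rw [(hcomp i x).fderiv]; rfl
  have hint : ∀ F : Plane → ℝ, ContinuousOn F K → (∀ x ∉ K, F x = 0) → Integrable F :=
    fun F hF h0 => (integrableOn_iff_integrable_of_support_subset
      (fun x hx => by by_contra hxK; exact hx (h0 x hxK))).1 (hF.integrableOn_compact hK)
  have hqc : ContinuousOn q K := fun x hx => (hq x (hKΩ hx)).continuousAt.continuousWithinAt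
  have hq'c : ∀ a : Plane, ContinuousOn (fun x => fderiv ℝ q x a) K := fun a => by
    simp only [← inner_gradient_left]
    exact (hq'.mono hKΩ).inner continuousOn_const
  have hWi : ∀ i : Fin 2, Continuous fun x => W x i := fun i =>
    (EuclideanSpace.proj i : Plane →L[ℝ] ℝ).continuous.comp hWC.continuous
  have hWi' : ∀ (i : Fin 2) (a : Plane), Continuous fun x => fderiv ℝ W x a i := fun i a =>
    (EuclideanSpace.proj i : Plane →L[ℝ] ℝ).continuous.comp
      ((hWC.continuous_fderiv (by simp)).clm_apply continuous_const)
  set e : Fin 2 → Plane := fun i => EuclideanSpace.single i 1 with he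
  have hI1 : ∀ i, Integrable fun x => fderiv ℝ q x (e i) * W x i := fun i =>
    hint _ ((hq'c _).mul (hWi i).continuousOn) fun x hx => by simp [hW0 x hx]
  have hI2 : ∀ i, Integrable fun x => q x * fderiv ℝ W x (e i) i := fun i =>
    hint _ (hqc.mul (hWi' i (e i)).continuousOn) fun x hx => by simp [hWd0 x hx]
  have hibp : ∀ i : Fin 2, ∫ x, fderiv ℝ q x (e i) * W x i = -∫ x, q x * fderiv ℝ W x (e i) i := by
    intro i
    have hsupp : tsupport (fun x => W x i) ⊆ K := by
      refine closure_minimal (fun x hx => ?_) hK.isClosed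
      by_contra hxK
      exact hx (by simp [hW0 x hxK])
    have h1 := integral_mul_fderiv_eq_neg_fderiv_mul_of_integrable (𝕜 := ℝ) (μ := volume)
      (f := q) (g := fun x => W x i) (v := e i) (hI1 i) (by simpa only [hfc] using hI2 i)
      (hint _ (hqc.mul (hWi i).continuousOn) fun x hx => by simp [hW0 x hx])
      (fun x hx => hq x (hKΩ (hsupp hx))) (fun x _ => (hcomp i x).differentiableAt)
    simp only [hfc] at h1
    rw [h1, neg_neg]
  have h1 : ∫ x in Ω, inner ℝ (gradient q x) (w x) = ∫ x, inner ℝ (gradient q x) (W x) := by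
    refine (setIntegral_congr_fun (g := fun x => inner ℝ (gradient q x) (W x)) hΩ.measurableSet
      fun x hx => ?_).trans (setIntegral_eq_integral_of_forall_compl_eq_zero fun x hx => ?_)
    · simp only [hWdef, indicator_of_mem hx]
    · rw [hWdef, indicator_of_notMem hx, inner_zero_right]
  have h2 : ∀ x, inner ℝ (gradient q x) (W x)
      = fderiv ℝ q x (e 0) * W x 0 + fderiv ℝ q x (e 1) * W x 1 := by
    intro x
    rw [inner_gradient_left]
    conv_lhs => rw [eq_coords (W x)]
    simp [he, mul_comm]
  simp only [h1, h2]
  rw [integral_add (hI1 0) (hI1 1), hibp 0, hibp 1, ← neg_add, ← integral_add (hI2 0) (hI2 1)]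
  have h3 : ∀ x, q x * fderiv ℝ W x (e 0) 0 + q x * fderiv ℝ W x (e 1) 1 = 0 := by
    intro x
    have := htr x
    simp only [planeTrace, Fin.sum_univ_two] at this
    rw [← mul_add, he, this, mul_zero]
  simp [h3]

lemma integrable_inner_of_memLp {α : Type*} [MeasurableSpace α] {μ : Measure α} {f g : α → Plane}
    (hf : MemLp f 2 μ) (hg : MemLp g 2 μ) : Integrable (fun x => inner ℝ (f x) (g x)) μ := by
  refine (L2.integrable_inner (𝕜 := ℝ) hf.toLp hg.toLp).congr ?_
  filter_upwards [hf.coeFn_toLp, hg.coeFn_toLp] with x h1 h2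
  rw [h1, h2]

/-- The elements of `H(Ω)` are orthogonal to bounded continuous gradients. -/
theorem MemSolenoidal.integral_inner_gradient {Ω : Set Plane} (hΩ : IsOpen Ω)
    (hb : Bornology.IsBounded Ω) {f : Plane → Plane} (hf : MemSolenoidal Ω f) {q : Plane → ℝ}
    (hq : ∀ x ∈ Ω, DifferentiableAt ℝ q x) (hq' : ContinuousOn (gradient q) Ω) {M : ℝ}
    (hM : ∀ x ∈ Ω, ‖gradient q x‖ ≤ M) :
    ∫ x in Ω, inner ℝ (gradient q x) (f x) = 0 := by
  have hfin : IsFiniteMeasure (volume.restrict Ω) :=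
    ⟨by rw [Measure.restrict_apply_univ]; exact hb.measure_lt_top⟩
  have hg : MemLp (gradient q) 2 (volume.restrict Ω) :=
    MemLp.of_bound (hq'.aestronglyMeasurable hΩ.measurableSet) M
      ((ae_restrict_iff' hΩ.measurableSet).2 (Eventually.of_forall hM))
  obtain ⟨hf2, hmem⟩ := hf
  have hclosed : IsClosed {w : Lp Plane 2 (volume.restrict Ω) | inner ℝ hg.toLp w = 0} :=
    isClosed_eq (by fun_prop) continuous_const
  have hinner : ∀ (w : Lp Plane 2 (volume.restrict Ω)) (F : Plane → Plane),
      w =ᵐ[volume.restrict Ω] F →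
      inner ℝ hg.toLp w = ∫ x in Ω, inner ℝ (gradient q x) (F x) := by
    intro w F hwF
    rw [L2.inner_def]
    refine integral_congr_ae ?_
    filter_upwards [hg.coeFn_toLp, hwF] with x h1 h2
    rw [h1, h2]
  have hsub : solenoidal Ω ⊆ {w | inner ℝ hg.toLp w = 0} := by
    refine closure_minimal ?_ hclosed
    rintro w ⟨F, hF, hFc, hFs, hdiv, hwF⟩
    rw [mem_ofPred_eq, hinner w F hwF]
    exact integral_inner_gradient_eq_zero hΩ hq hq' (hF.of_le (by simp)).contDiffOn hFc hFs
      (fun x _ hx => image_eq_zero_of_notMem_tsupport hx) (fun x _ => hdiv x)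
  rw [← hinner hf2.toLp f hf2.coeFn_toLp]
  exact hsub hmem

/-- A `C¹` function on the line that vanishes on the negative half-line and has the positive
derivative `s` at each `s > 0`. -/
lemma exists_positive_part_primitive : ∃ g : ℝ → ℝ,
    (∀ s, HasDerivAt g (max s 0) s) ∧ ∀ s ≤ 0, g s = 0 := by
  have hc : Continuous fun s : ℝ => max s 0 := by fun_prop
  refine ⟨fun s => ∫ σ in (0 : ℝ)..s, max σ 0,
    fun s => (hc.integral_hasStrictDerivAt 0 s).hasDerivAt, fun s hs => ?_⟩
  show ∫ σ in (0 : ℝ)..s, max σ 0 = 0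
  rw [intervalIntegral.integral_congr (g := fun _ => 0) fun σ hσ => ?_]
  · simp
  · rw [uIcc_of_ge hs] at hσ
    exact max_eq_right hσ.2

/-- If an element of `H(Ω)` is continuous up to a boundary point, its normal component vanishes
there. Otherwise it is not orthogonal to the gradient of a bump that increases in the direction of
the normal and meets `Ω` only in a small neighbourhood of the point. -/
theorem MemSolenoidal.inner_gradient_eq_zero {Ω O : Set Plane} (hΩ : IsOpen Ω)
    (hb : Bornology.IsBounded Ω) {f v : Plane → Plane} (hf : MemSolenoidal Ω f) {z : Plane}
    (hz : z ∈ frontier Ω) (hO : IsOpen O) (hzO : z ∈ O)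
    (hfv : ∀ᵐ x ∂volume.restrict Ω, x ∈ O → f x = v x) (hv : ContinuousWithinAt v Ω z)
    {ρ : Plane → ℝ} (hρ : IsDefiningFunctionAt Ω z ρ) : inner ℝ (gradient ρ z) (v z) = 0 := by
  obtain ⟨hρs, -, N, hN, hzN, hNΩ⟩ := hρ
  have hρz := eq_zero_of_mem_frontier hΩ hN hρs.continuous hNΩ hzN hz
  by_contra hne
  set κ := inner ℝ (gradient ρ z) (v z) with hκ
  -- the normal component keeps its sign near `z`
  have hev : ∀ᶠ x in 𝓝[Ω] z, 0 < κ * inner ℝ (gradient ρ x - (2 : ℝ) • (x - z)) (v x) := by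
    have h1 : ContinuousWithinAt (fun x => gradient ρ x - (2 : ℝ) • (x - z)) Ω z :=
      ((contDiff_gradient hρs).continuous.sub (by fun_prop)).continuousWithinAt
    have h2 : ContinuousWithinAt
        (fun x => κ * inner ℝ (gradient ρ x - (2 : ℝ) • (x - z)) (v x)) Ω z :=
      continuousWithinAt_const.mul (ContinuousWithinAt.inner (𝕜 := ℝ) h1 hv)
    refine h2.eventually (lt_mem_nhds ?_)
    simp only [sub_self, smul_zero, sub_zero, ← hκ]
    exact mul_self_pos.2 hne
  rw [eventually_nhdsWithin_iff] at hev
  obtain ⟨r, hr, hball⟩ := Metric.eventually_nhds_iff_ball.1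
    (hev.and ((hN.inter hO).mem_nhds ⟨hzN, hzO⟩))
  let χ : ContDiffBump z := ⟨r / 2, 3 * r / 4, by linarith, by linarith⟩
  have hχ1 : ∀ x, dist x z ≤ r / 2 → χ x = 1 := fun x hx =>
    χ.one_of_mem_closedBall (Metric.mem_closedBall.2 hx)
  have hχs : ∀ x, x ∉ Metric.ball z r → χ x = 0 := fun x hx =>
    χ.zero_of_le_dist (by
      rw [Metric.mem_ball, not_lt] at hx
      change 3 * r / 4 ≤ _
      linarith)
  have hχs' : ∀ x, x ∉ Metric.ball z r → gradient χ x = 0 := fun x hx => by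
    apply gradient_eq_zero_of_notMem_tsupport
    rw [χ.tsupport_eq, Metric.mem_closedBall, not_le]
    rw [Metric.mem_ball, not_lt] at hx
    change 3 * r / 4 < _
    linarith
  have hχC : ContDiff ℝ ∞ χ := χ.contDiff
  obtain ⟨g, hg, hg0⟩ := exists_positive_part_primitive
  set δ := (r / 2) ^ 2 with hδ
  have hδ0 : 0 < δ := by positivity
  set σ : Plane → ℝ := fun x => ρ x + δ - ‖x - z‖ ^ 2 with hσ
  have hσc : Continuous σ := by
    have := hρs.continuous
    fun_prop
  have hσd : ∀ x, HasFDerivAt σ (fderiv ℝ ρ x - 2 • (innerSL ℝ (x - z))) x := by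
    intro x
    have h1 : HasFDerivAt (fun x : Plane => ‖x - z‖ ^ 2) (2 • (innerSL ℝ (x - z))) x := by
      have := ((hasFDerivAt_id x).sub_const z).norm_sq
      simpa using this
    exact ((hρs.differentiable (by simp) x).hasFDerivAt.add_const δ).sub h1
  set q : Plane → ℝ := fun x => χ x * g (σ x) with hq
  have hqd : ∀ x, HasFDerivAt q (χ x • (max (σ x) 0 • (fderiv ℝ ρ x - 2 • (innerSL ℝ (x - z))))
      + g (σ x) • fderiv ℝ χ x) x := fun x =>
    (hχC.differentiable (by simp) x).hasFDerivAt.mul ((hg (σ x)).comp_hasFDerivAt x (hσd x))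
  have hqg : ∀ x, gradient q x = (χ x * max (σ x) 0) • (gradient ρ x - (2 : ℝ) • (x - z))
      + g (σ x) • gradient χ x := by
    intro x
    apply ext_inner_right ℝ
    intro a
    rw [inner_gradient_left, (hqd x).fderiv]
    simp only [add_apply, smul_apply, sub_apply, innerSL_apply_apply, smul_eq_mul, inner_add_left,
      real_inner_smul_left, inner_sub_left, inner_gradient_left, nsmul_eq_mul, Nat.cast_ofNat]
    ring
  have hgc : Continuous g := continuous_iff_continuousAt.2 fun s => (hg s).continuousAt
  have hqc : Continuous (gradient q) := by
    rw [funext hqg]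
    have h1 := (contDiff_gradient hρs).continuous
    have h2 := (contDiff_gradient hχC).continuous
    have h3 : Continuous fun x => χ x := hχC.continuous
    have h4 : Continuous fun x => max (σ x) 0 := hσc.max continuous_const
    exact ((h3.mul h4).smul (h1.sub (by fun_prop))).add ((hgc.comp hσc).smul h2)
  have hqsupp : HasCompactSupport (gradient q) := by
    refine HasCompactSupport.intro (isCompact_closedBall z r) fun x hx => ?_
    have hx' : x ∉ Metric.ball z r := fun h => hx (Metric.ball_subset_closedBall h)
    simp [hqg, hχs x hx', hχs' x hx']
  obtain ⟨M, hM⟩ := hqc.bounded_above_of_compact_support hqsupp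
  have horth := hf.integral_inner_gradient hΩ hb (fun x _ => (hqd x).differentiableAt)
    hqc.continuousOn (fun x _ => hM x)
  have hfin : IsFiniteMeasure (volume.restrict Ω) :=
    ⟨by rw [Measure.restrict_apply_univ]; exact hb.measure_lt_top⟩
  have hint : Integrable (fun x => inner ℝ (gradient q x) (f x)) (volume.restrict Ω) :=
    integrable_inner_of_memLp (MemLp.of_bound hqc.aestronglyMeasurable M
      (Eventually.of_forall hM)) hf.1
  -- in `Ω`, the gradient of the bump vanishes unless `x` is close to `z`
  have hval : ∀ x ∈ Ω, dist x z < r / 2 ∨ gradient q x = 0 := by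
    intro x hx
    by_cases hd : dist x z < r / 2
    · exact Or.inl hd
    refine Or.inr ?_
    by_cases hxb : x ∈ Metric.ball z r
    · have hneg : σ x ≤ 0 := by
        have h1 : ρ x < 0 := (hNΩ x (hball x hxb).2.1).1 hx
        have h2 : δ ≤ ‖x - z‖ ^ 2 := by
          rw [← dist_eq_norm]
          push Not at hd
          exact pow_le_pow_left₀ (by positivity) hd 2
        simp only [hσ]; linarith
      simp [hqg, hg0 _ hneg, max_eq_right hneg]
    · simp [hqg, hχs x hxb, hχs' x hxb]
  have hnear : ∀ x ∈ Ω, dist x z < r / 2 →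
      gradient q x = max (σ x) 0 • (gradient ρ x - (2 : ℝ) • (x - z)) := by
    intro x hx hd
    have h1 : gradient χ x = 0 := by
      have : (χ : Plane → ℝ) =ᶠ[𝓝 x] fun _ => 1 := by
        filter_upwards [Metric.isOpen_ball.mem_nhds (Metric.mem_ball.2 hd)] with y hy
        exact hχ1 y (Metric.mem_ball.1 hy).le
      rw [gradient, this.fderiv_eq]; simp
    rw [hqg, hχ1 x hd.le, h1, smul_zero, add_zero, one_mul]
  have hexp : ∀ x ∈ Ω, dist x z < r / 2 → κ * inner ℝ (gradient q x) (v x)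
      = max (σ x) 0 * (κ * inner ℝ (gradient ρ x - (2 : ℝ) • (x - z)) (v x)) := by
    intro x hx hd
    rw [hnear x hx hd, real_inner_smul_left]; ring
  have hsub : ∀ x, dist x z < r / 2 → x ∈ Metric.ball z r := fun x hx =>
    Metric.mem_ball.2 (by linarith)
  have hfv' : ∀ᵐ x ∂volume.restrict Ω, x ∈ Ω ∧ (x ∈ O → f x = v x) :=
    (ae_restrict_mem hΩ.measurableSet).and hfv
  have hnn : 0 ≤ᵐ[volume.restrict Ω] fun x => κ * inner ℝ (gradient q x) (f x) := by
    filter_upwards [hfv'] with x hx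
    rcases hval x hx.1 with hd | h0
    · have hxb := hsub x hd
      rw [hx.2 (hball x hxb).2.2, hexp x hx.1 hd]
      exact mul_nonneg (le_max_right _ _) ((hball x hxb).1 hx.1).le
    · simp [h0]
  have hzero := (integral_eq_zero_iff_of_nonneg_ae hnn (hint.const_mul κ)).1
    (by rw [integral_const_mul, horth, mul_zero])
  -- the bump is strictly increasing in the normal direction on a nonempty open part of `Ω`
  set S := Ω ∩ (Metric.ball z (r / 2) ∩ {x | 0 < σ x}) with hS
  have hSo : IsOpen (Metric.ball z (r / 2) ∩ {x | 0 < σ x}) :=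
    Metric.isOpen_ball.inter (isOpen_lt continuous_const hσc)
  have hSne : S.Nonempty := by
    rw [hS, inter_comm]
    refine mem_closure_iff.1 (frontier_subset_closure hz) _ hSo ⟨?_, ?_⟩
    · exact Metric.mem_ball_self (by positivity)
    · simpa [hσ, hρz] using hδ0
  have hS0 : volume S = 0 := by
    rw [hS, inter_comm, ← Measure.restrict_apply hSo.measurableSet]
    refine measure_eq_zero_iff_ae_notMem.2 ?_
    filter_upwards [hzero, hfv'] with x hx0 hx hxS
    have hxb := hsub x hxS.1
    simp only [Pi.zero_apply] at hx0
    rw [hx.2 (hball x hxb).2.2, hexp x hx.1 hxS.1, max_eq_left hxS.2.le] at hx0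
    exact (mul_pos hxS.2 ((hball x hxb).1 hx.1)).ne' hx0
  exact ((hΩ.inter hSo).measure_pos volume hSne).ne' hS0

section
variable {Ω : Set Plane} {T : ℝ} {J : Set ℝ} {u v : Plane × ℝ → Plane} {N : Set (Plane × ℝ)}

lemma IsSmoothBoundedDomain.isFiniteMeasure (hΩ : IsSmoothBoundedDomain Ω) :
    IsFiniteMeasure (volume.restrict Ω) :=
  ⟨by rw [Measure.restrict_apply_univ]; exact hΩ.isBounded.measure_lt_top⟩

lemma volume_restrict_prod (A : Set Plane) (B : Set ℝ) :
    (volume.restrict (A ×ˢ B) : Measure (Plane × ℝ))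
      = (volume.restrict A).prod (volume.restrict B) := by
  rw [Measure.volume_eq_prod, Measure.prod_restrict]

/-- A field in `L^∞((0,T); H(Ω))` that is continuous near the boundary is tangential there: this
holds at almost all times, and then at all times by continuity. -/
theorem exists_isTangentTrace (hΩ : IsSmoothBoundedDomain Ω) (hT : 0 < T)
    (hu : MemLinftySolenoidal Ω T u) (h : IsContinuousNearBoundary Ω T u) :
    ∃ N v, IsTangentTrace Ω T u N v := by
  obtain ⟨N, v, hN, hsub, hc, hae⟩ := h
  refine ⟨N, v, hN, hsub, hc, hae, ?_⟩
  have hm := hΩ.isOpen.measurableSet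
  have h1 : ∀ᵐ w ∂volume.restrict (Ω ×ˢ Ioo 0 T), w ∈ N → u w = v w := by
    rw [ae_restrict_iff' (hm.prod measurableSet_Ioo)]
    filter_upwards [(ae_restrict_iff'
      (hN.measurableSet.inter (hm.prod measurableSet_Ioo))).1 hae] with w hw hwΩ hwN
    exact (hw ⟨hwN, hwΩ⟩).symm
  rw [volume_restrict_prod] at h1
  intro x hx t ht ρ hρ
  have hg : ContinuousOn (fun s => inner ℝ (gradient ρ x) (v (x, s))) (Icc 0 T) := by
    refine ContinuousOn.inner (𝕜 := ℝ) continuousOn_const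
      (hc.comp (by fun_prop) fun s hs => ⟨hsub ⟨hx, hs⟩, frontier_subset_closure hx, hs⟩)
  refine Measure.eqOn_Icc_of_ae_eq (μ := volume) hT.ne ?_ hg continuousOn_const ht
  rw [← restrict_Ioo_eq_restrict_Icc]
  filter_upwards [ae_ae_of_ae_prod_right h1, hu.2.1, ae_restrict_mem measurableSet_Ioo]
    with s hs hus hsT
  have hsT' := Ioo_subset_Icc_self hsT
  refine hus.inner_gradient_eq_zero (v := fun y => v (y, s)) (O := {y | (y, s) ∈ N}) hΩ.isOpen
    hΩ.isBounded hx (hN.preimage (by fun_prop)) (hsub ⟨hx, hsT'⟩) hs ?_ hρ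
  have h2 := (hc (x, s) ⟨hsub ⟨hx, hsT'⟩, frontier_subset_closure hx, hsT'⟩)
  have h3 : Tendsto (fun y => (y, s)) (𝓝[Ω] x) (𝓝[N ∩ closure Ω ×ˢ Icc 0 T] (x, s)) := by
    refine tendsto_nhdsWithin_iff.2 ⟨?_, ?_⟩
    · exact (Continuous.tendsto (f := fun y : Plane => (y, s)) (by fun_prop) x).mono_left
        nhdsWithin_le_nhds
    · have h4 : {y | (y, s) ∈ N} ∈ 𝓝 x :=
        (hN.preimage (f := fun y : Plane => (y, s)) (by fun_prop)).mem_nhds (hsub ⟨hx, hsT'⟩)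
      filter_upwards [self_mem_nhdsWithin, nhdsWithin_le_nhds h4] with y hy hyN
      exact ⟨hyN, subset_closure hy, hsT'⟩
  exact Tendsto.comp h2 h3

lemma memLp_two_of_memLinftySolenoidal
    (hu : MemLinftySolenoidal Ω T u) : MemLp u 2 (volume.restrict (Ω ×ˢ Ioo 0 T)) := by
  obtain ⟨hm, -, C, hC⟩ := hu
  refine ⟨hm, ?_⟩
  rw [eLpNorm_lt_top_iff_lintegral_rpow_enorm_lt_top (by simp) (by simp)]
  rw [volume_restrict_prod] at hm ⊢
  rw [lintegral_prod_symm _ (hm.enorm.pow_const _)]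
  calc _ ≤ ∫⁻ t in Ioo 0 T, (C : ENNReal) ^ (2 : ℝ) := by
        refine lintegral_mono_ae ?_
        filter_upwards [hC] with t ht
        rw [eLpNorm_eq_lintegral_rpow_enorm_toReal (by simp) (by simp)] at ht
        have := ENNReal.rpow_le_rpow ht (z := 2) (by norm_num)
        rw [← ENNReal.rpow_mul] at this
        simpa using this
    _ < ⊤ := by
        rw [lintegral_const, Measure.restrict_apply_univ, Real.volume_Ioo]
        exact ENNReal.mul_lt_top (by simp) (by simp)

lemma IsTestField.integral_inner_gradient_eq_zero {φ : Plane × ℝ → Plane} (hφ : IsTestField Ω T φ)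
    (hΩ : IsOpen Ω) {t : ℝ} (ht : t ∈ Icc 0 T) {q : Plane → ℝ}
    (hq : ∀ x ∈ Ω, DifferentiableAt ℝ q x) (hq' : ContinuousOn (gradient q) Ω) :
    ∫ x in Ω, inner ℝ (gradient q x) (φ (x, t)) = 0 := by
  obtain ⟨K, hK, hKΩ, h0⟩ := hφ.compact_support
  exact Euler2D.integral_inner_gradient_eq_zero hΩ hq hq' (w := fun x => φ (x, t))
    (hφ.contDiffOn.comp (by fun_prop) fun x hx => ⟨hx, ht⟩) hK hKΩ
    (fun x hx hxK => h0 x hx hxK t ht) (fun x hx => hφ.div_free x hx t ht)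

/-- The fields of a negligible sequence tend to zero in the mean at each time. -/
lemma IsNegligible.tendsto_integral_inner (hΩ : IsOpen Ω) {W : ℕ → Plane × ℝ → Plane}
    (hW : IsNegligible Ω T J u W) {t : ℝ} (ht : t ∈ J) {f : Plane → Plane}
    (hf : Integrable f (volume.restrict Ω)) :
    Tendsto (fun n => ∫ x in Ω, inner ℝ (f x) (W n (x, t))) atTop (𝓝 0) := by
  obtain ⟨D, hD⟩ := hW.bound
  have h1 := tendsto_integral_of_dominated_convergence (μ := volume.restrict Ω)
    (F := fun n x => inner ℝ (f x) (W n (x, t))) (f := fun _ => (0 : ℝ)) (fun x => ‖f x‖ * D)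
    (fun n => ?_) (hf.norm.mul_const D) (fun n => ?_) ?_
  · simpa using h1
  · refine hf.aestronglyMeasurable.inner (ContinuousOn.aestronglyMeasurable ?_ hΩ.measurableSet)
    exact (hW.contDiffOn n).continuousOn.comp (by fun_prop) fun x hx => ⟨hx, ht⟩
  · filter_upwards [ae_restrict_mem hΩ.measurableSet] with x hx
    exact (norm_inner_le_norm _ _).trans
      (mul_le_mul_of_nonneg_left (hD n (x, t) ⟨hx, ht⟩).1 (norm_nonneg _))
  · filter_upwards [ae_restrict_mem hΩ.measurableSet] with x hx
    refine tendsto_const_nhds.congr' ?_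
    filter_upwards [hW.eventually_zero (x, t) ⟨hx, ht⟩] with n hn
    rw [hn.eq_of_nhds]; simp

lemma IsTangentField.continuousOn_slice (hV : IsTangentField Ω J u) {t : ℝ} (ht : t ∈ J) :
    ContinuousOn (fun x => u (x, t)) Ω :=
  hV.contDiffOn.continuousOn.comp (by fun_prop) fun _ hx => ⟨hx, ht⟩

/-- Tangential divergence-free fields are orthogonal to bounded gradients. -/
theorem IsTangentField.integral_inner_gradient_eq_zero (hΩ : IsSmoothBoundedDomain Ω)
    (hJ : IsOpen J) (hTJ : Icc 0 T ⊆ J)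
    (hu : AEStronglyMeasurable u (volume.restrict (Ω ×ˢ Ioo 0 T)))
    (hv : IsTangentTrace Ω T u N v) {V : Plane × ℝ → Plane} (hV : IsTangentField Ω J V) {t : ℝ}
    (ht : t ∈ Icc 0 T) {q : Plane → ℝ} (hq : ∀ x ∈ Ω, DifferentiableAt ℝ q x)
    (hq' : ContinuousOn (gradient q) Ω) {M : ℝ} (hM : ∀ x ∈ Ω, ‖gradient q x‖ ≤ M) :
    ∫ x in Ω, inner ℝ (gradient q x) (V (x, t)) = 0 := by
  have hfin := hΩ.isFiniteMeasure
  have hm := hΩ.isOpen.measurableSet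
  obtain ⟨W, hW, htest⟩ := exists_isNegligible hΩ hJ hTJ hu hv hV
  have hqi : Integrable (gradient q) (volume.restrict Ω) :=
    Integrable.of_bound (hq'.aestronglyMeasurable hm) M
      ((ae_restrict_iff' hm).2 (Eventually.of_forall hM))
  have hlim := hW.tendsto_integral_inner hΩ.isOpen (hTJ ht) hqi
  obtain ⟨A, -, hA⟩ := hV.bound
  obtain ⟨D, hD⟩ := hW.bound
  have hi : ∀ F : Plane → Plane, ContinuousOn F Ω → ∀ B, (∀ x ∈ Ω, ‖F x‖ ≤ B) →
      Integrable (fun x => inner ℝ (gradient q x) (F x)) (volume.restrict Ω) := by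
    intro F hF B hB
    exact integrable_inner_of_memLp
      (MemLp.of_bound (hq'.aestronglyMeasurable hm) M
        ((ae_restrict_iff' hm).2 (Eventually.of_forall hM)))
      (MemLp.of_bound (hF.aestronglyMeasurable hm) B
        ((ae_restrict_iff' hm).2 (Eventually.of_forall hB)))
  have hconst : ∀ n, ∫ x in Ω, inner ℝ (gradient q x) (W n (x, t))
      = ∫ x in Ω, inner ℝ (gradient q x) (V (x, t)) := by
    intro n
    have h1 := (htest n).integral_inner_gradient_eq_zero hΩ.isOpen ht hq hq'
    simp only [Pi.sub_apply, inner_sub_right] at h1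
    rw [integral_sub (hi _ (hV.continuousOn_slice (hTJ ht)) A
      fun x hx => (hA _ ⟨hx, hTJ ht⟩).1) (hi _ ?_ D fun x hx => (hD n _ ⟨hx, hTJ ht⟩).1)] at h1
    · linarith
    · exact (hW.contDiffOn n).continuousOn.comp (by fun_prop) fun x hx => ⟨hx, hTJ ht⟩
  simp only [hconst] at hlim
  exact tendsto_nhds_unique tendsto_const_nhds hlim

/-- The weak formulation extends from compactly supported test fields to tangential fields. -/
theorem weak_form_of_isTangentField (hΩ : IsSmoothBoundedDomain Ω) (hJ : IsOpen J)
    (hTJ : Icc 0 T ⊆ J) (hu : MemLp u 2 (volume.restrict (Ω ×ˢ Ioo 0 T)))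
    (hv : IsTangentTrace Ω T u N v) {V : Plane × ℝ → Plane} (hV : IsTangentField Ω J V)
    {u₀ : Plane → Plane} (hu₀ : MemLp u₀ 2 (volume.restrict Ω)) {τ : ℝ} (hτ : τ ∈ Ioo 0 T)
    (huτ : MemLp (fun x => u (x, τ)) 2 (volume.restrict Ω))
    (hw : ∀ φ : Plane × ℝ → Plane, IsTestField Ω T φ →
      ∫ t in (0 : ℝ)..τ, ∫ x in Ω,
        (inner ℝ (deriv (fun s => φ (x, s)) t) (u (x, t))
          + gradContract (fun y => φ (y, t)) x (u (x, t)))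
      = ∫ x in Ω, (inner ℝ (u (x, τ)) (φ (x, τ)) - inner ℝ (u₀ x) (φ (x, 0)))) :
    ∫ w in Ω ×ˢ Ioo 0 τ, (inner ℝ (timeDeriv V w) (u w) + inner ℝ (spaceDeriv V w (u w)) (u w))
      = ∫ x in Ω, (inner ℝ (u (x, τ)) (V (x, τ)) - inner ℝ (u₀ x) (V (x, 0))) := by
  have hfin := hΩ.isFiniteMeasure
  have hm := hΩ.isOpen.measurableSet
  have hQm : MeasurableSet (Ω ×ˢ Ioo 0 τ) := hm.prod measurableSet_Ioo
  have hQT : Ω ×ˢ Ioo 0 τ ⊆ Ω ×ˢ Ioo 0 T := prod_mono_right (Ioo_subset_Ioo_right hτ.2.le)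
  have hQJ : Ω ×ˢ Ioo 0 τ ⊆ Ω ×ˢ J :=
    hQT.trans (prod_mono_right (Ioo_subset_Icc_self.trans hTJ))
  have hτJ : τ ∈ J := hTJ (Ioo_subset_Icc_self hτ)
  have h0J : (0 : ℝ) ∈ J := hTJ ⟨le_rfl, (hτ.1.trans hτ.2).le⟩
  set μ : Measure (Plane × ℝ) := volume.restrict (Ω ×ˢ Ioo 0 τ) with hμ
  have hμfin : IsFiniteMeasure μ := by
    rw [hμ, volume_restrict_prod]; infer_instance
  have huμ : MemLp u 2 μ := hu.mono_measure (Measure.restrict_mono hQT le_rfl)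
  have hui : Integrable u μ := huμ.integrable (by norm_num)
  have husq : Integrable (fun w => ‖u w‖ ^ 2) μ := huμ.integrable_norm_pow (by norm_num)
  obtain ⟨W, hW, htest⟩ := exists_isNegligible hΩ hJ hTJ hu.1 hv hV
  obtain ⟨A, hA0, hA⟩ := hV.bound
  obtain ⟨D, hD⟩ := hW.bound
  have hVd : ∀ w ∈ Ω ×ˢ J, DifferentiableAt ℝ V w := fun w hw =>
    differentiableAt_of_contDiffOn hΩ.isOpen hJ hV.contDiffOn hw
  have hWd : ∀ n, ∀ w ∈ Ω ×ˢ J, DifferentiableAt ℝ (W n) w := fun n w hw =>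
    differentiableAt_of_contDiffOn hΩ.isOpen hJ (hW.contDiffOn n) hw
  have hmem : ∀ᵐ w ∂μ, w ∈ Ω ×ˢ Ioo 0 τ := ae_restrict_mem hQm
  -- integrability of the four terms
  have hIVt : Integrable (fun w => inner ℝ (timeDeriv V w) (u w)) μ := by
    refine (hui.norm.const_mul A).mono' (aestronglyMeasurable_inner_timeDeriv huμ.1 V) ?_
    filter_upwards [hmem] with w hw
    exact (norm_inner_le_norm _ _).trans (mul_le_mul_of_nonneg_right
      ((norm_timeDeriv_le _ _).trans (hA w (hQJ hw)).2) (norm_nonneg _))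
  have hIVx : Integrable (fun w => inner ℝ (spaceDeriv V w (u w)) (u w)) μ := by
    refine (husq.const_mul A).mono' (aestronglyMeasurable_inner_spaceDeriv huμ.1 V) ?_
    filter_upwards [hmem] with w hw
    refine (norm_inner_le_norm _ _).trans ?_
    rw [pow_two, ← mul_assoc]
    exact mul_le_mul_of_nonneg_right ((ContinuousLinearMap.le_of_opNorm_le _
      ((norm_spaceDeriv_le _ _).trans (hA w (hQJ hw)).2) _)) (norm_nonneg _)
  have hSV : Integrable (fun w => inner ℝ (timeDeriv V w) (u w)
      + inner ℝ (spaceDeriv V w (u w)) (u w)) μ := hIVt.add hIVx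
  have hIWt : ∀ n, Integrable (fun w => inner ℝ (timeDeriv (W n) w) (u w)) μ := by
    intro n
    refine (hui.norm.const_mul D).mono' (aestronglyMeasurable_inner_timeDeriv huμ.1 _) ?_
    filter_upwards [hmem] with w hw
    exact (norm_inner_le_norm _ _).trans (mul_le_mul_of_nonneg_right
      (hD n w (hQJ hw)).2 (norm_nonneg _))
  have htr : Tendsto (fun n => ∫⁻ w, ‖inner ℝ (spaceDeriv (W n) w (u w)) (u w)‖ₑ ∂μ)
      atTop (𝓝 0) :=
    tendsto_of_tendsto_of_tendsto_of_le_of_le tendsto_const_nhds hW.transport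
      (fun n => zero_le) fun n => lintegral_mono_set hQT
  have hIWx : ∀ᶠ n in atTop, Integrable (fun w => inner ℝ (spaceDeriv (W n) w (u w)) (u w)) μ := by
    filter_upwards [htr.eventually (gt_mem_nhds ENNReal.zero_lt_top)] with n hn
    exact ⟨aestronglyMeasurable_inner_spaceDeriv huμ.1 _, hn⟩
  -- the terms with `W n` vanish in the limit
  have hLt : Tendsto (fun n => ∫ w, inner ℝ (timeDeriv (W n) w) (u w) ∂μ) atTop (𝓝 0) := by
    have h1 := tendsto_integral_of_dominated_convergence (μ := μ)
      (F := fun n w => inner ℝ (timeDeriv (W n) w) (u w)) (f := fun _ => (0 : ℝ))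
      (fun w => D * ‖u w‖) (fun n => (hIWt n).1) (hui.norm.const_mul D) (fun n => ?_) ?_
    · simpa using h1
    · filter_upwards [hmem] with w hw
      exact (norm_inner_le_norm _ _).trans (mul_le_mul_of_nonneg_right
        (hD n w (hQJ hw)).2 (norm_nonneg _))
    · filter_upwards [hmem] with w hw
      refine tendsto_const_nhds.congr' ?_
      filter_upwards [hW.eventually_zero w (hQJ hw)] with n hn
      rw [timeDeriv_congr hn]; simp [timeDeriv]
  have hLx : Tendsto (fun n => ∫ w, inner ℝ (spaceDeriv (W n) w (u w)) (u w) ∂μ) atTop (𝓝 0) := by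
    rw [tendsto_zero_iff_enorm_tendsto_zero]
    exact tendsto_of_tendsto_of_tendsto_of_le_of_le tendsto_const_nhds htr (fun n => zero_le)
      fun n => enorm_integral_le_lintegral_enorm _
  have hLτ := hW.tendsto_integral_inner hΩ.isOpen hτJ (huτ.integrable (by norm_num))
  have hL0 := hW.tendsto_integral_inner hΩ.isOpen h0J (hu₀.integrable (by norm_num))
  have hslice : ∀ (F : Plane × ℝ → Plane) (B : ℝ) (t : ℝ), t ∈ J → ContDiffOn ℝ 1 F (Ω ×ˢ J) →
      (∀ w ∈ Ω ×ˢ J, ‖F w‖ ≤ B) → MemLp (fun x => F (x, t)) 2 (volume.restrict Ω) :=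
    fun F B t ht hF hB => MemLp.of_bound ((hF.continuousOn.comp (by fun_prop)
      fun x hx => ⟨hx, ht⟩ : ContinuousOn (fun x => F (x, t)) Ω).aestronglyMeasurable hm) B
      ((ae_restrict_iff' hm).2 (Eventually.of_forall fun x hx => hB _ ⟨hx, ht⟩))
  have hVs := fun t ht => hslice V A t ht hV.contDiffOn fun w hw => (hA w hw).1
  have hWs := fun n t ht => hslice (W n) D t ht (hW.contDiffOn n) fun w hw => (hD n w hw).1
  have hRV : Integrable (fun x => inner ℝ (u (x, τ)) (V (x, τ)) - inner ℝ (u₀ x) (V (x, 0)))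
      (volume.restrict Ω) :=
    (integrable_inner_of_memLp huτ (hVs τ hτJ)).sub (integrable_inner_of_memLp hu₀ (hVs 0 h0J))
  have hRτ := fun n => integrable_inner_of_memLp huτ (hWs n τ hτJ)
  have hR0 := fun n => integrable_inner_of_memLp hu₀ (hWs n 0 h0J)
  -- the weak formulation with the test field `V - W n`
  have hid : ∀ᶠ n in atTop,
      (∫ w, (inner ℝ (timeDeriv V w) (u w) + inner ℝ (spaceDeriv V w (u w)) (u w)) ∂μ)
        - ((∫ w, inner ℝ (timeDeriv (W n) w) (u w) ∂μ)
          + ∫ w, inner ℝ (spaceDeriv (W n) w (u w)) (u w) ∂μ)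
      = (∫ x in Ω, (inner ℝ (u (x, τ)) (V (x, τ)) - inner ℝ (u₀ x) (V (x, 0))))
        - ((∫ x in Ω, inner ℝ (u (x, τ)) (W n (x, τ)))
          - ∫ x in Ω, inner ℝ (u₀ x) (W n (x, 0))) := by
    filter_upwards [hIWx] with n hn
    have h1 := hw _ (htest n)
    have hSW : Integrable (fun w => inner ℝ (timeDeriv (W n) w) (u w)
        + inner ℝ (spaceDeriv (W n) w (u w)) (u w)) μ := (hIWt n).add hn
    have hRW : Integrable (fun x => inner ℝ (u (x, τ)) (W n (x, τ))
        - inner ℝ (u₀ x) (W n (x, 0))) (volume.restrict Ω) := (hRτ n).sub (hR0 n)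
    rw [← integral_add (hIWt n) hn, ← integral_sub hSV hSW, ← integral_sub (hRτ n) (hR0 n),
      ← integral_sub hRV hRW]
    rw [intervalIntegral.integral_of_le hτ.1.le, integral_Ioc_eq_integral_Ioo] at h1
    have hprod := integral_prod_symm (μ := volume.restrict Ω) (ν := volume.restrict (Ioo 0 τ)) _
      (by rw [← volume_restrict_prod]; exact hSV.sub hSW)
    rw [hμ, volume_restrict_prod]
    refine hprod.trans (Eq.trans ?_ (h1.trans ?_))
    · refine setIntegral_congr_fun measurableSet_Ioo fun t ht =>
        setIntegral_congr_fun hm fun x hx => ?_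
      have hxJ : (x, t) ∈ Ω ×ˢ J := hQJ ⟨hx, ht⟩
      have hd : DifferentiableAt ℝ (V - W n) (x, t) := (hVd _ hxJ).sub (hWd n _ hxJ)
      simp only [Pi.sub_apply]
      have h2 := (hasDerivAt_timeSlice hd).deriv
      have h3 := gradContract_spaceSlice hd (u (x, t))
      simp only [Pi.sub_apply] at h2 h3
      rw [h2, h3, timeDeriv_sub (hVd _ hxJ) (hWd n _ hxJ),
        spaceDeriv_sub (hVd _ hxJ) (hWd n _ hxJ), sub_apply, inner_sub_left, inner_sub_left]
      ring
    · refine setIntegral_congr_fun hm fun x _ => ?_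
      simp only [Pi.sub_apply, inner_sub_right]
      ring
  have hl := (tendsto_const_nhds (x := ∫ w, (inner ℝ (timeDeriv V w) (u w)
    + inner ℝ (spaceDeriv V w (u w)) (u w)) ∂μ)).sub (hLt.add hLx)
  have hr := (tendsto_const_nhds (x := ∫ x in Ω, (inner ℝ (u (x, τ)) (V (x, τ))
    - inner ℝ (u₀ x) (V (x, 0))))).sub (hLτ.sub hL0)
  have := tendsto_nhds_unique (hl.congr' hid) hr
  simpa using this

end

end Euler2D

/-! ### Strong solutions as test fields -/

namespace Euler2D

open Filter Topology

/-- The set `K` need not have unique derivatives at its boundary points: there, the bound comes from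
a derivative within `K` supplied by the `C¹` condition, which is continuous. -/
lemma exists_bound_fderiv_of_contDiffOn {E F : Type*} [NormedAddCommGroup E] [NormedSpace ℝ E]
    [NormedAddCommGroup F] [NormedSpace ℝ F] {f : E → F} {K S : Set E} (hK : IsCompact K)
    (hS : IsOpen S) (hSK : S ⊆ K) (hf : ContDiffOn ℝ 1 f K) : ∃ M, ∀ w ∈ S, ‖fderiv ℝ f w‖ ≤ M := by
  suffices h : ∃ M, ∀ w ∈ K ∩ S, ‖fderiv ℝ f w‖ ≤ M by
    obtain ⟨M, hM⟩ := h
    exact ⟨M, fun w hw => hM w ⟨hSK hw, hw⟩⟩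
  refine hK.induction_on (p := fun s => ∃ M, ∀ w ∈ s ∩ S, ‖fderiv ℝ f w‖ ≤ M) ⟨0, by simp⟩ ?_ ?_ ?_
  · rintro s t hst ⟨M, hM⟩
    exact ⟨M, fun w hw => hM w ⟨hst hw.1, hw.2⟩⟩
  · rintro s t ⟨M, hM⟩ ⟨M', hM'⟩
    refine ⟨max M M', ?_⟩
    rintro w ⟨hw | hw, hwS⟩
    · exact (hM w ⟨hw, hwS⟩).trans (le_max_left _ _)
    · exact (hM' w ⟨hw, hwS⟩).trans (le_max_right _ _)
  · intro z hz
    have h1 := hf z hz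
    rw [show (1 : WithTop ℕ∞) = 0 + 1 by rw [zero_add],
      contDiffWithinAt_succ_iff_hasFDerivWithinAt (by simp)] at h1
    obtain ⟨O, hO, -, f', hf', hf'c⟩ := h1
    rw [insert_eq_of_mem hz] at hO
    have hzO : z ∈ O := mem_of_mem_nhdsWithin hz hO
    have h2 : ∀ᶠ w in 𝓝[O] z, ‖f' w‖ < ‖f' z‖ + 1 :=
      hf'c.continuousWithinAt.norm.eventually (gt_mem_nhds (lt_add_one _))
    have h3 : ∀ᶠ w in 𝓝[K] z, w ∈ O ∧ ‖f' w‖ < ‖f' z‖ + 1 := by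
      filter_upwards [hO, nhdsWithin_le_of_mem hO h2] with w h h' using ⟨h, h'⟩
    obtain ⟨B, hBK, hB, hzB⟩ := eventually_nhds_iff.1 (eventually_nhdsWithin_iff.1 h3)
    refine ⟨B ∩ K, inter_mem (mem_nhdsWithin_of_mem_nhds (hB.mem_nhds hzB)) self_mem_nhdsWithin,
      ‖f' z‖ + 1, ?_⟩
    rintro w ⟨⟨hwB, hwK⟩, hwS⟩
    obtain ⟨hwO, hlt⟩ := hBK w hwB hwK
    have hOw : O ∈ 𝓝 w := by
      filter_upwards [(hB.inter hS).mem_nhds ⟨hwB, hwS⟩] with y hy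
      exact (hBK y hy.1 (hSK hy.2)).1
    rw [((hf' w hwO).hasFDerivAt hOw).fderiv]
    exact hlt.le

section
variable {Ω : Set Plane} {T : ℝ} {U u v : Plane × ℝ → Plane} {N : Set (Plane × ℝ)}

lemma IsSmoothBoundedDomain.isCompact_closure_prod (hΩ : IsSmoothBoundedDomain Ω) (T : ℝ) :
    IsCompact (closure Ω ×ˢ Icc 0 T) :=
  hΩ.isBounded.isCompact_closure.prod isCompact_Icc

lemma closure_prod_mem {x : Plane} {t : ℝ} (hx : x ∈ Ω) (ht : t ∈ Ioo 0 T) :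
    (x, t) ∈ closure Ω ×ˢ Icc 0 T := ⟨subset_closure hx, Ioo_subset_Icc_self ht⟩

lemma IsStrongSolution.contDiffOn_interior (hU : IsStrongSolution Ω T U) :
    ContDiffOn ℝ 1 U (Ω ×ˢ Ioo 0 T) :=
  hU.contDiffOn.mono (prod_mono subset_closure Ioo_subset_Icc_self)

lemma IsStrongSolution.differentiableAt (hU : IsStrongSolution Ω T U) (hΩ : IsOpen Ω)
    {w : Plane × ℝ} (hw : w ∈ Ω ×ˢ Ioo 0 T) : DifferentiableAt ℝ U w :=
  differentiableAt_of_contDiffOn hΩ isOpen_Ioo hU.contDiffOn_interior hw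

lemma IsStrongSolution.continuousOn_fderiv (hU : IsStrongSolution Ω T U) (hΩ : IsOpen Ω) :
    ContinuousOn (fderiv ℝ U) (Ω ×ˢ Ioo 0 T) :=
  hU.contDiffOn_interior.continuousOn_fderiv_of_isOpen (hΩ.prod isOpen_Ioo) (by simp)

lemma IsStrongSolution.exists_bound (hU : IsStrongSolution Ω T U)
    (hΩ : IsSmoothBoundedDomain Ω) : ∃ M, 0 < M ∧ (∀ w ∈ closure Ω ×ˢ Icc 0 T, ‖U w‖ ≤ M) ∧
      ∀ w ∈ Ω ×ˢ Ioo 0 T, ‖fderiv ℝ U w‖ ≤ M := by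
  have hK := hΩ.isCompact_closure_prod T
  obtain ⟨A, hA⟩ := hK.exists_bound_of_continuousOn hU.contDiffOn.continuousOn
  obtain ⟨B, hB⟩ := exists_bound_fderiv_of_contDiffOn hK (hΩ.isOpen.prod isOpen_Ioo)
    (prod_mono subset_closure Ioo_subset_Icc_self) hU.contDiffOn
  refine ⟨max (max A B) 1, by positivity, fun w hw => ?_, fun w hw => ?_⟩
  · exact (hA w hw).trans ((le_max_left _ _).trans (le_max_left _ _))
  · exact (hB w hw).trans ((le_max_right _ _).trans (le_max_left _ _))

/-- The field `U` with the time reparametrized by the affine map `t ↦ a t + b`. -/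
def timeAffine (a b : ℝ) (U : Plane × ℝ → Plane) (w : Plane × ℝ) : Plane :=
  U (w.1, a * w.2 + b)

lemma hasFDerivAt_timeAffine {a b : ℝ} {w : Plane × ℝ}
    (h : DifferentiableAt ℝ U (w.1, a * w.2 + b)) :
    HasFDerivAt (timeAffine a b U) ((fderiv ℝ U (w.1, a * w.2 + b)).comp
      ((ContinuousLinearMap.fst ℝ Plane ℝ).prod (a • ContinuousLinearMap.snd ℝ Plane ℝ))) w := by
  have h1 : HasFDerivAt (fun w : Plane × ℝ => (w.1, a * w.2 + b))
      ((ContinuousLinearMap.fst ℝ Plane ℝ).prod (a • ContinuousLinearMap.snd ℝ Plane ℝ)) w :=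
    hasFDerivAt_fst.prodMk ((hasFDerivAt_snd.const_mul a).add_const b)
  exact h.hasFDerivAt.comp w h1

lemma spaceDeriv_timeAffine {a b : ℝ} {w : Plane × ℝ}
    (h : DifferentiableAt ℝ U (w.1, a * w.2 + b)) :
    spaceDeriv (timeAffine a b U) w = spaceDeriv U (w.1, a * w.2 + b) := by
  ext y : 1
  simp [spaceDeriv_apply, (hasFDerivAt_timeAffine h).fderiv]

lemma timeDeriv_timeAffine {a b : ℝ} {w : Plane × ℝ}
    (h : DifferentiableAt ℝ U (w.1, a * w.2 + b)) :
    timeDeriv (timeAffine a b U) w = a • timeDeriv U (w.1, a * w.2 + b) := by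
  simp only [timeDeriv, (hasFDerivAt_timeAffine h).fderiv]
  rw [← map_smul]
  simp

/-- A strong solution is differentiable at interior times only; compressing the time interval turns
it into a tangential field on a neighbourhood of `[0,T]`. -/
theorem IsStrongSolution.isTangentField_timeAffine (hU : IsStrongSolution Ω T U)
    (hΩ : IsSmoothBoundedDomain Ω) {J : Set ℝ} {a b : ℝ} (hJ : ∀ s ∈ J, a * s + b ∈ Ioo 0 T) :
    IsTangentField Ω J (timeAffine a b U) := by
  obtain ⟨M, hM0, hM, hM'⟩ := hU.exists_bound hΩ
  have hd : ∀ w ∈ Ω ×ˢ J, DifferentiableAt ℝ U (w.1, a * w.2 + b) := fun w hw =>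
    hU.differentiableAt hΩ.isOpen ⟨hw.1, hJ _ hw.2⟩
  refine ⟨?_, ?_, ⟨M * (1 + |a|), by positivity, fun w hw => ⟨?_, ?_⟩⟩, fun w hw => ?_, ?_⟩
  · exact hU.contDiffOn_interior.comp (by fun_prop) fun w hw => ⟨hw.1, hJ _ hw.2⟩
  · exact hU.contDiffOn.continuousOn.comp (by fun_prop)
      fun w hw => ⟨hw.1, Ioo_subset_Icc_self (hJ _ hw.2)⟩
  · refine (hM _ (closure_prod_mem hw.1 (hJ _ hw.2))).trans ?_
    nlinarith [abs_nonneg a]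
  · rw [(hasFDerivAt_timeAffine (hd w hw)).fderiv]
    refine (ContinuousLinearMap.opNorm_comp_le _ _).trans
      (mul_le_mul (hM' _ ⟨hw.1, hJ _ hw.2⟩) ?_ (norm_nonneg _) hM0.le)
    refine ContinuousLinearMap.opNorm_le_bound _ (by positivity) fun y => ?_
    rw [ContinuousLinearMap.prod_apply, Prod.norm_def]
    refine max_le ?_ ?_
    · refine (norm_fst_le y).trans (le_mul_of_one_le_left (norm_nonneg _) ?_)
      linarith [abs_nonneg a]
    · simp only [smul_apply, norm_smul, Real.norm_eq_abs]
      exact mul_le_mul (by linarith) (norm_snd_le y) (abs_nonneg _) (by positivity)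
  · have hwd := hd w hw
    rw [spaceDeriv_timeAffine hwd, ← divergence_spaceSlice hwd]
    exact hU.div_free _ hw.1 _ (Ioo_subset_Icc_self (hJ _ hw.2))
  · intro x hx t ht ρ hρ
    have h1 := hU.slip x hx _ (Ioo_subset_Icc_self (hJ _ ht)) _ ⟨hx, ρ, hρ, rfl⟩
    rw [real_inner_smul_right, mul_eq_zero, inv_eq_zero, norm_eq_zero] at h1
    rw [real_inner_comm]
    exact h1.resolve_left hρ.2.1

lemma IsStrongSolution.integral_inner_gradient_eq_zero (hU : IsStrongSolution Ω T U)
    (hΩ : IsSmoothBoundedDomain Ω)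
    (hu : AEStronglyMeasurable u (volume.restrict (Ω ×ˢ Ioo 0 T)))
    (hv : IsTangentTrace Ω T u N v) {t : ℝ} (ht : t ∈ Ioo 0 T) {q : Plane → ℝ}
    (hq : ∀ x ∈ Ω, DifferentiableAt ℝ q x)
    (hq' : ContinuousOn (gradient q) Ω) {M : ℝ} (hM : ∀ x ∈ Ω, ‖gradient q x‖ ≤ M) :
    ∫ x in Ω, inner ℝ (gradient q x) (U (x, t)) = 0 := by
  have h1 := (hU.isTangentField_timeAffine hΩ (J := univ) (a := 0) (b := t)
    (fun s _ => by simpa using ht)).integral_inner_gradient_eq_zero hΩ isOpen_univ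
    (subset_univ _) hu hv (Ioo_subset_Icc_self ht) hq hq' hM
  simpa [timeAffine] using h1

/-- The weak formulation may be tested with a strong solution, by approximating it by its
compressions in time. -/
theorem IsStrongSolution.weak_form (hU : IsStrongSolution Ω T U) (hΩ : IsSmoothBoundedDomain Ω)
    (hu : MemLp u 2 (volume.restrict (Ω ×ˢ Ioo 0 T))) (hv : IsTangentTrace Ω T u N v)
    {u₀ : Plane → Plane} (hu₀ : MemLp u₀ 2 (volume.restrict Ω)) {τ : ℝ} (hτ : τ ∈ Ioo 0 T)
    (huτ : MemLp (fun x => u (x, τ)) 2 (volume.restrict Ω))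
    (hw : ∀ φ : Plane × ℝ → Plane, IsTestField Ω T φ →
      ∫ t in (0 : ℝ)..τ, ∫ x in Ω,
        (inner ℝ (deriv (fun s => φ (x, s)) t) (u (x, t))
          + gradContract (fun y => φ (y, t)) x (u (x, t)))
      = ∫ x in Ω, (inner ℝ (u (x, τ)) (φ (x, τ)) - inner ℝ (u₀ x) (φ (x, 0)))) :
    ∫ w in Ω ×ˢ Ioo 0 τ, (inner ℝ (timeDeriv U w) (u w) + inner ℝ (spaceDeriv U w (u w)) (u w))
      = ∫ x in Ω, (inner ℝ (u (x, τ)) (U (x, τ)) - inner ℝ (u₀ x) (U (x, 0))) := by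
  have hfin := hΩ.isFiniteMeasure
  have hm := hΩ.isOpen.measurableSet
  have hT : 0 < T := hτ.1.trans hτ.2
  obtain ⟨M, hM0, hM, hM'⟩ := hU.exists_bound hΩ
  -- affine maps sending `[0,T]` into `(0,T)` and tending to the identity
  set ε : ℕ → ℝ := fun n => 1 / ((n : ℝ) + 1) / 2 with hε
  have hε0 : ∀ n, 0 < ε n := fun n => by positivity
  have hε1 : ∀ n, ε n ≤ 1 / 2 := fun n => by
    have : 1 / ((n : ℝ) + 1) ≤ 1 := by
      rw [div_le_one (by positivity)]; linarith [n.cast_nonneg (α := ℝ)]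
    simp only [hε]; linarith
  have hεlim : Tendsto ε atTop (𝓝 0) := by
    have := (tendsto_one_div_add_atTop_nhds_zero_nat (𝕜 := ℝ)).div_const 2
    rwa [zero_div] at this
  set J : ℕ → Set ℝ := fun n => {s | (1 - ε n) * s + ε n * (T / 2) ∈ Ioo 0 T} with hJdef
  have hJ : ∀ n, IsOpen (J n) := fun n => isOpen_Ioo.preimage (by fun_prop)
  have hTJ : ∀ n, Icc 0 T ⊆ J n := by
    intro n s hs
    have h1 := hε0 n
    have h2 := hε1 n
    have h3 : 0 ≤ (1 - ε n) * s := mul_nonneg (by linarith) hs.1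
    have h4 : (1 - ε n) * s ≤ (1 - ε n) * T := mul_le_mul_of_nonneg_left hs.2 (by linarith)
    have h5 : 0 < ε n * T := by positivity
    exact ⟨by nlinarith, by nlinarith⟩
  have hlam : ∀ s, Tendsto (fun n => (1 - ε n) * s + ε n * (T / 2)) atTop (𝓝 s) := fun s => by
    simpa using ((hεlim.const_sub 1).mul_const s).add (hεlim.mul_const (T / 2))
  set V : ℕ → Plane × ℝ → Plane := fun n => timeAffine (1 - ε n) (ε n * (T / 2)) U with hV
  have hVt : ∀ n, IsTangentField Ω (J n) (V n) := fun n =>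
    hU.isTangentField_timeAffine hΩ fun s hs => hs
  have hid := fun n => weak_form_of_isTangentField hΩ (hJ n) (hTJ n) hu hv (hVt n) hu₀ hτ huτ hw
  have hQT : Ω ×ˢ Ioo 0 τ ⊆ Ω ×ˢ Ioo 0 T := prod_mono_right (Ioo_subset_Ioo_right hτ.2.le)
  set μ : Measure (Plane × ℝ) := volume.restrict (Ω ×ˢ Ioo 0 τ) with hμ
  have hμfin : IsFiniteMeasure μ := by
    rw [hμ, volume_restrict_prod]; infer_instance
  have huμ : MemLp u 2 μ := hu.mono_measure (Measure.restrict_mono hQT le_rfl)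
  have hui : Integrable u μ := huμ.integrable (by norm_num)
  have husq : Integrable (fun w => ‖u w‖ ^ 2) μ := huμ.integrable_norm_pow (by norm_num)
  have hmem : ∀ᵐ w ∂μ, w ∈ Ω ×ˢ Ioo 0 T :=
    (ae_restrict_mem (hm.prod measurableSet_Ioo)).mono fun w hw => hQT hw
  have hJmem : ∀ n, ∀ w ∈ Ω ×ˢ Ioo 0 T,
      (w.1, (1 - ε n) * w.2 + ε n * (T / 2)) ∈ Ω ×ˢ Ioo 0 T := fun n w hw =>
    ⟨hw.1, hTJ n (Ioo_subset_Icc_self hw.2)⟩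
  have hleft : Tendsto (fun n => ∫ w, (inner ℝ (timeDeriv (V n) w) (u w)
      + inner ℝ (spaceDeriv (V n) w (u w)) (u w)) ∂μ) atTop
      (𝓝 (∫ w, (inner ℝ (timeDeriv U w) (u w) + inner ℝ (spaceDeriv U w (u w)) (u w)) ∂μ)) := by
    refine tendsto_integral_of_dominated_convergence (fun w => M * ‖u w‖ + M * ‖u w‖ ^ 2)
      (fun n => (aestronglyMeasurable_inner_timeDeriv huμ.1 _).add
        (aestronglyMeasurable_inner_spaceDeriv huμ.1 _))
      ((hui.norm.const_mul M).add (husq.const_mul M)) (fun n => ?_) ?_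
    · filter_upwards [hmem] with w hw
      have hd := hU.differentiableAt hΩ.isOpen (hJmem n w hw)
      have hb := hM' _ (hJmem n w hw)
      refine (norm_add_le _ _).trans (add_le_add ?_ ?_)
      · refine (norm_inner_le_norm _ _).trans (mul_le_mul_of_nonneg_right ?_ (norm_nonneg _))
        rw [hV, timeDeriv_timeAffine hd, norm_smul, Real.norm_eq_abs,
          abs_of_nonneg (by linarith [hε1 n])]
        exact (mul_le_of_le_one_left (norm_nonneg _) (by linarith [hε0 n])).trans
          ((norm_timeDeriv_le _ _).trans hb)
      · refine (norm_inner_le_norm _ _).trans ?_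
        rw [hV, spaceDeriv_timeAffine hd, pow_two, ← mul_assoc]
        exact mul_le_mul_of_nonneg_right (ContinuousLinearMap.le_of_opNorm_le _
          ((norm_spaceDeriv_le _ _).trans hb) _) (norm_nonneg _)
    · filter_upwards [hmem] with w hw
      have hc : Tendsto (fun n => fderiv ℝ U (w.1, (1 - ε n) * w.2 + ε n * (T / 2))) atTop
          (𝓝 (fderiv ℝ U w)) := by
        have h1 := ((hU.continuousOn_fderiv hΩ.isOpen).continuousAt
          ((hΩ.isOpen.prod isOpen_Ioo).mem_nhds hw)).tendsto
        exact h1.comp (tendsto_const_nhds.prodMk_nhds (hlam w.2))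
      have h1 : ∀ n, timeDeriv (V n) w
          = (1 - ε n) • fderiv ℝ U (w.1, (1 - ε n) * w.2 + ε n * (T / 2)) (0, 1) := fun n =>
        timeDeriv_timeAffine (hU.differentiableAt hΩ.isOpen (hJmem n w hw))
      have h2 : ∀ n, spaceDeriv (V n) w (u w)
          = fderiv ℝ U (w.1, (1 - ε n) * w.2 + ε n * (T / 2)) (u w, 0) := fun n => by
        rw [hV, spaceDeriv_timeAffine (hU.differentiableAt hΩ.isOpen (hJmem n w hw))]; rfl
      have hca : ∀ y, Tendsto (fun n => fderiv ℝ U (w.1, (1 - ε n) * w.2 + ε n * (T / 2)) y) atTop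
          (𝓝 (fderiv ℝ U w y)) := fun y =>
        ((ContinuousLinearMap.apply ℝ Plane y).continuous.tendsto _).comp hc
      simp only [h1, h2]
      have h3 : Tendsto (fun n => 1 - ε n) atTop (𝓝 1) := by simpa using hεlim.const_sub 1
      have h4 := h3.smul (hca (0, 1))
      rw [one_smul] at h4
      exact (h4.inner tendsto_const_nhds).add ((hca (u w, 0)).inner tendsto_const_nhds)
  have hUc : ∀ t ∈ Icc 0 T, ∀ x ∈ Ω, Tendsto (fun n => V n (x, t)) atTop (𝓝 (U (x, t))) := by
    intro t ht x hx
    have h1 := hU.contDiffOn.continuousOn (x, t) ⟨subset_closure hx, ht⟩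
    refine h1.tendsto.comp (tendsto_nhdsWithin_iff.2
      ⟨tendsto_const_nhds.prodMk_nhds (hlam t), Eventually.of_forall fun n => ?_⟩)
    exact ⟨subset_closure hx, Ioo_subset_Icc_self (hTJ n ht)⟩
  have h0T : (0 : ℝ) ∈ Icc 0 T := ⟨le_rfl, hT.le⟩
  have hτT := Ioo_subset_Icc_self hτ
  have hright : Tendsto (fun n => ∫ x in Ω, (inner ℝ (u (x, τ)) (V n (x, τ))
      - inner ℝ (u₀ x) (V n (x, 0)))) atTop
      (𝓝 (∫ x in Ω, (inner ℝ (u (x, τ)) (U (x, τ)) - inner ℝ (u₀ x) (U (x, 0))))) := by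
    refine tendsto_integral_of_dominated_convergence
      (fun x => ‖u (x, τ)‖ * M + ‖u₀ x‖ * M) (fun n => ?_)
      (((huτ.integrable (by norm_num)).norm.mul_const M).add
        ((hu₀.integrable (by norm_num)).norm.mul_const M)) (fun n => ?_) ?_
    · exact (huτ.1.inner (((hVt n).continuousOn_slice
        (hTJ n hτT)).aestronglyMeasurable hm)).sub (hu₀.1.inner
        (((hVt n).continuousOn_slice (hTJ n h0T)).aestronglyMeasurable hm))
    · filter_upwards [ae_restrict_mem hm] with x hx
      have hb : ∀ t ∈ Icc 0 T, ‖V n (x, t)‖ ≤ M := fun t ht =>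
        hM _ (closure_prod_mem hx (hTJ n ht))
      refine (norm_sub_le _ _).trans (add_le_add ?_ ?_)
      · exact (norm_inner_le_norm _ _).trans
          (mul_le_mul_of_nonneg_left (hb τ hτT) (norm_nonneg _))
      · exact (norm_inner_le_norm _ _).trans
          (mul_le_mul_of_nonneg_left (hb 0 h0T) (norm_nonneg _))
    · filter_upwards [ae_restrict_mem hm] with x hx
      exact (tendsto_const_nhds.inner (hUc τ hτT x hx)).sub
        (tendsto_const_nhds.inner (hUc 0 h0T x hx))
  simp only [hid] at hleft
  exact tendsto_nhds_unique hleft hright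

end

end Euler2D

/-! ### Relative energy -/

namespace Euler2D

open Filter Topology

/-- A form of Grönwall's inequality that does not require continuity. -/
lemma ae_le_zero_of_ae_le_integral {T C : ℝ} {F : ℝ → ℝ} (hC : 0 ≤ C)
    (hF : IntegrableOn F (Ioo 0 T)) (h0 : ∀ t, 0 ≤ F t)
    (h : ∀ᵐ τ ∂volume.restrict (Ioo 0 T), F τ ≤ C * ∫ t in Ioo 0 τ, F t) :
    ∀ᵐ τ ∂volume.restrict (Ioo 0 T), F τ ≤ 0 := by
  set K := C * ∫ t in Ioo 0 T, F t with hK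
  -- iterating the inequality `n` times
  have hn : ∀ n : ℕ, ∀ᵐ τ ∂volume.restrict (Ioo 0 T), F τ ≤ K * ((C * τ) ^ n / n.factorial) := by
    intro n
    induction n with
    | zero =>
      filter_upwards [h, ae_restrict_mem measurableSet_Ioo] with τ hτ hτT
      refine hτ.trans ?_
      simp only [pow_zero, Nat.factorial_zero, Nat.cast_one, div_one, mul_one]
      exact mul_le_mul_of_nonneg_left (setIntegral_mono_set hF (ae_of_all _ h0)
        (Ioo_subset_Ioo_right hτT.2.le).eventuallyLE) hC
    | succ n ih =>
      filter_upwards [h, ae_restrict_mem measurableSet_Ioo] with τ hτ hτT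
      have hsub : Ioo 0 τ ⊆ Ioo 0 T := Ioo_subset_Ioo_right hτT.2.le
      have h1 : ∫ t in Ioo 0 τ, F t ≤ ∫ t in Ioo 0 τ, K * ((C * t) ^ n / n.factorial) := by
        refine integral_mono_ae (hF.mono_set hsub) ?_ (ae_restrict_of_ae_restrict_of_subset hsub ih)
        exact (Continuous.integrableOn_Icc (by fun_prop)).mono_set Ioo_subset_Icc_self
      have h2 : ∫ t in Ioo 0 τ, K * ((C * t) ^ n / n.factorial)
          = K * C ^ n / n.factorial * (τ ^ (n + 1) / (n + 1)) := by
        rw [← integral_Ioc_eq_integral_Ioo, ← intervalIntegral.integral_of_le hτT.1.le]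
        have : ∀ t : ℝ, K * ((C * t) ^ n / n.factorial) = K * C ^ n / n.factorial * t ^ n :=
          fun t => by rw [mul_pow]; ring
        simp only [this, intervalIntegral.integral_const_mul, integral_pow]
        simp
      refine (hτ.trans (mul_le_mul_of_nonneg_left (h1.trans h2.le) hC)).trans (le_of_eq ?_)
      rw [Nat.factorial_succ, mul_pow]
      push_cast
      field_simp
      ring
  filter_upwards [ae_all_iff.2 hn] with τ hτ
  have hlim := (FloorSemiring.tendsto_pow_div_factorial_atTop (C * τ)).const_mul K
  rw [mul_zero] at hlim
  exact ge_of_tendsto' hlim hτ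

section
variable {Ω : Set Plane} {T : ℝ} {U u v : Plane × ℝ → Plane} {N : Set (Plane × ℝ)}

/-- The pressure gradient and the gradient of `|U|²` drop out at each time. -/
lemma IsStrongSolution.integral_residual_eq_zero (hU : IsStrongSolution Ω T U)
    (hΩ : IsSmoothBoundedDomain Ω)
    (hu : AEStronglyMeasurable u (volume.restrict (Ω ×ˢ Ioo 0 T)))
    (hv : IsTangentTrace Ω T u N v) {t : ℝ} (ht : t ∈ Ioo 0 T)
    (hut : MemSolenoidal Ω (fun x => u (x, t))) :
    ∫ x in Ω, (inner ℝ (timeDeriv U (x, t)) (U (x, t) - u (x, t))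
      - inner ℝ (spaceDeriv U (x, t) (u (x, t))) (u (x, t))
      + inner ℝ (spaceDeriv U (x, t) (u (x, t) - U (x, t))) (u (x, t) - U (x, t))) = 0 := by
  have hfin := hΩ.isFiniteMeasure
  have hm := hΩ.isOpen.measurableSet
  obtain ⟨M, hM0, hM, hM'⟩ := hU.exists_bound hΩ
  obtain ⟨p, hp⟩ := hU.momentum
  have hd : ∀ x ∈ Ω, DifferentiableAt ℝ U (x, t) := fun x hx =>
    hU.differentiableAt hΩ.isOpen ⟨hx, ht⟩
  have hUb : ∀ x ∈ Ω, ‖U (x, t)‖ ≤ M := fun x hx => hM _ (closure_prod_mem hx ht)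
  have hDb : ∀ x ∈ Ω, ‖spaceDeriv U (x, t)‖ ≤ M := fun x hx =>
    (norm_spaceDeriv_le _ _).trans (hM' _ ⟨hx, ht⟩)
  have hUc : ContDiffOn ℝ 1 (fun x => U (x, t)) Ω :=
    hU.contDiffOn_interior.comp (by fun_prop) fun x hx => ⟨hx, ht⟩
  have hDc : ContinuousOn (fun x => fderiv ℝ U (x, t)) Ω :=
    (hU.continuousOn_fderiv hΩ.isOpen).comp (by fun_prop) fun x hx => ⟨hx, ht⟩
  -- the pressure gradient
  set q : Plane → ℝ := fun x => p (x, t) with hq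
  have hqG : ∀ x ∈ Ω, gradient q x
      = -(timeDeriv U (x, t) + spaceDeriv U (x, t) (U (x, t))) := by
    intro x hx
    have h1 := (hp x hx t ht).2
    rw [(hasDerivAt_timeSlice (hd x hx)).deriv, divTensorSelf_eq (hasFDerivAt_spaceSlice (hd x hx))
      ((divergence_spaceSlice (hd x hx)).symm.trans
        (hU.div_free x hx t (Ioo_subset_Icc_self ht)))] at h1
    exact eq_neg_of_add_eq_zero_right h1
  have hqc : ContinuousOn (gradient q) Ω := by
    refine ContinuousOn.congr ?_ hqG
    simp only [timeDeriv, spaceDeriv_apply]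
    exact ((hDc.clm_apply continuousOn_const).add
      (hDc.clm_apply (hUc.continuousOn.prodMk continuousOn_const))).neg
  have hqb : ∀ x ∈ Ω, ‖gradient q x‖ ≤ M + M * M := by
    intro x hx
    rw [hqG x hx, norm_neg]
    refine (norm_add_le _ _).trans (add_le_add ((norm_timeDeriv_le _ _).trans (hM' _ ⟨hx, ht⟩)) ?_)
    exact ((spaceDeriv U (x, t)).le_opNorm _).trans
      (mul_le_mul (hDb x hx) (hUb x hx) (norm_nonneg _) hM0.le)
  have hqd : ∀ x ∈ Ω, DifferentiableAt ℝ q x := fun x hx => (hp x hx t ht).1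
  -- the gradient of the kinetic energy density
  set k : Plane → ℝ := fun x => ‖U (x, t)‖ ^ 2 with hk
  have hkd : ∀ x ∈ Ω, HasFDerivAt k
      (2 • (innerSL ℝ (U (x, t))).comp (spaceDeriv U (x, t))) x := fun x hx =>
    (hasFDerivAt_spaceSlice (hd x hx)).norm_sq
  have hkc : ContinuousOn (gradient k) Ω :=
    (InnerProductSpace.toDual ℝ Plane).symm.continuous.comp_continuousOn
      ((hUc.norm_sq ℝ).continuousOn_fderiv_of_isOpen hΩ.isOpen (by simp))
  have hki : ∀ x ∈ Ω, ∀ a, inner ℝ (gradient k x) a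
      = 2 * inner ℝ (spaceDeriv U (x, t) a) (U (x, t)) := by
    intro x hx a
    rw [inner_gradient_left, (hkd x hx).fderiv, real_inner_comm]
    simp
  have hkb : ∀ x ∈ Ω, ‖gradient k x‖ ≤ 2 * (M * M) := by
    intro x hx
    rw [gradient, LinearIsometryEquiv.norm_map, (hkd x hx).fderiv]
    refine ContinuousLinearMap.opNorm_le_bound _ (by positivity) fun a => ?_
    simp only [smul_apply, ContinuousLinearMap.comp_apply, innerSL_apply_apply, nsmul_eq_mul,
      Nat.cast_ofNat, norm_mul, Real.norm_ofNat]
    rw [mul_assoc, mul_assoc]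
    refine mul_le_mul_of_nonneg_left ((norm_inner_le_norm _ _).trans ?_) zero_le_two
    exact mul_le_mul (hUb x hx) (ContinuousLinearMap.le_of_opNorm_le _ (hDb x hx) a)
      (norm_nonneg _) hM0.le
  have h1 := hU.integral_inner_gradient_eq_zero hΩ hu hv ht hqd hqc hqb
  have h2 := hut.integral_inner_gradient hΩ.isOpen hΩ.isBounded hqd hqc hqb
  have h3 := hut.integral_inner_gradient hΩ.isOpen hΩ.isBounded
    (fun x hx => (hkd x hx).differentiableAt) hkc hkb
  have hbdd : ∀ (F : Plane → Plane) (B : ℝ), ContinuousOn F Ω → (∀ x ∈ Ω, ‖F x‖ ≤ B) →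
      MemLp F 2 (volume.restrict Ω) := fun F B hF hB =>
    MemLp.of_bound (hF.aestronglyMeasurable hm) B
      ((ae_restrict_iff' hm).2 (Eventually.of_forall hB))
  have hqL := hbdd _ _ hqc hqb
  have hi1 := integrable_inner_of_memLp hqL (hbdd _ _ hUc.continuousOn hUb)
  have hi2 := integrable_inner_of_memLp hqL hut.1
  have hi3 := (integrable_inner_of_memLp (hbdd _ _ hkc hkb) hut.1).const_mul (1 / 2)
  have hi21 : Integrable (fun x => inner ℝ (gradient q x) (u (x, t))
    - inner ℝ (gradient q x) (U (x, t))) (volume.restrict Ω) := hi2.sub hi1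
  calc _ = ∫ x in Ω, (inner ℝ (gradient q x) (u (x, t)) - inner ℝ (gradient q x) (U (x, t))
        - 1 / 2 * inner ℝ (gradient k x) (u (x, t))) := by
        refine setIntegral_congr_fun hm fun x hx => ?_
        simp only [hqG x hx, hki x hx, map_sub, inner_sub_left, inner_sub_right, inner_neg_left,
          inner_add_left]
        ring
    _ = 0 := by
        rw [integral_sub hi21 hi3, integral_sub hi2 hi1, integral_const_mul, h1, h2, h3]
        ring

lemma IsStrongSolution.aestronglyMeasurable (hU : IsStrongSolution Ω T U) (hΩ : IsOpen Ω) :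
    AEStronglyMeasurable U (volume.restrict (Ω ×ˢ Ioo 0 T)) :=
  hU.contDiffOn_interior.continuousOn.aestronglyMeasurable
    (hΩ.measurableSet.prod measurableSet_Ioo)

lemma IsStrongSolution.memLp_slice (hU : IsStrongSolution Ω T U) (hΩ : IsSmoothBoundedDomain Ω)
    {t : ℝ} (ht : t ∈ Icc 0 T) : MemLp (fun x => U (x, t)) 2 (volume.restrict Ω) := by
  have hfin := hΩ.isFiniteMeasure
  have hm := hΩ.isOpen.measurableSet
  obtain ⟨M, -, hM, -⟩ := hU.exists_bound hΩ
  refine MemLp.of_bound (ContinuousOn.aestronglyMeasurable ?_ hm) M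
    ((ae_restrict_iff' hm).2 (Eventually.of_forall fun x hx => hM _ ⟨subset_closure hx, ht⟩))
  exact hU.contDiffOn.continuousOn.comp (by fun_prop) fun x hx => ⟨subset_closure hx, ht⟩

lemma IsStrongSolution.integrable_inner_timeDeriv (hU : IsStrongSolution Ω T U)
    (hΩ : IsSmoothBoundedDomain Ω) {τ : ℝ} (hτ : τ ∈ Ioo 0 T) {F : Plane × ℝ → Plane}
    (hF : Integrable F (volume.restrict (Ω ×ˢ Ioo 0 τ))) :
    Integrable (fun w => inner ℝ (timeDeriv U w) (F w)) (volume.restrict (Ω ×ˢ Ioo 0 τ)) := by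
  obtain ⟨M, -, -, hM⟩ := hU.exists_bound hΩ
  refine (hF.norm.const_mul M).mono' (aestronglyMeasurable_inner_timeDeriv hF.1 U) ?_
  filter_upwards [ae_restrict_mem (hΩ.isOpen.measurableSet.prod measurableSet_Ioo)] with w hw
  exact (norm_inner_le_norm _ _).trans (mul_le_mul_of_nonneg_right ((norm_timeDeriv_le _ _).trans
    (hM w ⟨hw.1, Ioo_subset_Ioo_right hτ.2.le hw.2⟩)) (norm_nonneg _))

lemma abs_inner_spaceDeriv_le {M : ℝ} {w : Plane × ℝ} (h : ‖fderiv ℝ U w‖ ≤ M) (a : Plane) :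
    |inner ℝ (spaceDeriv U w a) a| ≤ M * ‖a‖ ^ 2 := by
  refine (abs_real_inner_le_norm _ _).trans ?_
  rw [pow_two, ← mul_assoc]
  exact mul_le_mul_of_nonneg_right (ContinuousLinearMap.le_of_opNorm_le _
    ((norm_spaceDeriv_le _ _).trans h) a) (norm_nonneg _)

lemma IsStrongSolution.integrable_inner_spaceDeriv (hU : IsStrongSolution Ω T U)
    (hΩ : IsSmoothBoundedDomain Ω) {τ : ℝ} (hτ : τ ∈ Ioo 0 T) {F : Plane × ℝ → Plane}
    (hF : MemLp F 2 (volume.restrict (Ω ×ˢ Ioo 0 τ))) :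
    Integrable (fun w => inner ℝ (spaceDeriv U w (F w)) (F w))
      (volume.restrict (Ω ×ˢ Ioo 0 τ)) := by
  obtain ⟨M, -, -, hM⟩ := hU.exists_bound hΩ
  refine ((hF.integrable_norm_pow (by norm_num)).const_mul M).mono'
    (aestronglyMeasurable_inner_spaceDeriv hF.1 U) ?_
  filter_upwards [ae_restrict_mem (hΩ.isOpen.measurableSet.prod measurableSet_Ioo)] with w hw
  exact abs_inner_spaceDeriv_le (hM w ⟨hw.1, Ioo_subset_Ioo_right hτ.2.le hw.2⟩) _

/-- The balance of the kinetic energy, before the momentum equation is used. -/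
lemma IsStrongSolution.integral_norm_sq_sub (hU : IsStrongSolution Ω T U)
    (hΩ : IsSmoothBoundedDomain Ω) {τ : ℝ} (hτ : τ ∈ Ioo 0 T)
    (hUi : Integrable U (volume.restrict (Ω ×ˢ Ioo 0 τ))) :
    (∫ x in Ω, ‖U (x, τ)‖ ^ 2) - ∫ x in Ω, ‖U (x, 0)‖ ^ 2
      = 2 * ∫ w in Ω ×ˢ Ioo 0 τ, inner ℝ (timeDeriv U w) (U w) := by
  have hm := hΩ.isOpen.measurableSet
  have h0 : (0 : ℝ) ∈ Icc 0 T := ⟨le_rfl, (hτ.1.trans hτ.2).le⟩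
  have hi := hU.integrable_inner_timeDeriv hΩ hτ hUi
  rw [← integral_sub ((hU.memLp_slice hΩ (Ioo_subset_Icc_self hτ)).integrable_norm_pow
    (by norm_num)) ((hU.memLp_slice hΩ h0).integrable_norm_pow (by norm_num)),
    ← integral_const_mul]
  have hi' := hi.const_mul 2
  rw [volume_restrict_prod] at hi' ⊢
  rw [integral_prod _ hi']
  refine integral_congr_ae ?_
  filter_upwards [hi'.prod_right_ae, ae_restrict_mem hm] with x hxi hx
  rw [← integral_Ioc_eq_integral_Ioo, ← intervalIntegral.integral_of_le hτ.1.le]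
  refine (intervalIntegral.integral_eq_sub_of_hasDerivAt_of_le
    (f := fun t => ‖U (x, t)‖ ^ 2) hτ.1.le ?_ (fun t ht => ?_) ?_).symm
  · refine (ContinuousOn.norm ?_).pow 2
    exact hU.contDiffOn.continuousOn.comp (by fun_prop) fun t ht =>
      ⟨subset_closure hx, Icc_subset_Icc_right hτ.2.le ht⟩
  · have h1 := (hasDerivAt_timeSlice (hU.differentiableAt hΩ.isOpen
      (w := (x, t)) ⟨hx, Ioo_subset_Ioo_right hτ.2.le ht⟩)).norm_sq
    rwa [real_inner_comm] at h1
  · rw [intervalIntegrable_iff_integrableOn_Ioo_of_le hτ.1.le]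
    exact hxi

/-- The relative energy inequality: combination of the energy inequality for `u`, the energy balance
of `U`, and the weak formulation tested with `U`. -/
theorem IsStrongSolution.relative_energy_le (hU : IsStrongSolution Ω T U)
    (hΩ : IsSmoothBoundedDomain Ω) (hu : MemLp u 2 (volume.restrict (Ω ×ˢ Ioo 0 T)))
    (hus : ∀ᵐ t ∂volume.restrict (Ioo 0 T), MemSolenoidal Ω (fun x => u (x, t)))
    (hv : IsTangentTrace Ω T u N v) {u₀ : Plane → Plane} (hu₀ : MemLp u₀ 2 (volume.restrict Ω))
    (hU₀ : ∀ᵐ x ∂volume.restrict Ω, U (x, 0) = u₀ x) {M : ℝ}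
    (hM : ∀ w ∈ Ω ×ˢ Ioo 0 T, ‖fderiv ℝ U w‖ ≤ M) {τ : ℝ} (hτ : τ ∈ Ioo 0 T)
    (huτ : MemLp (fun x => u (x, τ)) 2 (volume.restrict Ω))
    (hw : ∀ φ : Plane × ℝ → Plane, IsTestField Ω T φ →
      ∫ t in (0 : ℝ)..τ, ∫ x in Ω,
        (inner ℝ (deriv (fun s => φ (x, s)) t) (u (x, t))
          + gradContract (fun y => φ (y, t)) x (u (x, t)))
      = ∫ x in Ω, (inner ℝ (u (x, τ)) (φ (x, τ)) - inner ℝ (u₀ x) (φ (x, 0))))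
    (hE : 1 / 2 * ∫ x in Ω, ‖u (x, τ)‖ ^ 2 ≤ 1 / 2 * ∫ x in Ω, ‖u₀ x‖ ^ 2) :
    ∫ x in Ω, ‖u (x, τ) - U (x, τ)‖ ^ 2
      ≤ 2 * M * ∫ w in Ω ×ˢ Ioo 0 τ, ‖u w - U w‖ ^ 2 := by
  have hfin := hΩ.isFiniteMeasure
  have hm := hΩ.isOpen.measurableSet
  have h0T : (0 : ℝ) ∈ Icc 0 T := ⟨le_rfl, (hτ.1.trans hτ.2).le⟩
  have hτT := Ioo_subset_Icc_self hτ
  have hQT : Ω ×ˢ Ioo 0 τ ⊆ Ω ×ˢ Ioo 0 T := prod_mono_right (Ioo_subset_Ioo_right hτ.2.le)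
  have hweak := hU.weak_form hΩ hu hv hu₀ hτ huτ hw
  set μ : Measure (Plane × ℝ) := volume.restrict (Ω ×ˢ Ioo 0 τ) with hμ
  have hμfin : IsFiniteMeasure μ := by
    rw [hμ, volume_restrict_prod]; infer_instance
  have hmem : ∀ᵐ w ∂μ, w ∈ Ω ×ˢ Ioo 0 T :=
    (ae_restrict_mem (hm.prod measurableSet_Ioo)).mono fun w hw => hQT hw
  have huμ : MemLp u 2 μ := hu.mono_measure (Measure.restrict_mono hQT le_rfl)
  have hUμ : MemLp U 2 μ := by
    obtain ⟨B, -, hB, -⟩ := hU.exists_bound hΩ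
    refine MemLp.of_bound ((hU.aestronglyMeasurable hΩ.isOpen).mono_measure
      (Measure.restrict_mono hQT le_rfl)) B ?_
    filter_upwards [hmem] with w hw
    exact hB w (closure_prod_mem hw.1 hw.2)
  have hwμ : MemLp (fun w => u w - U w) 2 μ := huμ.sub hUμ
  have hui := huμ.integrable (q := 2) (by norm_num)
  have hUi := hUμ.integrable (q := 2) (by norm_num)
  have hbal := hU.integral_norm_sq_sub hΩ hτ hUi
  have hItU := hU.integrable_inner_timeDeriv hΩ hτ hUi
  have hItu := hU.integrable_inner_timeDeriv hΩ hτ hui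
  have hIxu := hU.integrable_inner_spaceDeriv hΩ hτ huμ
  have hIxw := hU.integrable_inner_spaceDeriv hΩ hτ hwμ
  -- the residual integrates to zero
  have hres : ∫ w, (inner ℝ (timeDeriv U w) (U w) - inner ℝ (timeDeriv U w) (u w)
      - inner ℝ (spaceDeriv U w (u w)) (u w)
      + inner ℝ (spaceDeriv U w (u w - U w)) (u w - U w)) ∂μ = 0 := by
    have hi : Integrable (fun w => inner ℝ (timeDeriv U w) (U w) - inner ℝ (timeDeriv U w) (u w)
      - inner ℝ (spaceDeriv U w (u w)) (u w)
      + inner ℝ (spaceDeriv U w (u w - U w)) (u w - U w)) μ :=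
      ((hItU.sub hItu).sub hIxu).add hIxw
    rw [hμ, volume_restrict_prod] at hi ⊢
    rw [integral_prod_symm _ hi]
    refine integral_eq_zero_of_ae ?_
    filter_upwards [ae_restrict_of_ae_restrict_of_subset (Ioo_subset_Ioo_right hτ.2.le) hus,
      ae_restrict_mem measurableSet_Ioo] with t hts ht
    have h1 := hU.integral_residual_eq_zero hΩ hu.1 hv (Ioo_subset_Ioo_right hτ.2.le ht) hts
    simp only [inner_sub_right (timeDeriv U _)] at h1
    exact h1
  have hsplit : ∫ w, (inner ℝ (timeDeriv U w) (U w) - inner ℝ (timeDeriv U w) (u w)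
      - inner ℝ (spaceDeriv U w (u w)) (u w)
      + inner ℝ (spaceDeriv U w (u w - U w)) (u w - U w)) ∂μ
      = (∫ w, inner ℝ (timeDeriv U w) (U w) ∂μ)
        - (∫ w, (inner ℝ (timeDeriv U w) (u w) + inner ℝ (spaceDeriv U w (u w)) (u w)) ∂μ)
        + ∫ w, inner ℝ (spaceDeriv U w (u w - U w)) (u w - U w) ∂μ := by
    have hs : Integrable (fun w => inner ℝ (timeDeriv U w) (u w)
      + inner ℝ (spaceDeriv U w (u w)) (u w)) μ := hItu.add hIxu
    have hs' : Integrable (fun w => inner ℝ (timeDeriv U w) (U w) - (inner ℝ (timeDeriv U w) (u w)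
      + inner ℝ (spaceDeriv U w (u w)) (u w))) μ := hItU.sub hs
    rw [← integral_sub hItU hs, ← integral_add hs' hIxw]
    exact integral_congr_ae (ae_of_all _ fun w => by ring)
  have hlow : -(M * ∫ w, ‖u w - U w‖ ^ 2 ∂μ)
      ≤ ∫ w, inner ℝ (spaceDeriv U w (u w - U w)) (u w - U w) ∂μ := by
    rw [← integral_const_mul, ← integral_neg]
    refine integral_mono_ae ((hwμ.integrable_norm_pow (by norm_num)).const_mul M).neg hIxw ?_
    filter_upwards [hmem] with w hw
    exact (abs_le.1 (abs_inner_spaceDeriv_le (hM w hw) _)).1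
  -- expansion of the relative energy at time `τ`
  have hUτ := hU.memLp_slice hΩ hτT
  have hexp : ∫ x in Ω, ‖u (x, τ) - U (x, τ)‖ ^ 2 = (∫ x in Ω, ‖u (x, τ)‖ ^ 2)
      - 2 * (∫ x in Ω, inner ℝ (u (x, τ)) (U (x, τ))) + ∫ x in Ω, ‖U (x, τ)‖ ^ 2 := by
    have e1 : Integrable (fun x => ‖u (x, τ)‖ ^ 2) (volume.restrict Ω) :=
      huτ.integrable_norm_pow (by norm_num)
    have e2 : Integrable (fun x => ‖U (x, τ)‖ ^ 2) (volume.restrict Ω) :=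
      hUτ.integrable_norm_pow (by norm_num)
    have e3 := (integrable_inner_of_memLp huτ hUτ).const_mul 2
    have e4 : Integrable (fun x => ‖u (x, τ)‖ ^ 2 - 2 * inner ℝ (u (x, τ)) (U (x, τ)))
      (volume.restrict Ω) := e1.sub e3
    rw [← integral_const_mul, ← integral_sub e1 e3, ← integral_add e4 e2]
    exact integral_congr_ae (ae_of_all _ fun x => norm_sub_sq_real _ _)
  have hinit : ∫ x in Ω, inner ℝ (u₀ x) (U (x, 0)) = ∫ x in Ω, ‖u₀ x‖ ^ 2 := by
    refine integral_congr_ae ?_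
    filter_upwards [hU₀] with x hx
    rw [hx, real_inner_self_eq_norm_sq]
  have hinit' : ∫ x in Ω, ‖U (x, 0)‖ ^ 2 = ∫ x in Ω, ‖u₀ x‖ ^ 2 := by
    refine integral_congr_ae ?_
    filter_upwards [hU₀] with x hx
    rw [hx]
  rw [integral_sub (integrable_inner_of_memLp huτ hUτ)
    (integrable_inner_of_memLp hu₀ (hU.memLp_slice hΩ h0T)), hinit] at hweak
  rw [hsplit] at hres
  linarith

end

end Euler2D

theorem mainTheorem5 (Ω : Set Euler2D.Plane) (hΩ : Euler2D.IsSmoothBoundedDomain Ω)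
    (T : ℝ) (hT : 0 < T)
    (u₀ : Euler2D.Plane → Euler2D.Plane) (U u : Euler2D.Plane × ℝ → Euler2D.Plane)
    (hU : Euler2D.IsStrongSolution Ω T U)
    (hU₀ : ∀ᵐ x ∂(volume.restrict Ω), U (x, 0) = u₀ x)
    (hu : Euler2D.IsAdmissibleWeakSolution Ω T u₀ u)
    (hcont : Euler2D.IsContinuousNearBoundary Ω T u) :
    ∀ᵐ z ∂(volume.restrict (Ω ×ˢ Ioo 0 T)), u z = U z := by
  have hfin := hΩ.isFiniteMeasure
  obtain ⟨N, v, hv⟩ := Euler2D.exists_isTangentTrace hΩ hT hu.mem hcont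
  obtain ⟨M, hM0, hMU, hM⟩ := hU.exists_bound hΩ
  have hu2 := Euler2D.memLp_two_of_memLinftySolenoidal hu.mem
  have hμfin : IsFiniteMeasure (volume.restrict (Ω ×ˢ Ioo 0 T)) := by
    rw [Euler2D.volume_restrict_prod]; infer_instance
  have hU2 : MemLp U 2 (volume.restrict (Ω ×ˢ Ioo 0 T)) := by
    refine MemLp.of_bound (hU.aestronglyMeasurable hΩ.isOpen) M ?_
    filter_upwards [ae_restrict_mem (hΩ.isOpen.measurableSet.prod measurableSet_Ioo)] with w hw
    exact hMU w (Euler2D.closure_prod_mem hw.1 hw.2)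
  have hw : Integrable (fun w => ‖u w - U w‖ ^ 2) (volume.restrict (Ω ×ˢ Ioo 0 T)) :=
    (hu2.sub hU2).integrable_norm_pow (by norm_num)
  -- twice the relative energy
  set F : ℝ → ℝ := fun t => ∫ x in Ω, ‖u (x, t) - U (x, t)‖ ^ 2 with hF
  have hF0 : ∀ t, 0 ≤ F t := fun t => integral_nonneg fun x => by positivity
  have hFubini : ∀ τ ≤ T, ∫ w in Ω ×ˢ Ioo 0 τ, ‖u w - U w‖ ^ 2 = ∫ t in Ioo 0 τ, F t := by
    intro τ hτ
    have hsub : Ω ×ˢ Ioo 0 τ ⊆ Ω ×ˢ Ioo 0 T := prod_mono_right (Ioo_subset_Ioo_right hτ)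
    have hi := hw.mono_measure (Measure.restrict_mono hsub le_rfl)
    rw [Euler2D.volume_restrict_prod] at hi ⊢
    exact integral_prod_symm _ hi
  have hFi : IntegrableOn F (Ioo 0 T) := by
    have hi := hw
    rw [Euler2D.volume_restrict_prod] at hi
    exact hi.integral_prod_right
  have hle : ∀ᵐ τ ∂volume.restrict (Ioo 0 T), F τ ≤ 2 * M * ∫ t in Ioo 0 τ, F t := by
    filter_upwards [hu.weak_form, hu.energy_ineq, hu.mem.2.1, ae_restrict_mem measurableSet_Ioo]
      with τ hτw hτe hτs hτ
    rw [← hFubini τ hτ.2.le]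
    exact hU.relative_energy_le hΩ hu2 hu.mem.2.1 hv hu.initial_mem.1 hU₀ hM hτ hτs.1 hτw hτe
  have hzero := Euler2D.ae_le_zero_of_ae_le_integral (by positivity) hFi hF0 hle
  have hint : ∫ w in Ω ×ˢ Ioo 0 T, ‖u w - U w‖ ^ 2 = 0 := by
    rw [hFubini T le_rfl]
    exact integral_eq_zero_of_ae (hzero.mono fun t ht => le_antisymm ht (hF0 t))
  filter_upwards [(integral_eq_zero_iff_of_nonneg (fun w => by positivity) hw).1 hint] with w hw0
  have h1 : ‖u w - U w‖ ^ 2 = 0 := hw0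
  exact sub_eq_zero.1 (norm_eq_zero.1 (pow_eq_zero_iff (by norm_num) |>.1 h1))
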